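/- **Setting.** A contour is a finite union of oriented, bounded, regular smooth arcs that meet only at their ends; different arc ends at the same point leave it in different directions, so they have a counter-clockwise order. Functions are $2\times2$-matrix valued and may take a different value on each arc at a junction; $C(\Gamma)$, $L^p(\Gamma)$, $H^s(\Gamma)$, $W^{1,\infty}(\Gamma)$ are defined arc by arc (with respect to $|dk|$), and $H^1_z(\Gamma)$ is the set of $f\in H^1(\Gamma)$ such that at every point the sum of the end values over arcs ending there equals the sum over arcs starting there. Let $\mathcal C_\Gamma u(z)=\frac1{2\pi i}\int_\Gamma\frac{u(s)}{s-z}ds$, let $\mathcal C^-_\Gamma u$ be its boundary value from the right, and put $\mathcal T[G;\Gamma]u=\mathcal C_\Gamma^-u\,(G-I)$, $\mathcal C[G;\Gamma]u=u-\mathcal T[G;\Gamma]u$. The problem $[G;\Gamma]$ is *1-regular* if $G$ is invertible, $G-I$ and $G^{-1}-I$ lie in $W^{1,\infty}(\Gamma)\cap H^1(\Gamma)$, and at each point the counter-clockwise product of the values of $G$ (on outgoing arcs) and $G^{-1}$ (on incoming arcs) is $I$. It is *well posed* if $G-I\in L^2(\Gamma)$ and $\mathcal C[G;\Gamma]$ has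 a bounded inverse on $L^2(\Gamma)$. **Numerical method.** Let $\mathcal I_n$ (on $H^1(\Gamma)$, extended to $C(\Gamma)$) and $\mathcal P_n$ (on $H^1_z(\Gamma)$) be finite-rank projections, $X_n=\operatorname{ran}\mathcal P_n$, $\mathcal C_n[G;\Gamma]=\mathcal I_n\mathcal C[G;\Gamma]$, $\mathcal T_n[G;\Gamma]=\mathcal I_n\mathcal T[G;\Gamma]$ and $Y_n[G]=\mathcal I_n\big(\mathcal C[G;\Gamma]H^1_z(\Gamma)+\mathbb C(G-I)\big)$. Call $\mathcal C_n[G;\Gamma]$ *invertible* if it is a bijection $X_n\to Y_n[G]$; then $u_n=\mathcal C_n[G;\Gamma]^{-1}\mathcal I_n(G-I)$. The method is *admissible* if * there are real $\alpha,\beta,\gamma,C_1,C_2,C_3$ such that for each 1-regular well-posed $[G;\Gamma]$ there is $N$ (which may depend on $G$) such that for $n>N$: $\mathcal C_n[G;\Gamma]$ is invertible, $\|\mathcal C_n[G;\Gamma]\|_{H^1_z\to L^2}\le C_1n^\alpha(1+\|G-I\|_{L^\infty}\|\mathcal C^-_\Gamma\|)$, $\|\mathcal C_n[G;\Gamma]^{-1}\|_{L^2\to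 L^2}\le C_2n^\beta\|\mathcal C[G;\Gamma]^{-1}\|$ and $\|\mathcal T_n[G;\Gamma]|_{X_n}\|_{L^2\to L^2}\le C_3n^\gamma\|G-I\|_{L^\infty}\|\mathcal C_\Gamma^-\|$ (norms without subscript are on $L^2(\Gamma)$); * for each $r$ there is $s$ such that $n^r\|\mathcal I_nu-u\|_{H^1}\to0$ for $u\in H^s(\Gamma)$, and $n^r\|\mathcal P_nu-u\|_{H^1}\to0$ for $u\in H^s(\Gamma)\cap H^1_z(\Gamma)$; * $\|\mathcal I_nf\|_{L^2}\le K\|f\|_{C(\Gamma)}$ with $K$ independent of $n$ and of $f\in C(\Gamma)$; * for all large $n$ and all 1-regular $G$, $\dim Y_n[G]\le\dim X_n$ (the discrete equation has no more equations than unknowns). **Family of problems.** Let $\Omega_1,\dots,\Omega_\ell$ be contours, each with an admissible method. For $\xi\ge0$ let $\Gamma^\xi=\Gamma_1^\xi\cup\dots\cup\Gamma_\ell^\xi$ with $\Gamma_i^\xi=\alpha_i(\xi)\Omega_i+\beta_i(\xi)$ pairwise disjoint, where $\alpha_i,\beta_i:[0,\infty)\to\mathbb C$ are continuous and $\alpha_i(\xi)\neq0$.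 Let $[G^\xi;\Gamma^\xi]$ be 1-regular for every $\xi\ge0$ and put $H_i^\xi(k)=G^\xi(\alpha_i(\xi)k+\beta_i(\xi))$, $k\in\Omega_i$. Assume that $\xi\mapsto H_i^\xi$ is continuous from $[0,\infty)$ to $L^\infty(\Omega_i)$ for each $i$. **Discrete solver.** For orders $\mathbf n_i=(n_1,\dots,n_i)$ let, successively for $i=1,\dots,\ell$, $$\tilde H^\xi_{i,\mathbf n_i}=\Phi_{i-1,i}\cdots\Phi_{1,i}\,H_i^\xi\,\Phi_{1,i}^{-1}\cdots\Phi_{i-1,i}^{-1},\qquad \Phi_{j,i}(k)=I+\mathcal C_{\Omega_j}U^\xi_{j,\mathbf n_j}\Big(\tfrac{\alpha_i(\xi)k+\beta_i(\xi)-\beta_j(\xi)}{\alpha_j(\xi)}\Big),$$ and let $U^\xi_{i,\mathbf n_i}$ be the approximate solution of order $n_i$ for $[\tilde H^\xi_{i,\mathbf n_i};\Omega_i]$. Call stage $i$ *solvable* (at $\xi$, for the given orders) if $\Phi_{j,i}$ is invertible everywhere on $\Omega_i$ for $j<i$ and $\mathcal C_{n_i}[\tilde H^\xi_{i,\mathbf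 n_i};\Omega_i]$ is invertible. **Lemma.** There are $N_{0,1},\dots,N_{0,\ell}$, depending only on the contours $\Omega_i$ and the methods, such that for every such family: 1. For every $\xi\ge0$, stage $i$ and orders $n_1,\dots,n_{i-1}$ such that stages $1,\dots,i-1$ are solvable at $\xi$, the $\Phi_{j,i}$ ($j<i$) are invertible on $\Omega_i$ and $[\tilde H^\xi_{i,\mathbf n_i};\Omega_i]$ is well posed, stage $i$ is solvable at $\xi$ for all sufficiently large $n_i$. 2. Let $\mathbf n_i$ be fixed with $n_j>N_{0,j}$ for $j\le i$. If stages $1,\dots,i$ are solvable at $\eta\ge0$, then they are solvable for all $\xi\ge0$ near $\eta$, and $\|U^\xi_{i,\mathbf n_i}-U^\eta_{i,\mathbf n_i}\|_{L^2(\Omega_i)}\to0$ as $\xi\to\eta$. In particular, if they are solvable for every $\xi\ge0$, the map $\xi\mapsto U^\xi_{i,\mathbf n_i}$ is continuous from $[0,\infty)$ to $L^2(\Omega_i)$. -/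

import Mathlib

open Set Filter Topology MeasureTheory
open scoped NNReal ENNReal ContDiff

attribute [local instance] Matrix.normedAddCommGroup Matrix.normedSpace

noncomputable section

namespace RH

/-- The values of jump matrices and densities (with the entrywise maximum norm). -/
abbrev M2 : Type := Matrix (Fin 2) (Fin 2) ℂ

/-! ### Contours -/

/-- Data of a bounded oriented contour: finitely many oriented arcs, the arc `i` being
parametrized by `γ i` on `[0,1]`. -/
structure Contour where
  ι : Type
  [fin : Fintype ι]
  γ : ι → ℝ → ℂ

attribute [instance] Contour.fin

namespace Contour

/-- The underlying subset of the plane. -/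
def trace (Γ : Contour) : Set ℂ := ⋃ i, Γ.γ i '' Icc (0 : ℝ) 1

/-- An end of an arc: `(i, false)` is the initial end, `(i, true)` is the terminal end. -/
abbrev End (Γ : Contour) : Type := Γ.ι × Bool

/-- The parameter value of an end. -/
def par (Γ : Contour) (e : Γ.End) : ℝ := if e.2 then 1 else 0

/-- The point of the plane at which an end lies. -/
def pt (Γ : Contour) (e : Γ.End) : ℂ := Γ.γ e.1 (Γ.par e)

/-- The tangent at an end, pointing from the end into the arc. -/
def dir (Γ : Contour) (e : Γ.End) : ℂ :=
  if e.2 then -deriv (Γ.γ e.1) 1 else deriv (Γ.γ e.1) 0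

/-- `Γ` is a piecewise smooth contour: every arc is smooth (up to its ends) and regular, arcs meet
themselves and each other only at their ends, and different ends at the same point leave it in
different directions (so that they have a counter-clockwise order). A closed
curve is an arc whose two ends lie at the same point, which then counts as a junction. -/
structure IsPiecewiseSmooth (Γ : Contour) : Prop where
  smooth : ∀ i, ContDiff ℝ ∞ (Γ.γ i)
  regular : ∀ i, ∀ t ∈ Icc (0 : ℝ) 1, deriv (Γ.γ i) t ≠ 0
  meet : ∀ i j, ∀ s ∈ Icc (0 : ℝ) 1, ∀ t ∈ Icc (0 : ℝ) 1, Γ.γ i s = Γ.γ j t →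
    (i = j ∧ s = t) ∨ ((s = 0 ∨ s = 1) ∧ (t = 0 ∨ t = 1))
  directions : ∀ e e' : Γ.End, e ≠ e' → Γ.pt e = Γ.pt e' → ¬ SameRay ℝ (Γ.dir e) (Γ.dir e')

/-- The counter-clockwise angle, in `[0, 2π)`, from the end `e₀` to the end `e`
(used for ends at the same point). -/
def angle (Γ : Contour) (e₀ e : Γ.End) : ℝ :=
  toIcoMod Real.two_pi_pos 0 (Complex.arg (Γ.dir e / Γ.dir e₀))

/-- The arclength measure `|dk|` on the arc `i`, in the parameter. -/
def arclength (Γ : Contour) (i : Γ.ι) : Measure ℝ :=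
  (volume.restrict (Icc (0 : ℝ) 1)).withDensity fun t => ‖deriv (Γ.γ i) t‖ₑ

/-- The union of the contours `a i • Ω i + b i`. -/
def scaledUnion {ℓ : ℕ} (Ω : Fin ℓ → Contour) (a b : Fin ℓ → ℂ) : Contour where
  ι := Σ i : Fin ℓ, (Ω i).ι
  γ := fun x t => a x.1 * (Ω x.1).γ x.2 t + b x.1

end Contour

/-! ### Function spaces on a contour -/

/-- Matrix-valued functions on a contour: `f i t` is the value at the point `γ i t` of the arc `i`,
for `t ∈ [0,1]` (values at other `t` are never used). At a junction point a function has one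
value on each arc. -/
abbrev Fn (Γ : Contour) : Type := Γ.ι → ℝ → M2

/-- The space `C(Γ)`: functions that are continuous on each (closed) arc. -/
abbrev PC (Γ : Contour) : Type := Γ.ι → C(unitInterval, M2)

/-- A member of `C(Γ)` as a function on `Γ`. -/
def toFn {Γ : Contour} (f : PC Γ) : Fn Γ := fun i => IccExtend zero_le_one (f i)

/-- The identity matrix as a function. -/
def one (Γ : Contour) : Fn Γ := fun _ _ => 1

/-- Equality almost everywhere on `Γ`. -/
def AEEq {Γ : Contour} (f g : Fn Γ) : Prop :=
  ∀ i, f i =ᵐ[volume.restrict (Icc (0 : ℝ) 1)] g i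

def MemLp' (Γ : Contour) (p : ℝ≥0∞) (f : Fn Γ) : Prop := ∀ i, MemLp (f i) p (Γ.arclength i)

/-- The norm of `L²(Γ)`. -/
def L2norm (Γ : Contour) (f : Fn Γ) : ℝ≥0∞ :=
  (∑ i, eLpNorm (f i) 2 (Γ.arclength i) ^ 2) ^ (1 / 2 : ℝ)

/-- The norm of `L^∞(Γ)`. -/
def LinfNorm (Γ : Contour) (f : Fn Γ) : ℝ≥0∞ := ⨆ i, eLpNorm (f i) ⊤ (Γ.arclength i)

/-- `g = Df` on every arc, where `D` is differentiation with respect to `k` along the arc: `f` is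
an indefinite integral of `g dk`. -/
def IsDeriv (Γ : Contour) (f g : Fn Γ) : Prop :=
  ∀ i, ∀ t ∈ Icc (0 : ℝ) 1, f i t = f i 0 + ∫ s in (0 : ℝ)..t, deriv (Γ.γ i) s • g i s

/-- `f ∈ W^{k,p}(Γ)`, for continuous representatives when `k ≥ 1`: the derivatives
`f, Df, …, D^k f` exist and lie in `L^p(Γ)`. -/
def MemSobolev (Γ : Contour) (k : ℕ) (p : ℝ≥0∞) (f : Fn Γ) : Prop :=
  ∃ D : ℕ → Fn Γ, (∀ i, ∀ t ∈ Icc (0 : ℝ) 1, D 0 i t = f i t) ∧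
    (∀ j < k, IsDeriv Γ (D j) (D (j + 1))) ∧ ∀ j ≤ k, MemLp' Γ p (D j)

/-- The norm of `H¹(Γ)`; it is `∞` outside `H¹(Γ)`. -/
def H1norm (Γ : Contour) (f : Fn Γ) : ℝ≥0∞ :=
  ⨅ (g : Fn Γ) (_ : IsDeriv Γ f g ∧ MemLp' Γ 2 g), (L2norm Γ f ^ 2 + L2norm Γ g ^ 2) ^ (1 / 2 : ℝ)

/-- `H^s(Γ)`, through continuous representatives. -/
def Hs (Γ : Contour) (s : ℕ) : Set (PC Γ) := {f | MemSobolev Γ s 2 (toFn f)}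

open Classical in
/-- The zeroth-order zero-sum condition: at every point, the values along outgoing arcs and the
values along incoming arcs have the same sum. -/
def ZeroSum (Γ : Contour) (f : Fn Γ) : Prop :=
  ∀ a : ℂ, ∑ e : Γ.End with Γ.pt e = a, (if e.2 then f e.1 1 else -f e.1 0) = 0

/-- `H¹_z(Γ)`. -/
def H1z (Γ : Contour) : Set (PC Γ) := {f | f ∈ Hs Γ 1 ∧ ZeroSum Γ (toFn f)}

/-! ### Riemann--Hilbert problems -/

/-- The value of the jump matrix at an end, inverted if the arc is oriented inwards. -/
def endJump {Γ : Contour} (G : Fn Γ) (e : Γ.End) : M2 :=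
  if e.2 then (G e.1 1)⁻¹ else G e.1 0

/-- The zeroth-order product condition: at every point, the product of the `endJump`s over the ends
at that point, listed in counter-clockwise order, is the identity matrix. -/
def ProductCondition (Γ : Contour) (G : Fn Γ) : Prop :=
  ∀ (a : ℂ) (e₀ : Γ.End) (L : List Γ.End), (∀ e, e ∈ e₀ :: L ↔ Γ.pt e = a) →
    (e₀ :: L).Pairwise (fun e e' => Γ.angle e₀ e < Γ.angle e₀ e') →
    ((e₀ :: L).map (endJump G)).prod = 1

/-- The problem `[G;Γ]` is `1`-regular. -/
structure IsOneRegular (Γ : Contour) (G : Fn Γ) : Prop where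
  invertible : ∀ i, ∀ t ∈ Icc (0 : ℝ) 1, IsUnit (G i t).det
  product : ProductCondition Γ G
  winf : MemSobolev Γ 1 ⊤ (G - one Γ)
  winf_inv : MemSobolev Γ 1 ⊤ ((fun i t => (G i t)⁻¹) - one Γ)
  hone : MemSobolev Γ 1 2 (G - one Γ)
  hone_inv : MemSobolev Γ 1 2 ((fun i t => (G i t)⁻¹) - one Γ)

/-- The Cauchy integral `(2πi)⁻¹ ∫_Γ u(s) / (s - z) ds`. -/
def cauchy (Γ : Contour) (u : Fn Γ) (z : ℂ) : M2 :=
  (1 / (2 * Real.pi * Complex.I) : ℂ) •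
    ∑ i, ∫ t in (0 : ℝ)..1, (deriv (Γ.γ i) t / (Γ.γ i t - z)) • u i t

/-- The boundary value `C_Γ^- u` from the right of the contour, taken along the normal. -/
def cauchyMinus (Γ : Contour) (u : Fn Γ) : Fn Γ := fun i t =>
  limUnder (𝓝[>] (0 : ℝ)) fun ε : ℝ =>
    cauchy Γ u (Γ.γ i t - (ε : ℂ) * (Complex.I * deriv (Γ.γ i) t))

/-- `T[G;Γ] u = C_Γ^- u · (G - I)`. -/
def opT (Γ : Contour) (G u : Fn Γ) : Fn Γ := fun i t => cauchyMinus Γ u i t * (G i t - 1)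

/-- The singular integral operator `C[G;Γ] u = u - C_Γ^- u · (G - I)`. -/
def opC (Γ : Contour) (G u : Fn Γ) : Fn Γ := u - opT Γ G u

/-- The norm of `C_Γ^-` on `L²(Γ)`. -/
def cauchyNorm (Γ : Contour) : ℝ≥0∞ :=
  ⨅ (K : ℝ≥0∞) (_ : ∀ u, MemLp' Γ 2 u → L2norm Γ (cauchyMinus Γ u) ≤ K * L2norm Γ u), K

/-- The norm of `C[G;Γ]⁻¹` on `L²(Γ)`. -/
def invNorm (Γ : Contour) (G : Fn Γ) : ℝ≥0∞ :=
  ⨅ (K : ℝ≥0∞) (_ : ∀ u, MemLp' Γ 2 u → L2norm Γ u ≤ K * L2norm Γ (opC Γ G u)), K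

/-- `[G;Γ]` is well posed: `G - I ∈ L²(Γ)` and `C[G;Γ]` has a bounded inverse on `L²(Γ)`. -/
structure WellPosed (Γ : Contour) (G : Fn Γ) : Prop where
  mem : MemLp' Γ 2 (G - one Γ)
  surjective : ∀ f, MemLp' Γ 2 f → ∃ u, MemLp' Γ 2 u ∧ AEEq (opC Γ G u) f
  bounded : ∃ K : ℝ≥0, ∀ u, MemLp' Γ 2 u → L2norm Γ u ≤ K * L2norm Γ (opC Γ G u)

/-! ### Numerical methods -/

open Classical in
/-- The representative in `C(Γ)` of a function that has one (and `0` otherwise). -/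
def contRep {Γ : Contour} (f : Fn Γ) : PC Γ :=
  if h : ∃ g : PC Γ, AEEq (toFn g) f then h.choose else 0

/-- A pair `(I_n, P_n)` of sequences of finite rank projections: `P_n` on `H¹_z(Γ)`, and `I_n` on
`H¹(Γ)`, extended to `C(Γ)` (see the third condition in `Admissible`). The values of
`P_n` outside `H¹_z(Γ)` are never used. -/
structure NumericalMethod (Γ : Contour) where
  I : ℕ → PC Γ →ₗ[ℂ] PC Γ
  P : ℕ → PC Γ →ₗ[ℂ] PC Γ
  I_mem : ∀ n, ∀ f ∈ Hs Γ 1, I n f ∈ Hs Γ 1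
  I_proj : ∀ n, ∀ f ∈ Hs Γ 1, I n (I n f) = I n f
  I_finite : ∀ n, FiniteDimensional ℂ (LinearMap.range (I n))
  P_mem : ∀ n, ∀ f ∈ H1z Γ, P n f ∈ H1z Γ
  P_proj : ∀ n, ∀ f ∈ H1z Γ, P n (P n f) = P n f
  P_finite : ∀ n, FiniteDimensional ℂ (Submodule.span ℂ (P n '' H1z Γ))

namespace NumericalMethod

variable {Γ : Contour} (m : NumericalMethod Γ)

/-- `X_n`, the range of `P_n`. -/
def X (n : ℕ) : Set (PC Γ) := m.P n '' H1z Γ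

/-- `T_n[G;Γ] = I_n T[G;Γ]`. -/
def Tn (n : ℕ) (G : Fn Γ) (u : PC Γ) : PC Γ := m.I n (contRep (opT Γ G (toFn u)))

/-- `C_n[G;Γ] = I_n C[G;Γ]`. -/
def Cn (n : ℕ) (G : Fn Γ) (u : PC Γ) : PC Γ := m.I n (contRep (opC Γ G (toFn u)))

/-- `I_n (G - I)`. -/
def rhs (n : ℕ) (G : Fn Γ) : PC Γ := m.I n (contRep (G - one Γ))

/-- `Y_n`, the range of `I_n` on the space of possible data: `C[G;Γ]` maps `H¹_z(Γ)` into a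
proper subspace of `H¹(Γ)` if the contour has end points or junctions, and `I_n` is restricted to
this space (to which the right-hand side `G - I` is added). -/
def Y (n : ℕ) (G : Fn Γ) : Set (PC Γ) :=
  {w | ∃ v ∈ H1z Γ, ∃ c : ℂ, w = m.Cn n G v + c • m.rhs n G}

/-- `C_n[G;Γ] : X_n → Y_n` is invertible. -/
def Invertible (n : ℕ) (G : Fn Γ) : Prop := BijOn (m.Cn n G) (m.X n) (m.Y n G)

/-- The approximate solution `u_n = C_n[G;Γ]⁻¹ I_n (G - I)`. -/
def approx (n : ℕ) (G : Fn Γ) : PC Γ :=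
  Function.invFunOn (m.Cn n G) (m.X n) (m.rhs n G)

/-- The method is of type `(α, β, γ)`. The constants depend on `Γ` alone, the order from which on
the estimates hold may depend on `G`. -/
def IsOfType (α β γ : ℝ) : Prop :=
  ∃ C₁ C₂ C₃ : ℝ, ∀ G : Fn Γ, IsOneRegular Γ G → WellPosed Γ G → ∃ N : ℕ, ∀ n > N,
    m.Invertible n G ∧
    (∀ u ∈ H1z Γ, L2norm Γ (toFn (m.Cn n G u)) ≤
      ENNReal.ofReal (C₁ * (n : ℝ) ^ α) * (1 + LinfNorm Γ (G - one Γ) * cauchyNorm Γ) *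
        H1norm Γ (toFn u)) ∧
    (∀ u ∈ m.X n, L2norm Γ (toFn u) ≤
      ENNReal.ofReal (C₂ * (n : ℝ) ^ β) * invNorm Γ G * L2norm Γ (toFn (m.Cn n G u))) ∧
    (∀ u ∈ m.X n, L2norm Γ (toFn (m.Tn n G u)) ≤
      ENNReal.ofReal (C₃ * (n : ℝ) ^ γ) * (LinfNorm Γ (G - one Γ) * cauchyNorm Γ) *
        L2norm Γ (toFn u))

/-- The method is admissible. The condition `square` says that the spaces `X_n` and `Y_n` fit: for
large `n` the discrete equation has no more equations than unknowns. -/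
structure Admissible : Prop where
  type : ∃ α β γ : ℝ, m.IsOfType α β γ
  spectral : ∀ r : ℕ, ∃ s : ℕ,
    (∀ u ∈ Hs Γ s,
      Tendsto (fun n : ℕ => (n : ℝ≥0∞) ^ r * H1norm Γ (toFn (m.I n u - u))) atTop (𝓝 0)) ∧
    (∀ u ∈ H1z Γ ∩ Hs Γ s,
      Tendsto (fun n : ℕ => (n : ℝ≥0∞) ^ r * H1norm Γ (toFn (m.P n u - u))) atTop (𝓝 0))
  bounded : ∃ K : ℝ≥0, ∀ n f, L2norm Γ (toFn (m.I n f)) ≤ K * LinfNorm Γ (toFn f)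
  square : ∃ N : ℕ, ∀ n > N, ∀ G : Fn Γ, IsOneRegular Γ G →
    Module.finrank ℂ (Submodule.span ℂ (m.Y n G)) ≤ Module.finrank ℂ (Submodule.span ℂ (m.X n))

end NumericalMethod

/-! ### The scaled and shifted solver, for fixed values of the scalings -/

section Solver

variable {ℓ : ℕ} (Ω : Fin ℓ → Contour) (a b : Fin ℓ → ℂ)

/-- `H_i(k) = G(a_i k + b_i)`, for a function `G` on the union of the contours `a i • Ω i + b i`. -/
def scaledRestriction (G : Fn (Contour.scaledUnion Ω a b)) (i : Fin ℓ) : Fn (Ω i) :=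
  fun j t => G ⟨i, j⟩ t

/-- `Φ_{j,i}` on `Ω_i`, for the density `u` on `Ω_j`: the function `I + C_{Ω_j} u` evaluated at the
image of `k ∈ Ω_i` under `k ↦ (a_i k + b_i - b_j) / a_j`. -/
def stagePhi (j i : Fin ℓ) (u : PC (Ω j)) : Fn (Ω i) := fun x t =>
  1 + cauchy (Ω j) (toFn u) ((a i * (Ω i).γ x t + b i - b j) / a j)

/-- The jump matrix `Φ_{i-1,i} ⋯ Φ_{1,i} H_i Φ_{1,i}⁻¹ ⋯ Φ_{i-1,i}⁻¹` of stage `i`, for densities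
`U j` on `Ω_j`, `j < i`. -/
def stageJump (H : ∀ i, Fn (Ω i)) (i : Fin ℓ) (U : ∀ j, PC (Ω j)) : Fn (Ω i) := fun x t =>
  let L := (List.finRange ℓ).filter (· < i)
  (L.reverse.map fun j => stagePhi Ω a b j i (U j) x t).prod * H i x t *
    (L.map fun j => (stagePhi Ω a b j i (U j) x t)⁻¹).prod

variable (m : ∀ i, NumericalMethod (Ω i)) (H : ∀ i, Fn (Ω i)) (n : Fin ℓ → ℕ)

/-- The discrete solution `U_{i,(n_1,…,n_i)}` of stage `i`, for the orders `n`. -/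
def discreteU (i : Fin ℓ) : PC (Ω i) :=
  (m i).approx (n i) (stageJump Ω a b H i fun j => if _h : j < i then discreteU j else 0)
termination_by i

/-- The jump matrix of stage `i` of the discrete solver; it depends on `n j` for `j < i`. -/
def discreteJump (i : Fin ℓ) : Fn (Ω i) :=
  stageJump Ω a b H i (discreteU Ω a b m H n)

/-- The jump matrix of stage `i` of the discrete solver is defined: the matrices that have to be
inverted are invertible on `Ω_i`. -/
def JumpDefined (i : Fin ℓ) : Prop :=
  ∀ j < i, ∀ x, ∀ t ∈ Icc (0 : ℝ) 1,
    IsUnit (stagePhi Ω a b j i (discreteU Ω a b m H n j) x t).det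

/-- The discrete problem of stage `i` is (defined and) uniquely solvable. -/
def StageSolvable (i : Fin ℓ) : Prop :=
  JumpDefined Ω a b m H n i ∧ (m i).Invertible (n i) (discreteJump Ω a b m H n i)

end Solver

end RH

end

noncomputable section

set_option linter.unusedSectionVars false

namespace RH

/-! ### Cauchy kernels on a smooth arc -/

/-! Item 1 follows from the definition of a method's type once the jump matrix of a stage is known
to be 1-regular (`IsSeparated.isOneRegular_stageJump`). Each Φ is I plus a Cauchy integral evaluated
at positive distance from its contour, so it is Lipschitz along `Ω i`, and it depends only on the
point of the plane. At a junction all values of the jump matrix are therefore conjugated by one and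
the same matrix, and the cyclic product stays I.

Item 2 is a finite-dimensional perturbation argument (`NumericalMethod.discrete_perturbation`). For
a fixed order the discrete operator on `X_n` is a linear map from a finite-dimensional space into
C(Γ), and it depends on the jump matrix continuously in the maximum norm. An injective linear map on
a finite-dimensional space has a lower bound that survives pointwise convergence
(`eventually_lower_bound`). So injectivity persists nearby and solutions converge. The target
`Y_n[G]` moves with G, but dim Y_n ≤ dim X_n turns injectivity into bijectivity
(`NumericalMethod.invertible_of_injOn`). This dimension count is the only source of the thresholds
`N₀`, which is why they do not depend on the family.

Two facts make the operator meaningful on C(Γ). The boundary value of the Cauchy integral of a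
density in H¹_z is continuous on each closed arc (`exists_boundary_values`): H¹ densities are Hölder
continuous of exponent 1/2, so that only logarithms can diverge at a junction, and the zero-sum
condition says that their coefficients cancel. Moreover `I_n` is continuous in the maximum norm,
because it has finite rank and a closed kernel (`NumericalMethod.continuous_I`).

Induction over the stages concludes (`IsRegularFamily.tendsto_discreteU`): convergence of the
earlier densities gives uniform convergence of the factors Φ and of the next jump matrix, to which
the perturbation argument applies. The maximum norm dominates the L² norm up to a constant. -/

theorem intervalIntegrable_abs_rpow {r : ℝ} (hr : -1 < r) (a b : ℝ) :
    IntervalIntegrable (fun x : ℝ => |x| ^ r) volume a b := by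
  have pos : ∀ c : ℝ, 0 ≤ c → IntervalIntegrable (fun x : ℝ => |x| ^ r) volume 0 c := by
    intro c hc
    refine (intervalIntegral.intervalIntegrable_rpow' (a := 0) (b := c) hr).congr ?_
    intro x hx
    rw [uIoc_of_le hc] at hx
    simp only [abs_of_pos hx.1]
  have all : ∀ c : ℝ, IntervalIntegrable (fun x : ℝ => |x| ^ r) volume 0 c := by
    intro c
    rcases le_total 0 c with h | h
    · exact pos c h
    · simpa using (IntervalIntegrable.iff_comp_neg (a := 0) (f := fun x : ℝ => |x| ^ r)).1
        (pos (-c) (by linarith))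
  exact (all a).symm.trans (all b)

theorem intervalIntegrable_abs_sub_rpow {r : ℝ} (hr : -1 < r) (a b t : ℝ) :
    IntervalIntegrable (fun x : ℝ => |x - t| ^ r) volume a b := by
  have := (intervalIntegrable_abs_rpow hr (a - t) (b - t)).comp_sub_right t
  simpa using this

/-- Points to the right of a regular arc are at least proportionally far from nearby points. -/
theorem exists_chord_bound {γ : ℝ → ℂ} (hγ : ContDiff ℝ ∞ γ) {t₀ : ℝ} (h : deriv γ t₀ ≠ 0) :
    ∃ c > 0, ∃ r > 0, ∀ s t, |s - t₀| ≤ r → |t - t₀| ≤ r → ∀ ε : ℝ, 0 ≤ ε →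
      c * (|s - t| + ε) ≤ ‖γ s - (γ t - ε * (Complex.I * deriv γ t))‖ := by
  set v := deriv γ t₀
  have hv : 0 < ‖v‖ := norm_pos_iff.2 h
  have hd : HasStrictDerivAt γ v t₀ :=
    (hγ.contDiffAt).hasStrictDerivAt (by simp)
  have h1 : ∀ᶠ p : ℝ × ℝ in 𝓝 (t₀, t₀), ‖γ p.1 - γ p.2 - (p.1 - p.2) • v‖ ≤ ‖v‖ / 4 * ‖p.1 - p.2‖ := by
    have := hd.hasStrictFDerivAt.isLittleO.def (show 0 < ‖v‖ / 4 by positivity)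
    simpa using this
  have hc : Continuous (deriv γ) := hγ.continuous_deriv (by simp)
  have h2 : ∀ᶠ t in 𝓝 t₀, ‖deriv γ t - v‖ < ‖v‖ / 4 := by
    have := (hc.tendsto t₀).sub_const v
    rw [sub_self] at this
    exact (tendsto_zero_iff_norm_tendsto_zero.1 this).eventually_lt_const (by positivity)
  rw [nhds_prod_eq, (Metric.nhds_basis_closedBall.prod_self).eventually_iff] at h1
  obtain ⟨r1, hr1, h1⟩ := h1
  obtain ⟨r2, hr2, h2⟩ := Metric.nhds_basis_closedBall.eventually_iff.1 h2
  refine ⟨‖v‖ / 4, by positivity, min r1 r2, lt_min hr1 hr2, fun s t hs ht ε hε => ?_⟩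
  have e1 := h1 (x := (s, t)) ⟨by simpa [Real.dist_eq] using hs.trans (min_le_left _ _),
    by simpa [Real.dist_eq] using ht.trans (min_le_left _ _)⟩
  have e2 := (h2 (x := t) (by simpa [Real.dist_eq] using ht.trans (min_le_right _ _))).le
  simp only [Real.norm_eq_abs] at e1
  -- Leading term: |x + iε| is at least half of |x| + ε. The two errors below cost at most ‖v‖/4
  -- times |s - t| and ε, which leaves the constant ‖v‖/4.
  have key : ‖v‖ / 2 * (|s - t| + ε) ≤ ‖((s - t : ℝ) : ℂ) * v + ε * (Complex.I * v)‖ := by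
    have : ((s - t : ℝ) : ℂ) * v + ε * (Complex.I * v) = (((s - t : ℝ) : ℂ) + ε * Complex.I) * v := by
      ring
    rw [this, norm_mul]
    have a1 := Complex.abs_re_le_norm (((s - t : ℝ) : ℂ) + ε * Complex.I)
    have a2 := Complex.abs_im_le_norm (((s - t : ℝ) : ℂ) + ε * Complex.I)
    have r1 : (((s - t : ℝ) : ℂ) + ε * Complex.I).re = s - t := by simp
    have r2 : (((s - t : ℝ) : ℂ) + ε * Complex.I).im = ε := by simp
    rw [r1] at a1
    rw [r2, abs_of_nonneg hε] at a2
    nlinarith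
  have hdec : γ s - (γ t - ε * (Complex.I * deriv γ t)) =
      (((s - t : ℝ) : ℂ) * v + ε * (Complex.I * v)) + ((γ s - γ t - (s - t) • v) +
        ε * (Complex.I * (deriv γ t - v))) := by
    rw [Complex.real_smul]; push_cast; ring
  have n1 : ‖(ε : ℂ) * (Complex.I * (deriv γ t - v))‖ ≤ ε * (‖v‖ / 4) := by
    rw [norm_mul, norm_mul, Complex.norm_I, one_mul, Complex.norm_real, Real.norm_eq_abs,
      abs_of_nonneg hε]
    gcongr
  rw [hdec]
  have n2 := norm_sub_le_norm_add (((s - t : ℝ) : ℂ) * v + ε * (Complex.I * v)) ((γ s - γ t - (s - t) • v) +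
        ε * (Complex.I * (deriv γ t - v)))
  have n3 := norm_add_le (γ s - γ t - (s - t) • v) (ε * (Complex.I * (deriv γ t - v)))
  nlinarith

/-- Compactness gives one constant for all three estimates. The last is the mean value inequality
for x ↦ γ'(s)x − γ(x), whose derivative at x is γ'(s) − γ'(x). -/
theorem exists_taylor_bound {γ : ℝ → ℂ} (hγ : ContDiff ℝ ∞ γ) (a b : ℝ) :
    ∃ D : ℝ, 0 ≤ D ∧ ∀ s ∈ Icc a b, ∀ t ∈ Icc a b, ‖deriv γ s‖ ≤ D ∧
      ‖deriv γ s - deriv γ t‖ ≤ D * |s - t| ∧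
      ‖deriv γ s * (s - t) - (γ s - γ t)‖ ≤ D * |s - t| ^ 2 := by
  have h1 : ContDiff ℝ 1 (deriv γ) := by
    have : ContDiff ℝ (1 + 1) γ := hγ.of_le (by norm_cast)
    exact ((contDiff_succ_iff_deriv).1 this).2.2
  obtain ⟨D1, hD1⟩ := (isCompact_Icc (a := a) (b := b)).exists_bound_of_continuousOn
    h1.continuous.continuousOn
  obtain ⟨D2, hD2⟩ := (isCompact_Icc (a := a) (b := b)).exists_bound_of_continuousOn
    (h1.continuous_deriv (by simp)).continuousOn
  have lip : ∀ s ∈ Icc a b, ∀ t ∈ Icc a b, ‖deriv γ s - deriv γ t‖ ≤ D2 * |s - t| := by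
    intro s hs t ht
    have := (convex_Icc a b).norm_image_sub_le_of_norm_deriv_le (f := deriv γ)
      (fun x _ => (h1.differentiable (by simp)) x) hD2 ht hs
    simpa using this
  refine ⟨max D1 (max D2 0), by simp, fun s hs t ht => ⟨(hD1 s hs).trans (by simp), ?_, ?_⟩⟩
  · exact (lip s hs t ht).trans (by gcongr; simp)
  · have hle : uIcc s t ⊆ Icc a b := (convex_Icc a b).ordConnected.uIcc_subset hs ht
    have hdiff : Differentiable ℝ γ := hγ.differentiable (by simp)
    have := (convex_uIcc s t).norm_image_sub_le_of_norm_hasDerivWithin_le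
      (f := fun x : ℝ => deriv γ s * x - γ x) (f' := fun x => deriv γ s - deriv γ x)
      (C := max D1 (max D2 0) * |s - t|)
      (fun x _ => by
        have e1 : HasDerivAt (fun x : ℝ => deriv γ s * (x : ℂ)) (deriv γ s) x := by
          simpa using (Complex.ofRealCLM.hasDerivAt (x := x)).const_mul (deriv γ s)
        exact (e1.sub (hdiff x).hasDerivAt).hasDerivWithinAt)
      (fun x hx => by
        refine (lip s hs x (hle hx)).trans ?_
        have : |s - x| ≤ |s - t| := by
          rw [abs_sub_comm s x, abs_sub_comm s t]
          exact abs_sub_left_of_mem_uIcc hx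
        gcongr
        simp) right_mem_uIcc left_mem_uIcc
    calc _ = ‖(deriv γ s * s - γ s) - (deriv γ s * t - γ t)‖ := by congr 1; ring
      _ ≤ _ := this
      _ = _ := by rw [Real.norm_eq_abs]; ring


/-! ### One-sided boundary values of the Cauchy integral over a single arc. -/

section Kernel

variable {E : Type*} [NormedAddCommGroup E] [NormedSpace ℝ E] [NormedSpace ℂ E]

/-- The part over `[a,b]` of the Cauchy integral along an arc, without the factor `(2πi)⁻¹`. -/
def arcCauchy (γ : ℝ → ℂ) (u : ℝ → E) (a b : ℝ) (z : ℂ) : E :=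
  ∫ s in a..b, (deriv γ s / (γ s - z)) • u s

variable {γ : ℝ → ℂ} {u : ℝ → E} {a b : ℝ}

theorem aestronglyMeasurable_cauchyKernel (hγ : ContDiff ℝ ∞ γ) (hu : Continuous u) (z : ℂ)
    (μ : Measure ℝ) : AEStronglyMeasurable (fun s => (deriv γ s / (γ s - z)) • u s) μ := by
  have h1 : Measurable (deriv γ) := (hγ.continuous_deriv (by simp)).measurable
  have h2 : Measurable γ := hγ.continuous.measurable
  have : Measurable fun s => deriv γ s / (γ s - z) := by fun_prop
  exact this.aestronglyMeasurable.smul hu.aestronglyMeasurable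

theorem intervalIntegrable_cauchyKernel (hγ : ContDiff ℝ ∞ γ) (hu : Continuous u) (hab : a ≤ b)
    {z : ℂ} (hz : z ∉ γ '' Icc a b) :
    IntervalIntegrable (fun s => (deriv γ s / (γ s - z)) • u s) volume a b := by
  apply ContinuousOn.intervalIntegrable
  rw [uIcc_of_le hab]
  refine ContinuousOn.smul (ContinuousOn.div (hγ.continuous_deriv (by simp)).continuousOn
    (hγ.continuous.sub continuous_const).continuousOn ?_) hu.continuousOn
  intro s hs h
  exact hz ⟨s, hs, sub_eq_zero.1 h⟩

theorem exists_pos_le_norm_sub (hγ : ContDiff ℝ ∞ γ) {z₀ : ℂ} (hz : z₀ ∉ γ '' Icc a b) :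
    ∃ r > 0, ∀ s ∈ Icc a b, ∀ z, dist z z₀ < r → r ≤ ‖γ s - z‖ := by
  have hcl : IsClosed (γ '' Icc a b) := (isCompact_Icc.image hγ.continuous).isClosed
  obtain ⟨r, hr, h⟩ := Metric.isOpen_iff.1 hcl.isOpen_compl z₀ hz
  refine ⟨r / 2, by positivity, fun s hs z hz => ?_⟩
  by_contra! hlt
  rw [← dist_eq_norm] at hlt
  refine h (a := γ s) ?_ ⟨s, hs, rfl⟩
  exact Metric.mem_ball.2 ((dist_triangle _ z _).trans_lt (by linarith))

theorem continuousAt_arcCauchy (hγ : ContDiff ℝ ∞ γ) (hu : Continuous u) (hab : a ≤ b)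
    {z₀ : ℂ} (hz : z₀ ∉ γ '' Icc a b) : ContinuousAt (arcCauchy γ u a b) z₀ := by
  obtain ⟨r, hr, hd⟩ := exists_pos_le_norm_sub hγ hz
  obtain ⟨D, hD⟩ := (isCompact_Icc (a := a) (b := b)).exists_bound_of_continuousOn
    (hγ.continuous_deriv (by simp)).continuousOn
  obtain ⟨U, hU⟩ := (isCompact_Icc (a := a) (b := b)).exists_bound_of_continuousOn hu.continuousOn
  refine intervalIntegral.tendsto_integral_filter_of_dominated_convergence (fun _ => D / r * U)
    (Eventually.of_forall fun z => aestronglyMeasurable_cauchyKernel hγ hu z _) ?_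
    intervalIntegrable_const ?_
  · filter_upwards [Metric.ball_mem_nhds z₀ hr] with z hz
    refine Eventually.of_forall fun s hs => ?_
    rw [uIoc_of_le hab] at hs
    have hs' : s ∈ Icc a b := Ioc_subset_Icc_self hs
    rw [norm_smul, norm_div]
    have := hd s hs' z hz
    have hDp := hD s hs'
    have hD0 : 0 ≤ D := (norm_nonneg _).trans hDp
    gcongr
    exact hU s hs'
  · refine Eventually.of_forall fun s hs => ?_
    rw [uIoc_of_le hab] at hs
    have hs' : s ∈ Icc a b := Ioc_subset_Icc_self hs
    refine Tendsto.smul (Tendsto.div tendsto_const_nhds (tendsto_const_nhds.sub tendsto_id) ?_)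
      tendsto_const_nhds
    exact norm_pos_iff.1 (hr.trans_le (hd s hs' z₀ (by simpa using hr)))

/-- The Cauchy kernel at distance `ε` to the right of the point `γ t`, with its singular part
removed. -/
def kern (γ : ℝ → ℂ) (u : ℝ → E) (ε s t : ℝ) : E :=
  (deriv γ s / (γ s - (γ t - ε * (Complex.I * deriv γ t)))) • u s -
    (1 / ((s : ℂ) - t + ε * Complex.I)) • u t

/-- A smooth arc over `[a,b]` without near self-intersections, and a Hölder continuous density. -/
structure ChordArc (γ : ℝ → ℂ) (u : ℝ → E) (a b : ℝ) : Prop where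
  lt : a < b
  smooth : ContDiff ℝ ∞ γ
  cont : Continuous u
  chord : ∃ c > 0, ∀ s ∈ Icc a b, ∀ t ∈ Icc a b, ∀ ε : ℝ, 0 ≤ ε →
      c * (|s - t| + ε) ≤ ‖γ s - (γ t - ε * (Complex.I * deriv γ t))‖
  holder : ∃ K : ℝ, ∀ s ∈ Icc a b, ∀ t ∈ Icc a b, ‖u s - u t‖ ≤ K * √|s - t|

theorem aestronglyMeasurable_kern (hγ : ContDiff ℝ ∞ γ) (hu : Continuous u) (ε t : ℝ)
    (μ : Measure ℝ) : AEStronglyMeasurable (fun s => kern γ u ε s t) μ := by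
  refine (aestronglyMeasurable_cauchyKernel hγ hu _ μ).sub ?_
  have : Measurable fun s : ℝ => 1 / ((s : ℂ) - t + ε * Complex.I) := by fun_prop
  exact this.aestronglyMeasurable.smul_const _

theorem abs_sub_le_norm_model (s t ε : ℝ) : |s - t| ≤ ‖(s : ℂ) - t + ε * Complex.I‖ := by
  have := Complex.abs_re_le_norm ((s : ℂ) - t + ε * Complex.I)
  simpa using this

namespace ChordArc

/-- The integrable majorant, uniform in ε, behind all dominated convergence arguments on the arc
itself. Freezing the density at t leaves a term with u s - u t, where the Hölder bound gains √|s -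
t| against the simple pole. The remaining difference of the two scalar kernels is bounded, since its
numerator vanishes to second order. -/
theorem kern_bound (h : ChordArc γ u a b) : ∃ C : ℝ, 0 ≤ C ∧ ∀ s ∈ Icc a b, ∀ t ∈ Icc a b, s ≠ t →
    ∀ ε : ℝ, 0 ≤ ε → ‖kern γ u ε s t‖ ≤ C * |s - t| ^ (-(1 / 2) : ℝ) := by
  obtain ⟨c, hc, hchord⟩ := h.chord
  obtain ⟨K, hK⟩ := h.holder
  obtain ⟨D, hD0, hD⟩ := exists_taylor_bound h.smooth a b
  obtain ⟨U, hU⟩ := (isCompact_Icc (a := a) (b := b)).exists_bound_of_continuousOn h.cont.continuousOn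
  have hU0 : 0 ≤ U := (norm_nonneg _).trans (hU a (left_mem_Icc.2 h.lt.le))
  have hK0 : 0 ≤ K := by
    have := (norm_nonneg _).trans (hK a (left_mem_Icc.2 h.lt.le) b (right_mem_Icc.2 h.lt.le))
    have h2 : 0 < √|a - b| := Real.sqrt_pos.2 (abs_pos.2 (by linarith [h.lt]))
    exact nonneg_of_mul_nonneg_left this h2
  -- The second summand belongs to the bounded term; √(b - a) rewrites a constant as a multiple of
  -- |s - t| ^ (-1/2).
  refine ⟨D * K / c + D * U / c * √(b - a), by positivity, fun s hs t ht hst ε hε => ?_⟩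
  set x := |s - t| with hx
  have hx0 : 0 < x := abs_pos.2 (sub_ne_zero.2 hst)
  have hxb : x ≤ b - a := abs_le.2 ⟨by linarith [hs.1, ht.2], by linarith [hs.2, ht.1]⟩
  set w := γ s - (γ t - ε * (Complex.I * deriv γ t)) with hw
  set q := (s : ℂ) - t + ε * Complex.I with hq
  have hwn : c * (x + ε) ≤ ‖w‖ := hchord s hs t ht ε hε
  have hqn : x ≤ ‖q‖ := abs_sub_le_norm_model s t ε
  have hw0 : w ≠ 0 := norm_pos_iff.1 (lt_of_lt_of_le (by positivity) hwn)
  have hq0 : q ≠ 0 := norm_pos_iff.1 (lt_of_lt_of_le hx0 hqn)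
  have hdec : kern γ u ε s t = (deriv γ s / w) • (u s - u t) +
      ((deriv γ s * q - w) / (w * q)) • u t := by
    have : (deriv γ s * q - w) / (w * q) = deriv γ s / w - 1 / q := by field_simp
    rw [this, smul_sub, sub_smul]
    simp only [kern]
    abel
  obtain ⟨d1, d2, d3⟩ := hD s hs t ht
  have hnum : ‖deriv γ s * q - w‖ ≤ D * x * (x + ε) := by
    have : deriv γ s * q - w = (deriv γ s * (s - t) - (γ s - γ t)) +
        ε * (Complex.I * (deriv γ s - deriv γ t)) := by rw [hq, hw]; ring
    rw [this]
    refine (norm_add_le _ _).trans ?_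
    rw [norm_mul, norm_mul, Complex.norm_I, one_mul, Complex.norm_real, Real.norm_eq_abs,
      abs_of_nonneg hε]
    have := mul_le_mul_of_nonneg_left d2 hε
    nlinarith
  have hrp : x ^ (-(1 / 2) : ℝ) = (√x)⁻¹ := by
    rw [Real.rpow_neg hx0.le, Real.sqrt_eq_rpow]
  have hsx : 0 < √x := Real.sqrt_pos.2 hx0
  have b1 : ‖(deriv γ s / w) • (u s - u t)‖ ≤ D * K / c * (√x)⁻¹ := by
    rw [norm_smul, norm_div]
    have : c * x ≤ ‖w‖ := le_trans (by gcongr; linarith) hwn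
    calc ‖deriv γ s‖ / ‖w‖ * ‖u s - u t‖ ≤ D / (c * x) * (K * √x) := by
          gcongr
          exact hK s hs t ht
      _ = D * K / c * (√x)⁻¹ := by
          field_simp
          rw [Real.sq_sqrt hx0.le]
          ring
  have b2 : ‖((deriv γ s * q - w) / (w * q)) • u t‖ ≤ D * U / c * √(b - a) * (√x)⁻¹ := by
    rw [norm_smul, norm_div, norm_mul]
    have hle : 1 ≤ √(b - a) * (√x)⁻¹ := by
      rw [← div_eq_mul_inv, one_le_div hsx]
      exact Real.sqrt_le_sqrt hxb
    calc ‖deriv γ s * q - w‖ / (‖w‖ * ‖q‖) * ‖u t‖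
        ≤ D * x * (x + ε) / ((c * (x + ε)) * x) * U := by
          gcongr
          exact hU t ht
      _ = D * U / c := by field_simp
      _ = D * U / c * 1 := by ring
      _ ≤ D * U / c * (√(b - a) * (√x)⁻¹) := by gcongr
      _ = _ := by ring
  rw [hdec, hrp]
  refine (norm_add_le _ _).trans ((add_le_add b1 b2).trans (le_of_eq ?_))
  ring

theorem ne_of_ne (h : ChordArc γ u a b) {s t : ℝ} (hs : s ∈ Icc a b) (ht : t ∈ Icc a b) {ε : ℝ}
    (hε : 0 ≤ ε) (hst : s ≠ t ∨ 0 < ε) : γ s - (γ t - ε * (Complex.I * deriv γ t)) ≠ 0 := by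
  obtain ⟨c, hc, hchord⟩ := h.chord
  refine norm_pos_iff.1 (lt_of_lt_of_le ?_ (hchord s hs t ht ε hε))
  rcases hst with h | h
  · have := abs_pos.2 (sub_ne_zero.2 h)
    positivity
  · positivity

theorem intervalIntegrable_kern (h : ChordArc γ u a b) {t ε : ℝ} (ht : t ∈ Icc a b) (hε : 0 ≤ ε) :
    IntervalIntegrable (fun s => kern γ u ε s t) volume a b := by
  obtain ⟨C, hC0, hC⟩ := h.kern_bound
  refine ((intervalIntegrable_abs_sub_rpow (r := -(1 / 2)) (by norm_num) a b t).const_mul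
    C).mono_fun (aestronglyMeasurable_kern h.smooth h.cont ε t _) ?_
  rw [uIoc_of_le h.lt.le]
  filter_upwards [ae_restrict_mem measurableSet_Ioc,
    ae_restrict_of_ae (Measure.ae_ne volume t)] with s hs hst
  exact (hC s (Ioc_subset_Icc_self hs) t ht hst ε hε).trans (le_abs_self _)

theorem tendsto_integral_kern_eps (h : ChordArc γ u a b) {t : ℝ} (ht : t ∈ Icc a b) :
    Tendsto (fun ε => ∫ s in a..b, kern γ u ε s t) (𝓝[>] 0) (𝓝 (∫ s in a..b, kern γ u 0 s t)) := by
  obtain ⟨C, hC0, hC⟩ := h.kern_bound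
  refine intervalIntegral.tendsto_integral_filter_of_dominated_convergence
    (fun s => C * |s - t| ^ (-(1 / 2) : ℝ))
    (Eventually.of_forall fun ε => aestronglyMeasurable_kern h.smooth h.cont ε t _) ?_
    ((intervalIntegrable_abs_sub_rpow (by norm_num) a b t).const_mul C) ?_
  · filter_upwards [self_mem_nhdsWithin] with ε hε
    filter_upwards [Measure.ae_ne volume t] with s hst hs
    rw [uIoc_of_le h.lt.le] at hs
    exact hC s (Ioc_subset_Icc_self hs) t ht hst ε (le_of_lt hε)
  · filter_upwards [Measure.ae_ne volume t] with s hst hs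
    rw [uIoc_of_le h.lt.le] at hs
    have hcont : ContinuousAt (fun ε => kern γ u ε s t) 0 := by
      unfold kern
      refine ContinuousAt.sub (ContinuousAt.smul (ContinuousAt.div (by fun_prop) (by fun_prop) ?_)
        (by fun_prop)) (ContinuousAt.smul (ContinuousAt.div (by fun_prop) (by fun_prop) ?_)
        (by fun_prop))
      · exact h.ne_of_ne (Ioc_subset_Icc_self hs) ht le_rfl (Or.inl hst)
      · simpa [sub_eq_zero] using hst
    exact hcont.mono_left nhdsWithin_le_nhds

/-- The singularity at s = t moves with t. The substitution s = σ + t pins it at σ = 0, at the price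
of a moving interval of integration, which an indicator absorbs. -/
theorem tendsto_integral_kern (h : ChordArc γ u a b) {t₀ : ℝ} (ht₀ : t₀ ∈ Icc a b) :
    Tendsto (fun t => ∫ s in a..b, kern γ u 0 s t) (𝓝[Icc a b] t₀)
      (𝓝 (∫ s in a..b, kern γ u 0 s t₀)) := by
  obtain ⟨C, hC0, hC⟩ := h.kern_bound
  have hab := h.lt.le
  set F : ℝ → ℝ → E := fun t => (Ioc (a - t) (b - t)).indicator fun σ => kern γ u 0 (σ + t) t
  have hF : ∀ t, ∫ s in a..b, kern γ u 0 s t = ∫ σ, F t σ := by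
    intro t
    rw [integral_indicator measurableSet_Ioc, ← intervalIntegral.integral_of_le (by linarith),
      intervalIntegral.integral_comp_add_right (fun s => kern γ u 0 s t) t]
    simp
  simp only [hF]
  have hbd : Integrable ((Icc (-(b - a)) (b - a)).indicator
      fun σ : ℝ => C * |σ| ^ (-(1 / 2) : ℝ)) := by
    rw [integrable_indicator_iff measurableSet_Icc]
    have := (intervalIntegrable_abs_rpow (r := -(1 / 2)) (by norm_num) (-(b - a)) (b - a)).const_mul C
    rwa [intervalIntegrable_iff_integrableOn_Icc_of_le (by linarith)] at this
  refine tendsto_integral_filter_of_dominated_convergence _ ?_ ?_ hbd ?_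
  · refine Eventually.of_forall fun t => AEStronglyMeasurable.indicator ?_ measurableSet_Ioc
    exact (aestronglyMeasurable_kern h.smooth h.cont 0 t volume).comp_quasiMeasurePreserving
      (measurePreserving_add_right volume t).quasiMeasurePreserving
  · filter_upwards [self_mem_nhdsWithin] with t ht
    filter_upwards [Measure.ae_ne volume 0] with σ hσ
    by_cases hm : σ ∈ Ioc (a - t) (b - t)
    · have h1 : σ ∈ Icc (-(b - a)) (b - a) := ⟨by linarith [hm.1, ht.2], by linarith [hm.2, ht.1]⟩
      simp only [F]
      rw [indicator_of_mem hm, indicator_of_mem h1]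
      have := hC (σ + t) ⟨by linarith [hm.1], by linarith [hm.2]⟩ t ht (by simpa using hσ) 0 le_rfl
      simpa using this
    · simp only [F]
      rw [indicator_of_notMem hm, norm_zero]
      exact indicator_nonneg (fun x _ => by positivity) _
  -- Away from these three values the indicator is constant for t near t₀ and the kernel is
  -- continuous in t.
  · filter_upwards [Measure.ae_ne volume 0, Measure.ae_ne volume (a - t₀),
      Measure.ae_ne volume (b - t₀)] with σ hσ ha hb
    by_cases hm : σ ∈ Icc (a - t₀) (b - t₀)
    · have hm1 : a - t₀ < σ := lt_of_le_of_ne hm.1 (Ne.symm ha)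
      have hm2 : σ < b - t₀ := lt_of_le_of_ne hm.2 hb
      have ev : ∀ᶠ t in 𝓝[Icc a b] t₀, F t σ = kern γ u 0 (σ + t) t := by
        have e1 : ∀ᶠ t in 𝓝 t₀, a - σ < t := eventually_gt_nhds (by linarith)
        have e2 : ∀ᶠ t in 𝓝 t₀, t < b - σ := eventually_lt_nhds (by linarith)
        filter_upwards [nhdsWithin_le_nhds e1, nhdsWithin_le_nhds e2] with t h1 h2
        exact indicator_of_mem (show σ ∈ Ioc (a - t) (b - t) from ⟨by linarith, by linarith⟩) _
      have hlim : F t₀ σ = kern γ u 0 (σ + t₀) t₀ := indicator_of_mem (show σ ∈ Ioc (a - t₀) (b - t₀) from ⟨hm1, hm.2⟩) _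
      rw [hlim]
      refine Tendsto.congr' (EventuallyEq.symm ev) ?_
      have hcont : ContinuousAt (fun t => kern γ u 0 (σ + t) t) t₀ := by
        have hg := h.smooth.continuous
        have hg' := h.smooth.continuous_deriv (by simp)
        have hu := h.cont
        unfold kern
        refine ContinuousAt.sub (ContinuousAt.smul (ContinuousAt.div (by fun_prop) (by fun_prop) ?_)
          (by fun_prop)) (ContinuousAt.smul (ContinuousAt.div (by fun_prop) (by fun_prop) ?_)
          (by fun_prop))
        · exact h.ne_of_ne ⟨by linarith, by linarith⟩ ht₀ le_rfl (Or.inl (by simpa using hσ))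
        · simpa using hσ
      exact hcont.mono_left nhdsWithin_le_nhds
    · have hlim : F t₀ σ = 0 := indicator_of_notMem (fun h => hm (Ioc_subset_Icc_self h)) _
      have ev : ∀ᶠ t in 𝓝[Icc a b] t₀, F t σ = 0 := by
        rw [mem_Icc, not_and_or, not_le, not_le] at hm
        rcases hm with hm | hm
        · have e1 : ∀ᶠ t in 𝓝 t₀, t < a - σ := eventually_lt_nhds (by linarith)
          filter_upwards [nhdsWithin_le_nhds e1] with t h1
          exact indicator_of_notMem (fun h => by linarith [h.1]) _
        · have e1 : ∀ᶠ t in 𝓝 t₀, b - σ < t := eventually_gt_nhds (by linarith)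
          filter_upwards [nhdsWithin_le_nhds e1] with t h1
          exact indicator_of_notMem (fun h => by linarith [h.2]) _
      rw [hlim]
      exact tendsto_const_nhds.congr' (EventuallyEq.symm ev)

end ChordArc

theorem integral_model {a b t ε : ℝ} (hε : 0 < ε) :
    ∫ s in a..b, 1 / ((s : ℂ) - t + ε * Complex.I) =
      Complex.log ((b : ℂ) - t + ε * Complex.I) - Complex.log ((a : ℂ) - t + ε * Complex.I) := by
  have hsl : ∀ s : ℝ, (s : ℂ) - t + ε * Complex.I ∈ Complex.slitPlane := fun s =>
    Complex.mem_slitPlane_iff.2 (Or.inr (by simpa using hε.ne'))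
  refine intervalIntegral.integral_eq_sub_of_hasDerivAt
    (f := fun s : ℝ => Complex.log ((s : ℂ) - t + ε * Complex.I)) (fun s _ => ?_) ?_
  · have h1 : HasDerivAt (fun s : ℝ => (s : ℂ) - t + ε * Complex.I) 1 s := by
      simpa using ((Complex.ofRealCLM.hasDerivAt (x := s)).sub_const (t : ℂ)).add_const
        ((ε : ℂ) * Complex.I)
    exact h1.clog_real (hsl s)
  · refine Continuous.intervalIntegrable (Continuous.div (by fun_prop) (by fun_prop) ?_) _ _
    exact fun s => Complex.slitPlane_ne_zero (hsl s)

/-- The term -πi is the jump of the Cauchy integral: a - t < 0 is approached from the upper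
half-plane, where the argument tends to π. -/
theorem tendsto_integral_model {a b t : ℝ} (ht : t ∈ Ioo a b) :
    Tendsto (fun ε : ℝ => ∫ s in a..b, 1 / ((s : ℂ) - t + ε * Complex.I)) (𝓝[>] 0)
      (𝓝 (((Real.log (b - t) - Real.log (t - a) : ℝ) : ℂ) - Real.pi * Complex.I)) := by
  have e : ∀ᶠ ε : ℝ in 𝓝[>] 0, Complex.log ((b : ℂ) - t + ε * Complex.I) -
      Complex.log ((a : ℂ) - t + ε * Complex.I) = ∫ s in a..b, 1 / ((s : ℂ) - t + ε * Complex.I) := by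
    filter_upwards [self_mem_nhdsWithin] with ε hε
    exact (integral_model hε).symm
  refine Tendsto.congr' e ?_
  have lin : ∀ c : ℝ, Tendsto (fun ε : ℝ => (c : ℂ) - t + ε * Complex.I) (𝓝[>] 0)
      (𝓝 ((c - t : ℝ) : ℂ)) := by
    intro c
    have : Continuous fun ε : ℝ => (c : ℂ) - t + ε * Complex.I := by fun_prop
    have := this.tendsto 0
    simp only [Complex.ofReal_zero, zero_mul, add_zero] at this
    push_cast
    exact this.mono_left nhdsWithin_le_nhds
  have h1 : Tendsto (fun ε : ℝ => Complex.log ((b : ℂ) - t + ε * Complex.I)) (𝓝[>] 0)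
      (𝓝 (Real.log (b - t) : ℂ)) := by
    rw [Complex.ofReal_log (by linarith [ht.2])]
    refine (lin b).clog ?_
    exact Complex.ofReal_mem_slitPlane.2 (by linarith [ht.2])
  have h2 : Tendsto (fun ε : ℝ => Complex.log ((a : ℂ) - t + ε * Complex.I)) (𝓝[>] 0)
      (𝓝 ((Real.log (t - a) : ℂ) + Real.pi * Complex.I)) := by
    have := Complex.tendsto_log_nhdsWithin_im_nonneg_of_re_neg_of_im_zero
      (z := ((a - t : ℝ) : ℂ)) (by simpa using ht.1) (by simp)
    have hn : ‖((a - t : ℝ) : ℂ)‖ = t - a := by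
      rw [Complex.norm_real, Real.norm_eq_abs, abs_of_neg (by linarith [ht.1])]; ring
    rw [hn] at this
    refine this.comp (tendsto_nhdsWithin_iff.2 ⟨lin a, ?_⟩)
    filter_upwards [self_mem_nhdsWithin] with ε hε
    simpa using le_of_lt hε
  convert h1.sub h2 using 2
  push_cast; ring

variable [IsScalarTower ℝ ℂ E] [SMulCommClass ℝ ℂ E] [CompleteSpace E]

theorem ChordArc.arcCauchy_right_tendsto (h : ChordArc γ u a b) {t : ℝ} (ht : t ∈ Ioo a b) :
    Tendsto (fun ε : ℝ => arcCauchy γ u a b (γ t - ε * (Complex.I * deriv γ t))) (𝓝[>] 0)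
      (𝓝 ((∫ s in a..b, kern γ u 0 s t) +
        (((Real.log (b - t) - Real.log (t - a) : ℝ) : ℂ) - Real.pi * Complex.I) • u t)) := by
  have ht' := Ioo_subset_Icc_self ht
  refine Tendsto.congr' ?_ ((h.tendsto_integral_kern_eps ht').add
    ((tendsto_integral_model ht).smul_const (u t)))
  filter_upwards [self_mem_nhdsWithin] with ε hε
  have hi : IntervalIntegrable (fun s : ℝ => 1 / ((s : ℂ) - t + ε * Complex.I)) volume a b := by
    refine Continuous.intervalIntegrable (Continuous.div (by fun_prop) (by fun_prop) ?_) _ _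
    intro s h0
    have := congrArg Complex.im h0
    simp at this
    exact absurd this (ne_of_gt hε)
  rw [← intervalIntegral.integral_smul_const, ← intervalIntegral.integral_add
    (h.intervalIntegrable_kern ht' (le_of_lt hε)) ⟨Integrable.smul_const hi.1 _, Integrable.smul_const hi.2 _⟩]
  simp only [kern, sub_add_cancel, arcCauchy]

end Kernel

/-! ### Limits at the ends of an arc -/

section Corner

/-- By homogeneity it suffices to minimize over s + t = 1, which is compact; a vanishing minimum
would put v and w on one ray. -/
theorem exists_linear_corner_bound {v w : ℂ} (h : ¬ SameRay ℝ v w) :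
    ∃ c > 0, ∀ s t : ℝ, 0 ≤ s → 0 ≤ t → c * (s + t) ≤ ‖(s : ℂ) * v - t * w‖ := by
  have hcont : Continuous fun x : ℝ => ‖(x : ℂ) * v - (1 - x : ℝ) * w‖ := by fun_prop
  obtain ⟨x, hx, hmin⟩ := (isCompact_Icc (a := (0 : ℝ)) (b := 1)).exists_isMinOn
    (nonempty_Icc.2 zero_le_one) hcont.continuousOn
  refine ⟨‖(x : ℂ) * v - (1 - x : ℝ) * w‖, norm_pos_iff.2 fun h0 => h ?_, fun s t hs ht => ?_⟩
  · rw [sub_eq_zero] at h0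
    rcases hx.1.eq_or_lt with h1 | h1
    · refine Or.inr (Or.inl ?_)
      rw [← h1] at h0
      simpa using h0.symm
    rcases hx.2.eq_or_lt with h2 | h2
    · refine Or.inl ?_
      rw [h2] at h0
      simpa using h0
    · exact Or.inr (Or.inr ⟨x, 1 - x, h1, by linarith, by simpa [Complex.real_smul] using h0⟩)
  · rcases (add_nonneg hs ht).eq_or_lt with h0 | h0
    · rw [← h0]; simp
    · have hm := isMinOn_iff.1 hmin (s / (s + t)) ⟨by positivity, by rw [div_le_one h0]; linarith⟩
      have e1 : (1 - s / (s + t) : ℝ) = t / (s + t) := by field_simp; ring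
      rw [e1] at hm
      calc _ ≤ ‖((s / (s + t) : ℝ) : ℂ) * v - (t / (s + t) : ℝ) * w‖ * (s + t) := by gcongr
        _ = ‖(((s / (s + t) : ℝ) : ℂ) * v - (t / (s + t) : ℝ) * w) * (s + t : ℝ)‖ := by
            rw [norm_mul, Complex.norm_real, Real.norm_of_nonneg h0.le]
        _ = _ := by
            congr 1
            have : ((s + t : ℝ) : ℂ) ≠ 0 := by exact_mod_cast h0.ne'
            push_cast at this ⊢
            field_simp

/-- Arcs that leave a point in different directions separate linearly. -/
theorem exists_corner_bound {σ τ : ℝ → ℂ} (hσ : ContDiff ℝ ∞ σ) (hτ : ContDiff ℝ ∞ τ)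
    (h0 : σ 0 = τ 0) (hd : ¬ SameRay ℝ (deriv σ 0) (deriv τ 0)) :
    ∃ c > 0, ∃ r > 0, r ≤ 1 ∧ ∀ s ∈ Icc 0 r, ∀ t ∈ Icc 0 r, c * (s + t) ≤ ‖σ s - τ t‖ := by
  obtain ⟨c, hc, hlin⟩ := exists_linear_corner_bound hd
  obtain ⟨D, hD0, hD⟩ := exists_taylor_bound hσ 0 1
  obtain ⟨D', hD0', hD'⟩ := exists_taylor_bound hτ 0 1
  -- The radius is such that the quadratic Taylor remainders use up at most half of the linear lower
  -- bound.
  refine ⟨c / 2, by positivity, min 1 (c / (2 * (D + D' + 1))), by positivity, min_le_left _ _,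
    fun s hs t ht => ?_⟩
  have hs1 : s ∈ Icc (0 : ℝ) 1 := ⟨hs.1, hs.2.trans (min_le_left _ _)⟩
  have ht1 : t ∈ Icc (0 : ℝ) 1 := ⟨ht.1, ht.2.trans (min_le_left _ _)⟩
  have z1 : (0 : ℝ) ∈ Icc (0 : ℝ) 1 := by simp
  have a1 := (hD 0 z1 s hs1).2.2
  have a2 := (hD' 0 z1 t ht1).2.2
  have a3 := hlin s t hs.1 ht.1
  rw [zero_sub, abs_neg, sq_abs] at a1 a2
  have hdec : (s : ℂ) * deriv σ 0 - t * deriv τ 0 = (σ s - τ t) -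
      (deriv σ 0 * ((0 : ℝ) - s) - (σ 0 - σ s)) + (deriv τ 0 * ((0 : ℝ) - t) - (τ 0 - τ t)) := by
    rw [h0]; push_cast; ring
  rw [hdec] at a3
  have b1 := norm_add_le ((σ s - τ t) - (deriv σ 0 * ((0 : ℝ) - s) - (σ 0 - σ s)))
    (deriv τ 0 * ((0 : ℝ) - t) - (τ 0 - τ t))
  have b2 := norm_sub_le (σ s - τ t) (deriv σ 0 * ((0 : ℝ) - s) - (σ 0 - σ s))
  have hs2 : (D + D' + 1) * s ≤ c / 2 := by
    have := hs.2.trans (min_le_right _ _)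
    rw [le_div_iff₀ (by positivity)] at this
    linarith
  have ht2 : (D + D' + 1) * t ≤ c / 2 := by
    have := ht.2.trans (min_le_right _ _)
    rw [le_div_iff₀ (by positivity)] at this
    linarith
  have c1 : D * s ^ 2 ≤ c / 2 * s := by
    nlinarith [mul_le_mul_of_nonneg_right hs2 hs.1, mul_nonneg hD0' (sq_nonneg s), sq_nonneg s]
  have c2 : D' * t ^ 2 ≤ c / 2 * t := by
    nlinarith [mul_le_mul_of_nonneg_right ht2 ht.1, mul_nonneg hD0 (sq_nonneg t), sq_nonneg t]
  linarith

/-- With ρ = w / v, which is not a nonnegative real, s - tρ stays in the slit plane, so the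
principal logarithm is a primitive. Its value at s = 0 splits as log t + log(-ρ): the divergent part
is -log t, whatever the angle between the arcs. -/
theorem tendsto_integral_corner_model {v w : ℂ} (h : ¬ SameRay ℝ v w) {δ : ℝ} (hδ : 0 < δ) :
    ∃ y : ℂ, Tendsto (fun t : ℝ => (∫ s in (0 : ℝ)..δ, v / (s * v - t * w)) + Real.log t)
      (𝓝[>] 0) (𝓝 y) := by
  have hv : v ≠ 0 := fun h0 => h (Or.inl h0)
  have hw : w ≠ 0 := fun h0 => h (Or.inr (Or.inl h0))
  set ρ := w / v with hρ
  have hwρ : w = ρ * v := by rw [hρ]; field_simp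
  have hρ0 : ρ ≠ 0 := div_ne_zero hw hv
  have hsl : ∀ s t : ℝ, 0 ≤ s → 0 < t → (s : ℂ) - t * ρ ∈ Complex.slitPlane := by
    intro s t hs ht
    rw [Complex.mem_slitPlane_iff]
    by_cases him : ρ.im = 0
    · left
      have hre : ρ.re < 0 := by
        by_contra! hge
        refine h ?_
        have : w = ρ.re • v := by
          rw [hwρ, Complex.real_smul]
          congr 1
          exact Complex.ext (by simp) (by simpa using him)
        rw [this]
        exact SameRay.sameRay_nonneg_smul_right v hge
      simp [him]
      nlinarith
    · right
      simp [him, ht.ne']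
  have hρs : -ρ ∈ Complex.slitPlane := by simpa using hsl 0 1 le_rfl one_pos
  refine ⟨Complex.log δ - Complex.log (-ρ), ?_⟩
  have hlim : Tendsto (fun t : ℝ => Complex.log ((δ : ℂ) - t * ρ) - Complex.log (-ρ)) (𝓝[>] 0)
      (𝓝 (Complex.log δ - Complex.log (-ρ))) := by
    refine Tendsto.sub_const (Tendsto.clog ?_ (Complex.ofReal_mem_slitPlane.2 hδ)) _
    have : Continuous fun t : ℝ => (δ : ℂ) - t * ρ := by fun_prop
    have := this.tendsto 0
    simp only [Complex.ofReal_zero, zero_mul, sub_zero] at this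
    exact this.mono_left nhdsWithin_le_nhds
  refine Tendsto.congr' ?_ hlim
  filter_upwards [self_mem_nhdsWithin] with t ht
  have ht : 0 < t := ht
  have hint : ∫ s in (0 : ℝ)..δ, v / (s * v - t * w) =
      Complex.log ((δ : ℂ) - t * ρ) - Complex.log (((0 : ℝ) : ℂ) - t * ρ) := by
    have hd : ∀ s : ℝ, 0 ≤ s → v / (s * v - t * w) = 1 / ((s : ℂ) - t * ρ) := by
      intro s hs
      have : (s : ℂ) * v - t * w = (s - t * ρ) * v := by rw [hwρ]; ring
      rw [this]
      have := Complex.slitPlane_ne_zero (hsl s t hs ht)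
      field_simp
    refine intervalIntegral.integral_eq_sub_of_hasDerivAt
      (f := fun s : ℝ => Complex.log ((s : ℂ) - t * ρ)) (fun s hs => ?_) ?_
    · rw [uIcc_of_le hδ.le] at hs
      have h1 : HasDerivAt (fun s : ℝ => (s : ℂ) - t * ρ) 1 s := by
        simpa using (Complex.ofRealCLM.hasDerivAt (x := s)).sub_const ((t : ℂ) * ρ)
      rw [hd s hs.1]
      exact h1.clog_real (hsl s t hs.1 ht)
    · apply ContinuousOn.intervalIntegrable
      rw [uIcc_of_le hδ.le]
      refine ContinuousOn.div continuousOn_const (by fun_prop) fun s hs => ?_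
      have : (s : ℂ) * v - t * w = (s - t * ρ) * v := by rw [hwρ]; ring
      rw [this]
      exact mul_ne_zero (Complex.slitPlane_ne_zero (hsl s t hs.1 ht)) hv
  rw [hint]
  have : ((0 : ℝ) : ℂ) - t * ρ = t * (-ρ) := by push_cast; ring
  rw [this, Complex.log_ofReal_mul ht (neg_ne_zero.2 hρ0)]
  ring

variable {E : Type*} [NormedAddCommGroup E] [NormedSpace ℝ E] [NormedSpace ℂ E]
  [IsScalarTower ℝ ℂ E] [SMulCommClass ℝ ℂ E] [CompleteSpace E]

/-- The Cauchy integral over an arc near its initial point, on an arc that leaves this point in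
another direction. -/
theorem tendsto_arcCauchy_corner {σ τ : ℝ → ℂ} (hσ : ContDiff ℝ ∞ σ) (hτ : ContDiff ℝ ∞ τ)
    (h0 : σ 0 = τ 0) (hd : ¬ SameRay ℝ (deriv σ 0) (deriv τ 0)) {u : ℝ → E} (hu : Continuous u)
    {K : ℝ} (hK : ∀ s ∈ Icc (0 : ℝ) 1, ‖u s - u 0‖ ≤ K * √s) :
    ∃ r > 0, ∀ δ, 0 < δ → δ ≤ r → ∃ y, Tendsto
      (fun t : ℝ => arcCauchy σ u 0 δ (τ t) + (Real.log t : ℂ) • u 0) (𝓝[>] 0) (𝓝 y) := by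
  obtain ⟨c, hc, r, hr, hr1, hcorner⟩ := exists_corner_bound hσ hτ h0 hd
  obtain ⟨c', hc', hlin⟩ := exists_linear_corner_bound hd
  obtain ⟨D₁, hD0₁, hD₁⟩ := exists_taylor_bound hσ 0 1
  obtain ⟨D₂, hD0₂, hD₂⟩ := exists_taylor_bound hτ 0 1
  set v := deriv σ 0 with hv
  set w := deriv τ 0 with hw
  have z1 : (0 : ℝ) ∈ Icc (0 : ℝ) 1 := by simp
  have hK0 : 0 ≤ K := by
    have := (norm_nonneg _).trans (hK 1 (by simp))
    simpa using this
  refine ⟨r, hr, fun δ hδ hδr => ?_⟩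
  obtain ⟨y, hy⟩ := tendsto_integral_corner_model hd hδ
  set F : ℝ → ℝ → E := fun t s => (deriv σ s / (σ s - τ t)) • u s - (v / (s * v - t * w)) • u 0
  -- Difference between the kernel and its linear model along the tangents: the numerator is of
  -- order (s + t)², and the denominators are at least c(s + t) and c'(s + t).
  set M := (D₁ + D₂) * (‖v‖ + ‖w‖) * 2 / (c * c')
  have hbound : ∀ t ∈ Ioo (0 : ℝ) r, ∀ s ∈ Ioc (0 : ℝ) δ,
      ‖F t s‖ ≤ (D₁ * K / c + M * ‖u 0‖) * |s - 0| ^ (-(1 / 2) : ℝ) := by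
    intro t ht s hs
    have hsr : s ∈ Icc 0 r := ⟨hs.1.le, hs.2.trans hδr⟩
    have htr : t ∈ Icc 0 r := ⟨ht.1.le, ht.2.le⟩
    have hs1 : s ∈ Icc (0 : ℝ) 1 := ⟨hs.1.le, hsr.2.trans hr1⟩
    have ht1 : t ∈ Icc (0 : ℝ) 1 := ⟨ht.1.le, htr.2.trans hr1⟩
    have hs0 : 0 < s := hs.1
    have ht0 : 0 < t := ht.1
    have A := hcorner s hsr t htr
    have B := hlin s t hs0.le ht0.le
    have A0 : σ s - τ t ≠ 0 := norm_pos_iff.1 (lt_of_lt_of_le (by positivity) A)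
    have B0 : (s : ℂ) * v - t * w ≠ 0 := norm_pos_iff.1 (lt_of_lt_of_le (by positivity) B)
    have hdec : F t s = (deriv σ s / (σ s - τ t)) • (u s - u 0) +
        ((deriv σ s * (s * v - t * w) - v * (σ s - τ t)) / ((σ s - τ t) * (s * v - t * w))) • u 0 := by
      have : (deriv σ s * (s * v - t * w) - v * (σ s - τ t)) / ((σ s - τ t) * (s * v - t * w)) =
          deriv σ s / (σ s - τ t) - v / (s * v - t * w) := by field_simp
      rw [this, smul_sub, sub_smul]
      simp only [F]
      abel
    obtain ⟨d1, d2, -⟩ := hD₁ s hs1 0 z1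
    have d3 := (hD₁ 0 z1 s hs1).2.2
    have d4 := (hD₂ 0 z1 t ht1).2.2
    rw [zero_sub, abs_neg, sq_abs] at d3 d4
    rw [sub_zero, abs_of_pos hs0] at d2
    have hnum : ‖deriv σ s * (s * v - t * w) - v * (σ s - τ t)‖ ≤
        (D₁ + D₂) * (‖v‖ + ‖w‖) * 2 * ((s + t) * (s + t)) := by
      have e : deriv σ s * (s * v - t * w) - v * (σ s - τ t) =
          (deriv σ s - v) * (s * v - t * w) + v * ((v * ((0 : ℝ) - s) - (σ 0 - σ s)) * (-1) +
            (w * ((0 : ℝ) - t) - (τ 0 - τ t))) := by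
        rw [h0]; push_cast; ring
      have n1 : ‖(s : ℂ) * v - t * w‖ ≤ s * ‖v‖ + t * ‖w‖ := by
        refine (norm_sub_le _ _).trans (le_of_eq ?_)
        rw [norm_mul, norm_mul, Complex.norm_real, Complex.norm_real, Real.norm_of_nonneg hs0.le,
          Real.norm_of_nonneg ht0.le]
      rw [e]
      refine (norm_add_le _ _).trans ?_
      rw [norm_mul, norm_mul]
      have n2 : ‖(v * ((0 : ℝ) - s) - (σ 0 - σ s)) * (-1) + (w * ((0 : ℝ) - t) - (τ 0 - τ t))‖ ≤
          D₁ * s ^ 2 + D₂ * t ^ 2 := by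
        refine (norm_add_le _ _).trans (add_le_add ?_ d4)
        rw [norm_mul, norm_neg, norm_one, mul_one]
        exact d3
      have hv0 := norm_nonneg v
      have hw0 := norm_nonneg w
      calc ‖deriv σ s - v‖ * ‖(s : ℂ) * v - t * w‖ + ‖v‖ * _
          ≤ (D₁ * s) * (s * ‖v‖ + t * ‖w‖) + ‖v‖ * (D₁ * s ^ 2 + D₂ * t ^ 2) := by gcongr
        _ ≤ ((D₁ + D₂) * (s + t)) * ((s + t) * (‖v‖ + ‖w‖)) +
            (‖v‖ + ‖w‖) * ((D₁ + D₂) * ((s + t) * (s + t))) := by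
            have q1 : D₁ * s ≤ (D₁ + D₂) * (s + t) := by gcongr <;> linarith
            have q2 : s * ‖v‖ + t * ‖w‖ ≤ (s + t) * (‖v‖ + ‖w‖) := by nlinarith [mul_nonneg hs0.le hw0, mul_nonneg ht0.le hv0]
            have q3 : D₁ * s ^ 2 + D₂ * t ^ 2 ≤ (D₁ + D₂) * ((s + t) * (s + t)) := by
              have : s ^ 2 ≤ (s + t) * (s + t) := by nlinarith
              have : t ^ 2 ≤ (s + t) * (s + t) := by nlinarith
              nlinarith
            gcongr
            linarith
        _ = _ := by ring
    have hsx : 0 < √s := Real.sqrt_pos.2 hs0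
    have hrp : |s - 0| ^ (-(1 / 2) : ℝ) = (√s)⁻¹ := by
      rw [sub_zero, abs_of_pos hs0, Real.rpow_neg hs0.le, Real.sqrt_eq_rpow]
    have b1 : ‖(deriv σ s / (σ s - τ t)) • (u s - u 0)‖ ≤ D₁ * K / c * (√s)⁻¹ := by
      rw [norm_smul, norm_div]
      have : c * s ≤ ‖σ s - τ t‖ := le_trans (by gcongr; linarith) A
      calc ‖deriv σ s‖ / ‖σ s - τ t‖ * ‖u s - u 0‖ ≤ D₁ / (c * s) * (K * √s) := by
            gcongr
            exact hK s hs1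
        _ = D₁ * K / c * (√s)⁻¹ := by
            field_simp
            rw [Real.sq_sqrt hs0.le]
            ring
    have b2 : ‖((deriv σ s * (s * v - t * w) - v * (σ s - τ t)) /
        ((σ s - τ t) * (s * v - t * w))) • u 0‖ ≤ M * ‖u 0‖ * (√s)⁻¹ := by
      rw [norm_smul, norm_div, norm_mul]
      have hle : 1 ≤ (√s)⁻¹ := by
        rw [one_le_inv₀ hsx]
        exact Real.sqrt_le_one.2 hs1.2
      calc _ ≤ (D₁ + D₂) * (‖v‖ + ‖w‖) * 2 * ((s + t) * (s + t)) /
            ((c * (s + t)) * (c' * (s + t))) * ‖u 0‖ := by gcongr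
        _ = M * ‖u 0‖ * 1 := by simp only [M]; field_simp
        _ ≤ M * ‖u 0‖ * (√s)⁻¹ := by
            have : 0 ≤ M := by positivity
            gcongr
    rw [hdec, hrp]
    refine (norm_add_le _ _).trans ((add_le_add b1 b2).trans (le_of_eq ?_))
    ring
  have hmeas : ∀ t : ℝ, AEStronglyMeasurable (F t) (volume.restrict (uIoc 0 δ)) := by
    intro t
    refine (aestronglyMeasurable_cauchyKernel hσ hu (τ t) _).sub ?_
    have : Measurable fun s : ℝ => v / (s * v - t * w) := by fun_prop
    exact this.aestronglyMeasurable.smul_const _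
  have hev : ∀ᶠ t : ℝ in 𝓝[>] 0, t ∈ Ioo (0 : ℝ) r := Ioo_mem_nhdsGT hr
  have hF : Tendsto (fun t => ∫ s in (0 : ℝ)..δ, F t s) (𝓝[>] 0) (𝓝 (∫ s in (0 : ℝ)..δ, F 0 s)) := by
    refine intervalIntegral.tendsto_integral_filter_of_dominated_convergence
      (fun s => (D₁ * K / c + M * ‖u 0‖) * |s - 0| ^ (-(1 / 2) : ℝ)) (Eventually.of_forall hmeas) ?_
      ((intervalIntegrable_abs_sub_rpow (by norm_num) 0 δ 0).const_mul _) ?_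
    · filter_upwards [hev] with t ht
      refine Eventually.of_forall fun s hs => ?_
      rw [uIoc_of_le hδ.le] at hs
      exact hbound t ht s hs
    · refine Eventually.of_forall fun s hs => ?_
      rw [uIoc_of_le hδ.le] at hs
      have hcont : ContinuousAt (fun t => F t s) 0 := by
        have := hτ.continuous
        refine ContinuousAt.sub (ContinuousAt.smul (ContinuousAt.div (by fun_prop) (by fun_prop) ?_)
          (by fun_prop)) (ContinuousAt.smul (ContinuousAt.div (by fun_prop) (by fun_prop) ?_)
          (by fun_prop))
        · refine norm_pos_iff.1 (lt_of_lt_of_le ?_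
            (hcorner s ⟨hs.1.le, hs.2.trans hδr⟩ 0 ⟨le_rfl, hr.le⟩))
          have := hs.1
          positivity
        · have := hlin s 0 hs.1.le le_rfl
          refine norm_pos_iff.1 (lt_of_lt_of_le ?_ this)
          have := hs.1
          positivity
      exact hcont.mono_left nhdsWithin_le_nhds
  refine ⟨_, Tendsto.congr' ?_ (hF.add (hy.smul_const (u 0)))⟩
  filter_upwards [hev] with t ht
  have hi1 : IntervalIntegrable (F t) volume 0 δ := by
    refine ((intervalIntegrable_abs_sub_rpow (r := -(1 / 2)) (by norm_num) 0 δ 0).const_mul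
      (D₁ * K / c + M * ‖u 0‖)).mono_fun (hmeas t) ?_
    rw [uIoc_of_le hδ.le]
    filter_upwards [ae_restrict_mem measurableSet_Ioc] with s hs
    exact (hbound t ht s hs).trans (le_abs_self _)
  have hi2 : IntervalIntegrable (fun s : ℝ => v / (s * v - t * w)) volume 0 δ := by
    apply ContinuousOn.intervalIntegrable
    rw [uIcc_of_le hδ.le]
    refine ContinuousOn.div continuousOn_const (by fun_prop) fun s hs => ?_
    have := hlin s t hs.1 ht.1.le
    have h1 := ht.1
    have h2 := hs.1
    exact norm_pos_iff.1 (lt_of_lt_of_le (by positivity) this)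
  rw [add_smul, ← add_assoc, ← intervalIntegral.integral_smul_const, ← intervalIntegral.integral_add
    hi1 ⟨Integrable.smul_const hi2.1 _, Integrable.smul_const hi2.2 _⟩]
  simp only [F, sub_add_cancel, arcCauchy]

/-- The principal value on the arc itself, from which the boundary values from the right are
obtained. -/
def arcPV (γ : ℝ → ℂ) (u : ℝ → E) (a b t : ℝ) : E :=
  (∫ s in a..b, kern γ u 0 s t) +
    (((Real.log (b - t) - Real.log (t - a) : ℝ) : ℂ) - Real.pi * Complex.I) • u t

variable {γ : ℝ → ℂ} {u : ℝ → E} {a b : ℝ}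

/-- Allows the coefficient of the logarithm to be frozen at the end point: the Hölder error of the
density beats log x. -/
theorem tendsto_log_smul_zero {f : ℝ → E} {K : ℝ} {r : ℝ} (hr : 0 < r)
    (hf : ∀ x ∈ Ioo 0 r, ‖f x‖ ≤ K * √x) :
    Tendsto (fun x : ℝ => (Real.log x : ℂ) • f x) (𝓝[>] 0) (𝓝 0) := by
  have h1 := (tendsto_log_mul_rpow_nhdsGT_zero (r := 1 / 2) (by norm_num)).norm.mul_const K
  rw [norm_zero, zero_mul] at h1
  refine squeeze_zero_norm' ?_ h1
  filter_upwards [Ioo_mem_nhdsGT hr] with x hx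
  rw [norm_smul, norm_mul, Complex.norm_real, Real.norm_of_nonneg (Real.rpow_nonneg hx.1.le _),
    ← Real.sqrt_eq_rpow, mul_assoc]
  gcongr
  rw [mul_comm]
  exact hf x hx

namespace ChordArc

theorem tendsto_arcPV (h : ChordArc γ u a b) {t₀ : ℝ} (ht₀ : t₀ ∈ Ioo a b) :
    ∃ y, Tendsto (arcPV γ u a b) (𝓝 t₀) (𝓝 y) := by
  have h1 := h.tendsto_integral_kern (Ioo_subset_Icc_self ht₀)
  rw [nhdsWithin_eq_nhds.2 (Icc_mem_nhds ht₀.1 ht₀.2)] at h1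
  have hu := h.cont
  have h2 : ContinuousAt (fun t : ℝ => (((Real.log (b - t) - Real.log (t - a) : ℝ) : ℂ) -
      Real.pi * Complex.I) • u t) t₀ := by
    have e1 : ContinuousAt (fun t : ℝ => Real.log (b - t)) t₀ :=
      ContinuousAt.log (by fun_prop) (by linarith [ht₀.2])
    have e2 : ContinuousAt (fun t : ℝ => Real.log (t - a)) t₀ :=
      ContinuousAt.log (by fun_prop) (by linarith [ht₀.1])
    fun_prop
  exact ⟨_, h1.add h2⟩

/-- Near a the only unbounded term of `arcPV` is -log(t - a) • u t. At b it is +log(b - t) • u t, so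
the divergence at any end is log x times the signed value `endCoeff`. -/
theorem tendsto_arcPV_left (h : ChordArc γ u a b) :
    ∃ y, Tendsto (fun x => arcPV γ u a b (a + x) + (Real.log x : ℂ) • u a) (𝓝[>] 0) (𝓝 y) := by
  obtain ⟨K, hK⟩ := h.holder
  have hlt := h.lt
  have hu := h.cont
  have hmap : Tendsto (fun x => a + x) (𝓝[>] 0) (𝓝[Icc a b] a) := by
    refine tendsto_nhdsWithin_iff.2 ⟨?_, ?_⟩
    · have : Continuous fun x => a + x := by fun_prop
      simpa using (this.tendsto 0).mono_left (nhdsWithin_le_nhds (s := Ioi 0))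
    · filter_upwards [Ioo_mem_nhdsGT (sub_pos.2 hlt)] with x hx
      exact ⟨by linarith [hx.1], by linarith [hx.2]⟩
  have h1 := (h.tendsto_integral_kern (left_mem_Icc.2 hlt.le)).comp hmap
  have h2 : Tendsto (fun x : ℝ => ((Real.log (b - (a + x)) : ℂ) - Real.pi * Complex.I) • u (a + x))
      (𝓝[>] 0) (𝓝 (((Real.log (b - (a + 0)) : ℂ) - Real.pi * Complex.I) • u (a + 0))) := by
    have e1 : ContinuousAt (fun x : ℝ => Real.log (b - (a + x))) 0 :=
      ContinuousAt.log (by fun_prop) (by linarith)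
    have : ContinuousAt (fun x : ℝ => ((Real.log (b - (a + x)) : ℂ) - Real.pi * Complex.I) • u (a + x)) 0 := by
      fun_prop
    exact this.mono_left nhdsWithin_le_nhds
  have h3 : Tendsto (fun x : ℝ => (Real.log x : ℂ) • (u a - u (a + x))) (𝓝[>] 0) (𝓝 0) := by
    refine tendsto_log_smul_zero (K := K) (sub_pos.2 hlt) fun x hx => ?_
    have := hK a (left_mem_Icc.2 hlt.le) (a + x) ⟨by linarith [hx.1], by linarith [hx.2]⟩
    simpa [abs_of_pos hx.1] using this
  refine ⟨_, Tendsto.congr (fun x => ?_) ((h1.add h2).add h3)⟩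
  simp only [arcPV, Function.comp, Complex.ofReal_sub, add_sub_cancel_left]
  module

theorem tendsto_arcPV_right (h : ChordArc γ u a b) :
    ∃ y, Tendsto (fun x => arcPV γ u a b (b - x) - (Real.log x : ℂ) • u b) (𝓝[>] 0) (𝓝 y) := by
  obtain ⟨K, hK⟩ := h.holder
  have hlt := h.lt
  have hu := h.cont
  have hmap : Tendsto (fun x => b - x) (𝓝[>] 0) (𝓝[Icc a b] b) := by
    refine tendsto_nhdsWithin_iff.2 ⟨?_, ?_⟩
    · have : Continuous fun x => b - x := by fun_prop
      simpa using (this.tendsto 0).mono_left (nhdsWithin_le_nhds (s := Ioi 0))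
    · filter_upwards [Ioo_mem_nhdsGT (sub_pos.2 hlt)] with x hx
      exact ⟨by linarith [hx.2], by linarith [hx.1]⟩
  have h1 := (h.tendsto_integral_kern (right_mem_Icc.2 hlt.le)).comp hmap
  have h2 : Tendsto (fun x : ℝ => (-(Real.log (b - x - a) : ℂ) - Real.pi * Complex.I) • u (b - x))
      (𝓝[>] 0) (𝓝 ((-(Real.log (b - 0 - a) : ℂ) - Real.pi * Complex.I) • u (b - 0))) := by
    have e1 : ContinuousAt (fun x : ℝ => Real.log (b - x - a)) 0 :=
      ContinuousAt.log (by fun_prop) (by linarith)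
    have : ContinuousAt (fun x : ℝ => (-(Real.log (b - x - a) : ℂ) - Real.pi * Complex.I) • u (b - x)) 0 := by
      fun_prop
    exact this.mono_left nhdsWithin_le_nhds
  have h3 : Tendsto (fun x : ℝ => (Real.log x : ℂ) • (u (b - x) - u b)) (𝓝[>] 0) (𝓝 0) := by
    refine tendsto_log_smul_zero (K := K) (sub_pos.2 hlt) fun x hx => ?_
    have := hK (b - x) ⟨by linarith [hx.2], by linarith [hx.1]⟩ b (right_mem_Icc.2 hlt.le)
    simpa [abs_of_pos hx.1] using this
  refine ⟨_, Tendsto.congr (fun x => ?_) ((h1.add h2).add h3)⟩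
  simp only [arcPV, Function.comp, Complex.ofReal_sub, sub_sub_cancel]
  module

end ChordArc

end Corner

/-! ### Arclength and Sobolev spaces on a contour -/

/-- Lebesgue measure on the parameter interval. -/
abbrev unitVol : Measure ℝ := volume.restrict (Icc (0 : ℝ) 1)

namespace Contour

/-- All arcs are smooth and regular. -/
structure Regular (Γ : Contour) : Prop where
  smooth : ∀ i, ContDiff ℝ ∞ (Γ.γ i)
  regular : ∀ i, ∀ t ∈ Icc (0 : ℝ) 1, deriv (Γ.γ i) t ≠ 0

theorem IsPiecewiseSmooth.toRegular {Γ : Contour} (h : Γ.IsPiecewiseSmooth) : Γ.Regular :=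
  ⟨h.smooth, h.regular⟩

namespace Regular

variable {Γ : Contour} (hΓ : Γ.Regular)

include hΓ

theorem continuous_deriv (i : Γ.ι) : Continuous (deriv (Γ.γ i)) :=
  (hΓ.smooth i).continuous_deriv (by simp)

/-- The speed of a regular arc lies between two positive constants, so null sets and L^p membership
may be tested with Lebesgue measure in the parameter. -/
theorem exists_arclength_bounds (i : Γ.ι) : ∃ C : ℝ≥0∞, C ≠ ⊤ ∧ Γ.arclength i ≤ C • unitVol ∧
    unitVol ≤ C • Γ.arclength i := by
  have hc := hΓ.continuous_deriv i
  obtain ⟨t₀, ht₀, hmax⟩ := (isCompact_Icc (a := (0 : ℝ)) (b := 1)).exists_isMaxOn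
    (nonempty_Icc.2 zero_le_one) hc.enorm.continuousOn
  obtain ⟨t₁, ht₁, hmin⟩ := (isCompact_Icc (a := (0 : ℝ)) (b := 1)).exists_isMinOn
    (nonempty_Icc.2 zero_le_one) hc.enorm.continuousOn
  rw [isMaxOn_iff] at hmax
  rw [isMinOn_iff] at hmin
  have h1 : ‖deriv (Γ.γ i) t₁‖ₑ ≠ 0 := by simpa using hΓ.regular i t₁ ht₁
  have h2 : ‖deriv (Γ.γ i) t₁‖ₑ ≠ ⊤ := by simp
  refine ⟨max ‖deriv (Γ.γ i) t₀‖ₑ ‖deriv (Γ.γ i) t₁‖ₑ⁻¹, by simpa using hΓ.regular i t₁ ht₁,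
    ?_, ?_⟩
  · calc Γ.arclength i ≤ unitVol.withDensity fun _ => ‖deriv (Γ.γ i) t₀‖ₑ := by
          refine withDensity_mono ?_
          filter_upwards [ae_restrict_mem measurableSet_Icc] with t ht using hmax t ht
      _ = ‖deriv (Γ.γ i) t₀‖ₑ • unitVol := withDensity_const _
      _ ≤ _ := by gcongr; exact le_max_left _ _
  · calc unitVol = unitVol.withDensity 1 := withDensity_one.symm
      _ ≤ unitVol.withDensity (‖deriv (Γ.γ i) t₁‖ₑ⁻¹ • fun t => ‖deriv (Γ.γ i) t‖ₑ) := by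
          refine withDensity_mono ?_
          filter_upwards [ae_restrict_mem measurableSet_Icc] with t ht
          simp only [Pi.one_apply, Pi.smul_apply, smul_eq_mul]
          rw [← ENNReal.inv_mul_cancel h1 h2]
          gcongr
          exact hmin t ht
      _ = ‖deriv (Γ.γ i) t₁‖ₑ⁻¹ • Γ.arclength i :=
          withDensity_smul _ hc.enorm.measurable
      _ ≤ _ := by gcongr; exact le_max_right _ _

theorem memLp_iff {E : Type*} [NormedAddCommGroup E] (i : Γ.ι) {p : ℝ≥0∞} {f : ℝ → E} :
    MemLp f p (Γ.arclength i) ↔ MemLp f p unitVol := by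
  obtain ⟨C, hC, h1, h2⟩ := hΓ.exists_arclength_bounds i
  exact ⟨fun h => h.of_measure_le_smul hC h2, fun h => h.of_measure_le_smul hC h1⟩

theorem ae_iff (i : Γ.ι) {q : ℝ → Prop} :
    (∀ᵐ t ∂Γ.arclength i, q t) ↔ ∀ᵐ t ∂unitVol, q t := by
  obtain ⟨C, hC, h1, h2⟩ := hΓ.exists_arclength_bounds i
  exact ⟨fun h => (Measure.absolutelyContinuous_of_le_smul h2).ae_le h,
    fun h => (Measure.absolutelyContinuous_of_le_smul h1).ae_le h⟩

end Regular

end Contour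

/-! ### Sobolev functions on the unit interval as indefinite integrals. -/

section Primitive

variable {E : Type*} [NormedAddCommGroup E] [NormedSpace ℝ E]

/-- On the unit interval, `f` is an indefinite integral of `h`. -/
def IsPrimitive (f h : ℝ → E) : Prop :=
  ∀ t ∈ Icc (0 : ℝ) 1, f t = f 0 + ∫ s in (0 : ℝ)..t, h s

/-- On the unit interval, `f` is an indefinite integral of a function in `L^p`. -/
def HasPrimitive (p : ℝ≥0∞) (f : ℝ → E) : Prop := ∃ h, MemLp h p unitVol ∧ IsPrimitive f h

theorem intervalIntegrable_of_memLp {h : ℝ → E} {p : ℝ≥0∞} (hp : 1 ≤ p) (hh : MemLp h p unitVol)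
    {s t : ℝ} (hs : s ∈ Icc (0 : ℝ) 1) (ht : t ∈ Icc (0 : ℝ) 1) : IntervalIntegrable h volume s t := by
  have h1 : IntegrableOn h (Icc 0 1) volume := hh.integrable hp
  rw [intervalIntegrable_iff]
  exact h1.mono_set (uIoc_subset_uIcc.trans ((convex_Icc (0 : ℝ) 1).ordConnected.uIcc_subset hs ht))

theorem memLp_of_continuousOn {f : ℝ → E} {p : ℝ≥0∞} (hc : ContinuousOn f (Icc 0 1)) :
    MemLp f p unitVol := by
  obtain ⟨M, hM⟩ := (isCompact_Icc (a := (0 : ℝ)) (b := 1)).exists_bound_of_continuousOn hc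
  refine MemLp.of_bound (hc.aestronglyMeasurable measurableSet_Icc) M ?_
  filter_upwards [ae_restrict_mem measurableSet_Icc] with t ht using hM t ht

theorem MemLp.continuousOn_smul [NormedSpace ℂ E] {c : ℝ → ℂ} {h : ℝ → E} {p : ℝ≥0∞}
    (hc : ContinuousOn c (Icc 0 1)) (hh : MemLp h p unitVol) :
    MemLp (fun t => c t • h t) p unitVol := by
  obtain ⟨M, hM⟩ := (isCompact_Icc (a := (0 : ℝ)) (b := 1)).exists_bound_of_continuousOn hc
  refine (hh.const_smul (M : ℂ)).mono
    ((hc.aestronglyMeasurable measurableSet_Icc).smul hh.1) ?_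
  filter_upwards [ae_restrict_mem measurableSet_Icc] with t ht
  rw [norm_smul, Pi.smul_apply, norm_smul]
  gcongr
  refine (hM t ht).trans ?_
  rw [Complex.norm_real]
  exact le_abs_self _

namespace IsPrimitive

variable {f h : ℝ → E} {p : ℝ≥0∞}

theorem sub_eq (hf : IsPrimitive f h) (hp : 1 ≤ p)
    (hh : MemLp h p unitVol) {s t : ℝ} (hs : s ∈ Icc (0 : ℝ) 1) (ht : t ∈ Icc (0 : ℝ) 1) :
    f t - f s = ∫ x in s..t, h x := by
  have z : (0 : ℝ) ∈ Icc (0 : ℝ) 1 := by simp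
  rw [hf t ht, hf s hs, add_sub_add_left_eq_sub]
  exact intervalIntegral.integral_interval_sub_left (intervalIntegrable_of_memLp hp hh z ht)
    (intervalIntegrable_of_memLp hp hh z hs)

theorem continuousOn (hf : IsPrimitive f h) (hp : 1 ≤ p)
    (hh : MemLp h p unitVol) : ContinuousOn f (Icc 0 1) := by
  have h1 : IntegrableOn h (uIcc 0 1) volume := by
    rw [uIcc_of_le zero_le_one]
    exact hh.integrable hp
  have := intervalIntegral.continuousOn_primitive_interval h1
  rw [uIcc_of_le zero_le_one] at this
  exact (continuousOn_const.add this).congr hf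

/-- Cauchy–Schwarz for the integral of h over [s, t]; this is where the exponent 1/2 of the kernel
estimates comes from. -/
theorem holder (hf : IsPrimitive f h) (hh : MemLp h 2 unitVol) :
    ∃ K : ℝ, ∀ s ∈ Icc (0 : ℝ) 1, ∀ t ∈ Icc (0 : ℝ) 1, ‖f s - f t‖ ≤ K * √|s - t| := by
  have key : ∀ s ∈ Icc (0 : ℝ) 1, ∀ t ∈ Icc (0 : ℝ) 1, s ≤ t →
      ‖f t - f s‖ ≤ (eLpNorm h 2 unitVol).toReal * √(t - s) := by
    intro s hs t ht hst
    have hi := intervalIntegrable_of_memLp one_le_two hh hs ht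
    rw [hf.sub_eq one_le_two hh hs ht, intervalIntegral.integral_of_le hst]
    have hsub : Ioc s t ⊆ Icc 0 1 := fun x hx => ⟨hs.1.trans hx.1.le, hx.2.trans ht.2⟩
    have hm : AEStronglyMeasurable h (volume.restrict (Ioc s t)) := hi.1.aestronglyMeasurable
    have e1 : ‖∫ x in Ioc s t, h x‖ₑ ≤ eLpNorm h 2 unitVol * ENNReal.ofReal (√(t - s)) := by
      refine (enorm_integral_le_lintegral_enorm _).trans ?_
      rw [← eLpNorm_one_eq_lintegral_enorm]
      refine (eLpNorm_le_eLpNorm_mul_rpow_measure_univ one_le_two hm).trans ?_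
      have : (volume.restrict (Ioc s t)) univ ^ (1 / ENNReal.toReal 1 - 1 / ENNReal.toReal 2) =
          ENNReal.ofReal (√(t - s)) := by
        rw [Measure.restrict_apply_univ, Real.volume_Ioc, Real.sqrt_eq_rpow,
          ENNReal.ofReal_rpow_of_nonneg (by linarith) (by norm_num)]
        norm_num
      rw [this]
      gcongr
      exact Measure.restrict_mono hsub le_rfl
    rw [← toReal_enorm]
    refine (ENNReal.toReal_mono (ENNReal.mul_ne_top hh.2.ne ENNReal.ofReal_ne_top) e1).trans ?_
    rw [ENNReal.toReal_mul, ENNReal.toReal_ofReal (Real.sqrt_nonneg _)]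
  refine ⟨(eLpNorm h 2 unitVol).toReal, fun s hs t ht => ?_⟩
  rcases le_total s t with hst | hst
  · rw [norm_sub_rev, abs_sub_comm, abs_of_nonneg (by linarith)]
    exact key s hs t ht hst
  · rw [abs_of_nonneg (by linarith)]
    exact key t ht s hs hst

end IsPrimitive

namespace HasPrimitive

variable {f g : ℝ → E} {p : ℝ≥0∞}

theorem zero : HasPrimitive p (0 : ℝ → E) := ⟨0, MemLp.zero, fun t _ => by simp⟩

theorem add (hp : 1 ≤ p) (hf : HasPrimitive p f) (hg : HasPrimitive p g) :
    HasPrimitive p (f + g) := by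
  obtain ⟨h1, m1, p1⟩ := hf
  obtain ⟨h2, m2, p2⟩ := hg
  refine ⟨h1 + h2, m1.add m2, fun t ht => ?_⟩
  have z : (0 : ℝ) ∈ Icc (0 : ℝ) 1 := by simp
  have := intervalIntegral.integral_add (intervalIntegrable_of_memLp hp m1 z ht)
    (intervalIntegrable_of_memLp hp m2 z ht)
  simp only [Pi.add_apply, this, p1 t ht, p2 t ht]
  abel

theorem const_smul [NormedSpace ℂ E] [SMulCommClass ℝ ℂ E] (c : ℂ) (hf : HasPrimitive p f) :
    HasPrimitive p (c • f) := by
  obtain ⟨h1, m1, p1⟩ := hf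
  refine ⟨c • h1, m1.const_smul c, fun t ht => ?_⟩
  have := intervalIntegral.integral_smul (μ := volume) (a := 0) (b := t) c h1
  simp only [Pi.smul_apply, this, p1 t ht, smul_add]

theorem mono {q : ℝ≥0∞} (hqp : q ≤ p) (hf : HasPrimitive p f) : HasPrimitive q f := by
  obtain ⟨h, hh, hprim⟩ := hf
  exact ⟨h, hh.mono_exponent hqp, hprim⟩

end HasPrimitive

/-- The functions max(‖f‖, C) and C are continuous and agree almost everywhere, hence everywhere on
the interval. -/
theorem enorm_le_of_ae_le {f : ℝ → E} {C : ℝ≥0∞} (hf : ContinuousOn f (Icc 0 1))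
    (h : ∀ᵐ t ∂unitVol, ‖f t‖ₑ ≤ C) {t : ℝ} (ht : t ∈ Icc (0 : ℝ) 1) : ‖f t‖ₑ ≤ C := by
  have h2 : (fun t => max ‖f t‖ₑ C) =ᵐ[unitVol] fun _ => C := by
    filter_upwards [h] with t ht using max_eq_right ht
  have h3 := Measure.eqOn_Icc_of_ae_eq volume zero_ne_one h2
    (hf.enorm.sup continuousOn_const) continuousOn_const ht
  exact (le_max_left _ _).trans h3.le

end Primitive

/-- Derivatives with respect to k and to the parameter differ by the factor γ', which is continuous
and has no zero on [0, 1]. -/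
theorem Contour.Regular.memSobolev_one_iff {Γ : Contour} (hΓ : Γ.Regular) {p : ℝ≥0∞} (hp : 1 ≤ p)
    {f : Fn Γ} : MemSobolev Γ 1 p f ↔ ∀ i, HasPrimitive (E := M2) p (f i) := by
  have hcont := hΓ.continuous_deriv
  have z : (0 : ℝ) ∈ Icc (0 : ℝ) 1 := by simp
  constructor
  · rintro ⟨D, hD0, hD, hDp⟩ i
    refine ⟨fun s => deriv (Γ.γ i) s • D 1 i s,
      MemLp.continuousOn_smul (hcont i).continuousOn ((hΓ.memLp_iff (E := M2) i).1 (hDp 1 le_rfl i)),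
      fun t ht => ?_⟩
    rw [← hD0 i t ht, ← hD0 i 0 z]
    exact hD 0 one_pos i t ht
  · intro h
    choose h hh hprim using h
    refine ⟨fun j => Nat.rec f (fun _ _ i t => (deriv (Γ.γ i) t)⁻¹ • h i t) j,
      fun i t _ => rfl, ?_, ?_⟩
    · intro j hj
      obtain rfl : j = 0 := by omega
      intro i t ht
      refine (hprim i t ht).trans (congrArg (f i 0 + ·) ?_)
      refine intervalIntegral.integral_congr fun s hs => ?_
      have hs' : s ∈ Icc (0 : ℝ) 1 := (convex_Icc (0 : ℝ) 1).ordConnected.uIcc_subset z ht hs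
      exact (smul_inv_smul₀ (hΓ.regular i s hs') _).symm
    · intro j hj i
      refine (hΓ.memLp_iff (E := M2) i).2 ?_
      rcases Nat.le_one_iff_eq_zero_or_eq_one.1 hj with rfl | rfl
      · exact memLp_of_continuousOn ((hprim i).continuousOn hp (hh i))
      · exact MemLp.continuousOn_smul ((hcont i).continuousOn.inv₀ (hΓ.regular i)) (hh i)

/-! ### Continuous functions on a contour -/

variable {Γ : Contour}

theorem continuous_toFn (f : PC Γ) (i : Γ.ι) : Continuous (toFn f i) :=
  (f i).continuous.Icc_extend'

theorem toFn_apply (f : PC Γ) (i : Γ.ι) {t : ℝ} (ht : t ∈ Icc (0 : ℝ) 1) :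
    toFn f i t = f i ⟨t, ht⟩ := IccExtend_of_mem _ _ ht

theorem toFn_sub (f g : PC Γ) : toFn (f - g) = toFn f - toFn g := rfl

theorem toFn_zero : toFn (0 : PC Γ) = 0 := rfl

theorem PC.ext_Icc {f g : PC Γ} (h : ∀ i, ∀ t ∈ Icc (0 : ℝ) 1, toFn f i t = toFn g i t) : f = g := by
  funext i
  ext1 t
  have := h i t t.2
  rwa [toFn_apply _ _ t.2, toFn_apply _ _ t.2] at this

theorem AEEq.eqOn {f g : Fn Γ} (h : AEEq f g) (hf : ∀ i, ContinuousOn (f i) (Icc 0 1))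
    (hg : ∀ i, ContinuousOn (g i) (Icc 0 1)) (i : Γ.ι) : EqOn (f i) (g i) (Icc 0 1) :=
  Measure.eqOn_Icc_of_ae_eq volume zero_ne_one (h i) (hf i) (hg i)

/-- A continuous representative is unique, so the choice made in `contRep` is harmless. -/
theorem contRep_eq {f : Fn Γ} {g : PC Γ} (h : AEEq (toFn g) f) : contRep f = g := by
  have hex : ∃ g : PC Γ, AEEq (toFn g) f := ⟨g, h⟩
  rw [contRep, dif_pos hex]
  have hc : AEEq (toFn hex.choose) (toFn g) := fun i => (hex.choose_spec i).trans (h i).symm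
  exact PC.ext_Icc fun i t ht => hc.eqOn (fun i => (continuous_toFn _ i).continuousOn)
    (fun i => (continuous_toFn _ i).continuousOn) i ht

/-- The restriction to the parameter interval of functions that are continuous there. -/
def ofContinuousOn (f : Fn Γ) (hf : ∀ i, ContinuousOn (f i) (Icc 0 1)) : PC Γ :=
  fun i => ⟨fun t => f i t, continuousOn_iff_continuous_domRestrict.1 (hf i)⟩

theorem toFn_ofContinuousOn (f : Fn Γ) (hf : ∀ i, ContinuousOn (f i) (Icc 0 1)) (i : Γ.ι) {t : ℝ}
    (ht : t ∈ Icc (0 : ℝ) 1) : toFn (ofContinuousOn f hf) i t = f i t := toFn_apply _ _ ht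

theorem aeeq_of_eqOn {f g : Fn Γ} (h : ∀ i, ∀ t ∈ Icc (0 : ℝ) 1, f i t = g i t) : AEEq f g := by
  intro i
  filter_upwards [ae_restrict_mem measurableSet_Icc] with t ht using h i t ht

theorem Contour.Regular.enorm_le_LinfNorm (hΓ : Γ.Regular) {f : Fn Γ} (i : Γ.ι)
    (hf : ContinuousOn (f i) (Icc 0 1)) {t : ℝ} (ht : t ∈ Icc (0 : ℝ) 1) :
    ‖f i t‖ₑ ≤ LinfNorm Γ f := by
  have h1 : ∀ᵐ t ∂unitVol, ‖f i t‖ₑ ≤ LinfNorm Γ f := by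
    rw [← hΓ.ae_iff i]
    filter_upwards [ae_le_eLpNormEssSup (f := f i) (μ := Γ.arclength i)] with t ht
    exact ht.trans (by
      rw [← eLpNorm_exponent_top]
      exact le_iSup (fun i => eLpNorm (f i) ⊤ (Γ.arclength i)) i)
  exact enorm_le_of_ae_le (E := M2) hf h1 ht

theorem Contour.Regular.LinfNorm_le (hΓ : Γ.Regular) {f : Fn Γ} {C : ℝ≥0∞}
    (hf : ∀ i, ∀ t ∈ Icc (0 : ℝ) 1, ‖f i t‖ₑ ≤ C) : LinfNorm Γ f ≤ C := by
  refine iSup_le fun i => ?_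
  rw [eLpNorm_exponent_top]
  refine eLpNormEssSup_le_of_ae_enorm_bound ?_
  rw [hΓ.ae_iff i]
  filter_upwards [ae_restrict_mem measurableSet_Icc] with t ht using hf i t ht

section EndCoeff

variable {E : Type*} [NormedAddCommGroup E] [NormedSpace ℂ E]

/-- The signed value of a function at an end. -/
def endCoeff (u : Γ.ι → ℝ → E) (e : Γ.End) : E := if e.2 then u e.1 1 else -u e.1 0

theorem sum_endCoeff_add (u v : Γ.ι → ℝ → E) (s : Finset Γ.End) :
    ∑ e ∈ s, endCoeff (u + v) e = ∑ e ∈ s, endCoeff u e + ∑ e ∈ s, endCoeff v e := by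
  rw [← Finset.sum_add_distrib]
  refine Finset.sum_congr rfl fun e _ => ?_
  simp only [endCoeff, Pi.add_apply]
  split_ifs
  · rfl
  · exact neg_add _ _

theorem sum_endCoeff_smul (c : ℂ) (u : Γ.ι → ℝ → E) (s : Finset Γ.End) :
    ∑ e ∈ s, endCoeff (c • u) e = c • ∑ e ∈ s, endCoeff u e := by
  rw [Finset.smul_sum]
  refine Finset.sum_congr rfl fun e _ => ?_
  simp only [endCoeff, Pi.smul_apply]
  split_ifs
  · rfl
  · exact (smul_neg _ _).symm

end EndCoeff

open Classical in
theorem zeroSum_iff {f : Fn Γ} :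
    ZeroSum Γ f ↔ ∀ a : ℂ, ∑ e : Γ.End with Γ.pt e = a, endCoeff (E := M2) f e = 0 := Iff.rfl

/-- `H¹_z(Γ)` as a subspace. -/
def H1zSub (hΓ : Γ.Regular) : Submodule ℂ (PC Γ) where
  carrier := H1z Γ
  zero_mem' := by
    refine ⟨(hΓ.memSobolev_one_iff one_le_two).2 fun i => HasPrimitive.zero, fun a => ?_⟩
    exact Finset.sum_eq_zero fun e _ => by rw [toFn_zero]; split_ifs <;> simp
  add_mem' := by
    rintro f g ⟨hf, hf'⟩ ⟨hg, hg'⟩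
    refine ⟨(hΓ.memSobolev_one_iff one_le_two).2 fun i => HasPrimitive.add one_le_two
      ((hΓ.memSobolev_one_iff one_le_two).1 hf i) ((hΓ.memSobolev_one_iff one_le_two).1 hg i),
      fun a => ?_⟩
    exact (sum_endCoeff_add (E := M2) _ _ _).trans ((congrArg₂ (· + ·) (zeroSum_iff.1 hf' a)
      (zeroSum_iff.1 hg' a)).trans (add_zero _))
  smul_mem' := by
    rintro c f ⟨hf, hf'⟩
    refine ⟨(hΓ.memSobolev_one_iff one_le_two).2 fun i => HasPrimitive.const_smul c
      ((hΓ.memSobolev_one_iff one_le_two).1 hf i), fun a => ?_⟩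
    exact (sum_endCoeff_smul (E := M2) c _ _).trans ((congrArg (c • ·) (zeroSum_iff.1 hf' a)).trans
      (smul_zero c))

theorem Contour.Regular.holder_of_mem_H1z (hΓ : Γ.Regular) {f : PC Γ} (hf : f ∈ H1z Γ) :
    ∃ K : ℝ, ∀ i, ∀ s ∈ Icc (0 : ℝ) 1, ∀ t ∈ Icc (0 : ℝ) 1,
      ‖toFn f i s - toFn f i t‖ ≤ K * √|s - t| := by
  have h1 := (hΓ.memSobolev_one_iff one_le_two).1 hf.1
  choose h hh hprim using h1
  choose K hK using fun i => IsPrimitive.holder (hprim i) (hh i)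
  refine ⟨∑ i, |K i|, fun i s hs t ht => (hK i s hs t ht).trans ?_⟩
  gcongr
  exact (le_abs_self _).trans (Finset.single_le_sum (fun i _ => abs_nonneg (K i)) (Finset.mem_univ i))

/-! ### Boundary values of Cauchy integrals over a contour -/

section BoundaryValues

variable {E : Type*} [NormedAddCommGroup E] [NormedSpace ℝ E] [NormedSpace ℂ E]
  [IsScalarTower ℝ ℂ E] [SMulCommClass ℝ ℂ E] [CompleteSpace E]

/-- Only the piece that contains the point has a jump there; the others do not meet the point and
contribute continuously. -/
theorem tendsto_sum_arcCauchy {P : Type*} [Fintype P] [DecidableEq P] {γ : P → ℝ → ℂ}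
    {u : P → ℝ → E} {a b : P → ℝ} (hγ : ∀ x, ContDiff ℝ ∞ (γ x)) (hu : ∀ x, Continuous (u x))
    (hab : ∀ x, a x ≤ b x) (x₀ : P) (h : ChordArc (γ x₀) (u x₀) (a x₀) (b x₀)) {t : ℝ}
    (ht : t ∈ Ioo (a x₀) (b x₀)) (hoff : ∀ x ≠ x₀, γ x₀ t ∉ γ x '' Icc (a x) (b x)) :
    Tendsto (fun ε : ℝ => ∑ x, arcCauchy (γ x) (u x) (a x) (b x)
        (γ x₀ t - ε * (Complex.I * deriv (γ x₀) t))) (𝓝[>] 0)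
      (𝓝 (arcPV (γ x₀) (u x₀) (a x₀) (b x₀) t + ∑ x ∈ Finset.univ.erase x₀,
        arcCauchy (γ x) (u x) (a x) (b x) (γ x₀ t))) := by
  have hn : Tendsto (fun ε : ℝ => γ x₀ t - ε * (Complex.I * deriv (γ x₀) t)) (𝓝[>] 0)
      (𝓝 (γ x₀ t)) := by
    have : Continuous fun ε : ℝ => γ x₀ t - ε * (Complex.I * deriv (γ x₀) t) := by fun_prop
    simpa using (this.tendsto 0).mono_left (nhdsWithin_le_nhds (s := Ioi 0))
  simp only [← Finset.add_sum_erase _ _ (Finset.mem_univ x₀)]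
  refine (h.arcCauchy_right_tendsto ht).add (tendsto_finsetSum _ fun x hx => ?_)
  exact (continuousAt_arcCauchy (hγ x) (hu x) (hab x) (hoff x (Finset.ne_of_mem_erase hx))).tendsto.comp hn

theorem eventually_normal_notMem {P : Type*} [Fintype P] {γ : P → ℝ → ℂ}
    {u : P → ℝ → E} {a b : P → ℝ} (hγ : ∀ x, ContDiff ℝ ∞ (γ x)) (x₀ : P)
    (h : ChordArc (γ x₀) (u x₀) (a x₀) (b x₀)) {t : ℝ}
    (ht : t ∈ Ioo (a x₀) (b x₀)) (hoff : ∀ x ≠ x₀, γ x₀ t ∉ γ x '' Icc (a x) (b x)) :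
    ∀ᶠ ε : ℝ in 𝓝[>] 0, ∀ x, γ x₀ t - ε * (Complex.I * deriv (γ x₀) t) ∉
      γ x '' Icc (a x) (b x) := by
  have hn : Tendsto (fun ε : ℝ => γ x₀ t - ε * (Complex.I * deriv (γ x₀) t)) (𝓝[>] 0)
      (𝓝 (γ x₀ t)) := by
    have : Continuous fun ε : ℝ => γ x₀ t - ε * (Complex.I * deriv (γ x₀) t) := by fun_prop
    simpa using (this.tendsto 0).mono_left (nhdsWithin_le_nhds (s := Ioi 0))
  rw [eventually_all]
  intro x
  by_cases hx : x = x₀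
  · subst hx
    filter_upwards [self_mem_nhdsWithin] with ε hε
    rintro ⟨s, hs, he⟩
    exact h.ne_of_ne hs (Ioo_subset_Icc_self ht) (le_of_lt hε) (Or.inr hε) (sub_eq_zero.2 he)
  · have hcl : IsClosed (γ x '' Icc (a x) (b x)) :=
      (isCompact_Icc.image (hγ x).continuous).isClosed
    exact hn.eventually (hcl.isOpen_compl.mem_nhds (hoff x hx))

/-- The Cauchy integral of a vector-valued density. -/
def cauchyInt (Γ : Contour) (u : Γ.ι → ℝ → E) (z : ℂ) : E :=
  (1 / (2 * Real.pi * Complex.I) : ℂ) •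
    ∑ i, ∫ t in (0 : ℝ)..1, (deriv (Γ.γ i) t / (Γ.γ i t - z)) • u i t

/-- The points approaching `γ i t` from the right along the normal. -/
def rightNormal (Γ : Contour) (i : Γ.ι) (t ε : ℝ) : ℂ :=
  Γ.γ i t - (ε : ℂ) * (Complex.I * deriv (Γ.γ i) t)

/-- The parameter at distance `x` from an end. -/
def endPar {Γ : Contour} (e : Γ.End) (x : ℝ) : ℝ := if e.2 then 1 - x else x

/-- The arc of an end, parametrized so that it starts at this end. -/
def outArc (Γ : Contour) (e : Γ.End) (x : ℝ) : ℂ := Γ.γ e.1 (endPar e x)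

/-- The arc that carries a piece of the subdivision of a contour. -/
def pieceArc {Γ : Contour} : Γ.End ⊕ Γ.ι → Γ.ι := Sum.elim (fun e => e.1) id

/-- The left end of a piece of the subdivision of a contour. -/
def pieceLo {Γ : Contour} (p q : Γ.ι → ℝ) : Γ.End ⊕ Γ.ι → ℝ :=
  Sum.elim (fun e => if e.2 then q e.1 else 0) p

/-- The right end of a piece of the subdivision of a contour. -/
def pieceHi {Γ : Contour} (p q : Γ.ι → ℝ) : Γ.End ⊕ Γ.ι → ℝ :=
  Sum.elim (fun e => if e.2 then 1 else p e.1) q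

/-- The contribution of a piece to the Cauchy integral. -/
def pieceCauchy {Γ : Contour} (u : Γ.ι → ℝ → E) (p q : Γ.ι → ℝ) (x : Γ.End ⊕ Γ.ι) (z : ℂ) : E :=
  arcCauchy (Γ.γ (pieceArc x)) (u (pieceArc x)) (pieceLo p q x) (pieceHi p q x) z

variable {Γ : Contour} {u : Γ.ι → ℝ → E} {p q : Γ.ι → ℝ}

theorem piece_subset (hp : ∀ j, 0 ≤ p j) (hpq : ∀ j, p j ≤ q j) (hq : ∀ j, q j ≤ 1)
    (x : Γ.End ⊕ Γ.ι) : pieceLo p q x ≤ pieceHi p q x ∧ 0 ≤ pieceLo p q x ∧ pieceHi p q x ≤ 1 := by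
  rcases x with ⟨j, b⟩ | j
  · have := hp j; have := hpq j; have := hq j
    cases b <;> simp [pieceLo, pieceHi] <;> constructor <;> linarith
  · exact ⟨hpq j, hp j, hq j⟩

/-- Each arc is cut at p and q into two end pieces, indexed by the ends, and a middle piece. This
isolates the parts of the contour that are singular at a junction, even if both ends of an arc lie
there. -/
theorem cauchyInt_eq_sum_pieces (hs : ∀ i, ContDiff ℝ ∞ (Γ.γ i)) (hu : ∀ i, Continuous (u i))
    (hp : ∀ j, 0 ≤ p j) (hpq : ∀ j, p j ≤ q j) (hq : ∀ j, q j ≤ 1) {z : ℂ}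
    (hz : ∀ x, z ∉ Γ.γ (pieceArc x) '' Icc (pieceLo p q x) (pieceHi p q x)) :
    cauchyInt Γ u z = (1 / (2 * Real.pi * Complex.I) : ℂ) • ∑ x, pieceCauchy u p q x z := by
  have hint := fun x => intervalIntegrable_cauchyKernel (hs (pieceArc x)) (hu (pieceArc x))
    (piece_subset hp hpq hq x).1 (hz x)
  rw [cauchyInt, Fintype.sum_sum_type, Fintype.sum_prod_type, ← Finset.sum_add_distrib]
  congr 1
  refine Finset.sum_congr rfl fun j _ => ?_
  rw [Fintype.sum_bool]
  have h1 := hint (Sum.inl (j, false))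
  have h2 := hint (Sum.inr j)
  have h3 := hint (Sum.inl (j, true))
  simp only [pieceLo, pieceHi, pieceArc, Sum.elim_inl, Sum.elim_inr, if_true, Bool.false_eq_true,
    if_false, id] at h1 h2 h3
  simp only [pieceCauchy, pieceLo, pieceHi, pieceArc, Sum.elim_inl, Sum.elim_inr, if_true,
    Bool.false_eq_true, if_false, id, arcCauchy]
  rw [← intervalIntegral.integral_add_adjacent_intervals (h1.trans h2) h3,
    ← intervalIntegral.integral_add_adjacent_intervals h1 h2]
  abel

open Classical in
theorem tendsto_cauchyInt_right (hs : ∀ i, ContDiff ℝ ∞ (Γ.γ i)) (hu : ∀ i, Continuous (u i))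
    (hp : ∀ j, 0 ≤ p j) (hpq : ∀ j, p j ≤ q j) (hq : ∀ j, q j ≤ 1) (x₀ : Γ.End ⊕ Γ.ι)
    (h : ChordArc (Γ.γ (pieceArc x₀)) (u (pieceArc x₀)) (pieceLo p q x₀) (pieceHi p q x₀)) {t : ℝ}
    (ht : t ∈ Ioo (pieceLo p q x₀) (pieceHi p q x₀))
    (hoff : ∀ x ≠ x₀, Γ.γ (pieceArc x₀) t ∉
      Γ.γ (pieceArc x) '' Icc (pieceLo p q x) (pieceHi p q x)) :
    Tendsto (fun ε => cauchyInt Γ u (rightNormal Γ (pieceArc x₀) t ε)) (𝓝[>] 0)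
      (𝓝 ((1 / (2 * Real.pi * Complex.I) : ℂ) •
        (arcPV (Γ.γ (pieceArc x₀)) (u (pieceArc x₀)) (pieceLo p q x₀) (pieceHi p q x₀) t +
          ∑ x ∈ Finset.univ.erase x₀, pieceCauchy u p q x (Γ.γ (pieceArc x₀) t)))) := by
  have hab := fun x => (piece_subset (Γ := Γ) hp hpq hq x).1
  have h1 := tendsto_sum_arcCauchy (γ := fun x => Γ.γ (pieceArc x)) (u := fun x => u (pieceArc x))
    (fun x => hs _) (fun x => hu _) hab x₀ h ht hoff
  refine Tendsto.congr' ?_ (h1.const_smul _)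
  filter_upwards [eventually_normal_notMem (γ := fun x => Γ.γ (pieceArc x))
    (u := fun x => u (pieceArc x)) (fun x => hs _) x₀ h ht hoff] with ε hε
  exact (cauchyInt_eq_sum_pieces hs hu hp hpq hq hε).symm

/-- Reversal of the arc reduces terminal ends to initial ends; the minus sign is the one in
`endCoeff`. -/
theorem arcCauchy_reflect (γ : ℝ → ℂ) (u : ℝ → E) (δ : ℝ) (z : ℂ) :
    arcCauchy γ u (1 - δ) 1 z =
      -arcCauchy (fun x => γ (1 - x)) (fun x => u (1 - x)) 0 δ z := by
  have := intervalIntegral.integral_comp_sub_left (a := 0) (b := δ)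
    (fun s => (deriv γ s / (γ s - z)) • u s) 1
  rw [sub_zero] at this
  rw [arcCauchy, ← this, arcCauchy, ← intervalIntegral.integral_neg]
  refine intervalIntegral.integral_congr fun s _ => ?_
  simp only [deriv_comp_const_sub, neg_div, neg_smul, neg_neg]

theorem Contour.pt_eq_outArc (e : Γ.End) : Γ.pt e = outArc Γ e 0 := by
  obtain ⟨j, b⟩ := e
  cases b <;> simp [Contour.pt, Contour.par, outArc, endPar]

theorem Contour.dir_eq_deriv_outArc (e : Γ.End) : Γ.dir e = deriv (outArc Γ e) 0 := by
  obtain ⟨j, b⟩ := e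
  cases b
  · simp only [Contour.dir, Bool.false_eq_true, if_false]
    rfl
  · simp only [Contour.dir, if_true]
    have : outArc Γ (j, true) = fun x => Γ.γ j (1 - x) := by
      funext x; simp [outArc, endPar]
    rw [this, deriv_comp_const_sub, sub_zero]

theorem contDiff_outArc (hs : ∀ i, ContDiff ℝ ∞ (Γ.γ i)) (e : Γ.End) :
    ContDiff ℝ ∞ (outArc Γ e) := by
  obtain ⟨j, b⟩ := e
  cases b
  · exact hs j
  · have : outArc Γ (j, true) = fun x => Γ.γ j (1 - x) := by
      funext x; simp [outArc, endPar]
    rw [this]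
    exact (hs j).comp (contDiff_const.sub contDiff_id)

theorem exists_chordArc {γ : ℝ → ℂ} {v : ℝ → E} (hγ : ContDiff ℝ ∞ γ) (hv : Continuous v) {K : ℝ}
    (hK : ∀ s ∈ Icc (0 : ℝ) 1, ∀ t ∈ Icc (0 : ℝ) 1, ‖v s - v t‖ ≤ K * √|s - t|) {t₀ : ℝ}
    (h0 : deriv γ t₀ ≠ 0) : ∃ r > 0, ∀ a b : ℝ, a < b → 0 ≤ a → b ≤ 1 → t₀ - r ≤ a → b ≤ t₀ + r →
      ChordArc γ v a b := by
  obtain ⟨c, hc, r, hr, h⟩ := exists_chord_bound hγ h0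
  refine ⟨r, hr, fun a b hab ha hb har hbr => ⟨hab, hγ, hv, ⟨c, hc, fun s hs t ht ε hε => ?_⟩,
    ⟨K, fun s hs t ht => hK s ⟨ha.trans hs.1, hs.2.trans hb⟩ t ⟨ha.trans ht.1, ht.2.trans hb⟩⟩⟩⟩
  exact h s t (abs_le.2 ⟨by linarith [hs.1], by linarith [hs.2]⟩)
    (abs_le.2 ⟨by linarith [ht.1], by linarith [ht.2]⟩) ε hε

/-- A subdivision that isolates an interior point of an arc. -/
theorem exists_interior_pieces (hΓ : Γ.IsPiecewiseSmooth) (hu : ∀ i, Continuous (u i)) {K : ℝ}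
    (hK : ∀ i, ∀ s ∈ Icc (0 : ℝ) 1, ∀ t ∈ Icc (0 : ℝ) 1, ‖u i s - u i t‖ ≤ K * √|s - t|)
    (i : Γ.ι) {t₀ : ℝ} (ht₀ : t₀ ∈ Ioo (0 : ℝ) 1) :
    ∃ p q : Γ.ι → ℝ, (∀ j, 0 ≤ p j) ∧ (∀ j, p j ≤ q j) ∧ (∀ j, q j ≤ 1) ∧
      ChordArc (Γ.γ i) (u i) (p i) (q i) ∧ t₀ ∈ Ioo (p i) (q i) ∧
      ∀ t ∈ Ioo (p i) (q i), ∀ x ≠ Sum.inr i, Γ.γ i t ∉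
        Γ.γ (pieceArc x) '' Icc (pieceLo p q x) (pieceHi p q x) := by
  obtain ⟨r, hr, hchord⟩ := exists_chordArc (hΓ.smooth i) (hu i) (hK i)
    (hΓ.regular i t₀ (Ioo_subset_Icc_self ht₀))
  obtain ⟨δ, hδ, hδr, hδ0, hδ1⟩ : ∃ δ > 0, δ ≤ r ∧ δ ≤ t₀ ∧ δ ≤ 1 - t₀ :=
    ⟨min r (min t₀ (1 - t₀)), lt_min hr (lt_min ht₀.1 (by linarith [ht₀.2])), min_le_left _ _,
      (min_le_right _ _).trans (min_le_left _ _), (min_le_right _ _).trans (min_le_right _ _)⟩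
  set p : Γ.ι → ℝ := fun _ => t₀ - δ
  set q : Γ.ι → ℝ := fun _ => t₀ + δ
  have hp : ∀ j, 0 ≤ p j := fun j => by simp only [p]; linarith
  have hpq : ∀ j, p j ≤ q j := fun j => by simp only [p, q]; linarith
  have hq : ∀ j, q j ≤ 1 := fun j => by simp only [q]; linarith
  refine ⟨p, q, hp, hpq, hq, hchord _ _ (by simp only [p, q]; linarith) (hp i) (hq i)
    (by simp only [p]; linarith) (by simp only [q]; linarith),
    ⟨by simp only [p]; linarith, by simp only [q]; linarith⟩, ?_⟩
  rintro t ht x hx ⟨s, hsm, he⟩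
  obtain ⟨-, e0, e1⟩ := piece_subset hp hpq hq x
  have ht1 : t ∈ Ioo (0 : ℝ) 1 := ⟨(hp i).trans_lt ht.1, ht.2.trans_le (hq i)⟩
  -- A point interior to an arc is met by no other arc and at no other parameter, and the end pieces
  -- of the same arc stop at `p i` and `q i`.
  rcases hΓ.meet _ _ s ⟨e0.trans hsm.1, hsm.2.trans e1⟩ t (Ioo_subset_Icc_self ht1) he with
    ⟨h1, h2⟩ | ⟨-, h2 | h2⟩
  · simp only [p, q] at ht
    rcases x with ⟨j, b⟩ | j
    · cases b <;> simp [pieceLo, pieceHi, p, q] at hsm <;> linarith [ht.1, ht.2]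
    · exact hx (congrArg Sum.inr h1)
  · exact ht1.1.ne' h2
  · exact ht1.2.ne h2

open Classical in
/-- Near an interior point of an arc, the boundary values from the right exist and converge. -/
theorem exists_boundary_interior (hΓ : Γ.IsPiecewiseSmooth) (hu : ∀ i, Continuous (u i)) {K : ℝ}
    (hK : ∀ i, ∀ s ∈ Icc (0 : ℝ) 1, ∀ t ∈ Icc (0 : ℝ) 1, ‖u i s - u i t‖ ≤ K * √|s - t|)
    (i : Γ.ι) {t₀ : ℝ} (ht₀ : t₀ ∈ Ioo (0 : ℝ) 1) :
    ∃ (B : ℝ → E) (y : E), Tendsto B (𝓝 t₀) (𝓝 y) ∧ ∀ᶠ t in 𝓝 t₀,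
      Tendsto (fun ε => cauchyInt Γ u (rightNormal Γ i t ε)) (𝓝[>] 0) (𝓝 (B t)) := by
  have hs := hΓ.smooth
  obtain ⟨p, q, hp, hpq, hq, hown, hmem, hoff⟩ := exists_interior_pieces hΓ hu hK i ht₀
  obtain ⟨y, hy⟩ := hown.tendsto_arcPV hmem
  have hrest : Tendsto (fun t => ∑ x ∈ Finset.univ.erase (Sum.inr i), pieceCauchy u p q x (Γ.γ i t))
      (𝓝 t₀) (𝓝 (∑ x ∈ Finset.univ.erase (Sum.inr i), pieceCauchy u p q x (Γ.γ i t₀))) := by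
    refine tendsto_finsetSum _ fun x hx => ?_
    exact (continuousAt_arcCauchy (hs _) (hu _) (piece_subset hp hpq hq x).1 (hoff t₀
      hmem x (Finset.ne_of_mem_erase hx))).tendsto.comp ((hs i).continuous.tendsto t₀)
  exact ⟨_, _, (hy.add hrest).const_smul (1 / (2 * Real.pi * Complex.I) : ℂ),
    (eventually_mem_set.2 (Ioo_mem_nhds hmem.1 hmem.2)).mono fun t ht =>
      tendsto_cauchyInt_right hs hu hp hpq hq (Sum.inr i) hown ht (hoff t ht)⟩

theorem eventually_rightNormal_notMem_trace (hΓ : Γ.IsPiecewiseSmooth) (i : Γ.ι) {t₀ : ℝ}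
    (ht₀ : t₀ ∈ Ioo (0 : ℝ) 1) : ∀ᶠ ε in 𝓝[>] 0, rightNormal Γ i t₀ ε ∉ Γ.trace := by
  -- The density enters a subdivision only through its continuity and Hölder bound, so the zero
  -- density will do.
  obtain ⟨p, q, hp, hpq, hq, hown, hmem, hoff⟩ := exists_interior_pieces hΓ (u := fun _ _ => (0 : ℂ))
    (fun _ => continuous_const) (K := 0) (by simp) i ht₀
  filter_upwards [eventually_normal_notMem (γ := fun x => Γ.γ (pieceArc x))
    (u := fun _ _ => (0 : ℂ)) (a := pieceLo p q) (b := pieceHi p q)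
    (fun x => hΓ.smooth _) (Sum.inr i) hown hmem (hoff t₀ hmem)] with ε hε hmem
  obtain ⟨j, s, hs, he⟩ := mem_iUnion.1 hmem
  rcases le_total s (p j) with h1 | h1
  · exact hε (Sum.inl (j, false)) ⟨s, ⟨hs.1, h1⟩, he⟩
  rcases le_total s (q j) with h2 | h2
  · exact hε (Sum.inr j) ⟨s, ⟨h1, h2⟩, he⟩
  · exact hε (Sum.inl (j, true)) ⟨s, ⟨h2, hs.2⟩, he⟩

theorem exists_tendsto_piece_corner (hΓ : Γ.IsPiecewiseSmooth) (hu : ∀ i, Continuous (u i)) {K : ℝ}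
    (hK : ∀ i, ∀ s ∈ Icc (0 : ℝ) 1, ∀ t ∈ Icc (0 : ℝ) 1, ‖u i s - u i t‖ ≤ K * √|s - t|)
    {e₀ e : Γ.End} (hne : e ≠ e₀) (hpt : Γ.pt e = Γ.pt e₀) :
    ∃ r > 0, ∀ δ, 0 < δ → δ ≤ r → ∃ y, Tendsto
      (fun x : ℝ => pieceCauchy u (fun _ => δ) (fun _ => 1 - δ) (Sum.inl e) (outArc Γ e₀ x) -
        (Real.log x : ℂ) • endCoeff u e) (𝓝[>] 0) (𝓝 y) := by
  have hs := hΓ.smooth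
  have h0 : outArc Γ e 0 = outArc Γ e₀ 0 := by
    rw [← Contour.pt_eq_outArc, ← Contour.pt_eq_outArc, hpt]
  have hd : ¬ SameRay ℝ (deriv (outArc Γ e) 0) (deriv (outArc Γ e₀) 0) := by
    rw [← Contour.dir_eq_deriv_outArc, ← Contour.dir_eq_deriv_outArc]
    exact hΓ.directions e e₀ hne hpt
  have z : (0 : ℝ) ∈ Icc (0 : ℝ) 1 := by simp
  obtain ⟨j, b⟩ := e
  cases b
  · obtain ⟨r, hr, h⟩ := tendsto_arcCauchy_corner (contDiff_outArc hs (j, false))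
      (contDiff_outArc hs e₀) h0 hd (hu j) (K := K) (fun s hs => by
        simpa [abs_of_nonneg hs.1] using hK j s hs 0 z)
    refine ⟨r, hr, fun δ hδ hδr => ?_⟩
    obtain ⟨y, hy⟩ := h δ hδ hδr
    refine ⟨y, hy.congr fun x => ?_⟩
    simp only [endCoeff, Bool.false_eq_true, if_false, smul_neg, sub_neg_eq_add]
    rfl
  · obtain ⟨r, hr, h⟩ := tendsto_arcCauchy_corner (contDiff_outArc hs (j, true))
      (contDiff_outArc hs e₀) h0 hd (u := fun x => u j (1 - x))
      ((hu j).comp (continuous_const.sub continuous_id)) (K := K) (fun s hs => by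
        have := hK j (1 - s) ⟨by linarith [hs.2], by linarith [hs.1]⟩ (1 - 0) (by simp)
        simpa [abs_of_nonneg hs.1] using this)
    refine ⟨r, hr, fun δ hδ hδr => ?_⟩
    obtain ⟨y, hy⟩ := h δ hδ hδr
    refine ⟨-y, hy.neg.congr fun x => ?_⟩
    have e1 : outArc Γ (j, true) = fun x => Γ.γ j (1 - x) := by
      funext x; simp [outArc, endPar]
    simp only [endCoeff, if_true, pieceCauchy, pieceArc, pieceLo, pieceHi, Sum.elim_inl,
      arcCauchy_reflect, e1, sub_zero, neg_add, ← sub_eq_add_neg]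

theorem exists_tendsto_piece_own (hΓ : Γ.IsPiecewiseSmooth) (hu : ∀ i, Continuous (u i)) {K : ℝ}
    (hK : ∀ i, ∀ s ∈ Icc (0 : ℝ) 1, ∀ t ∈ Icc (0 : ℝ) 1, ‖u i s - u i t‖ ≤ K * √|s - t|)
    (e₀ : Γ.End) : ∃ r > 0, ∀ δ, 0 < δ → δ ≤ r → δ < 1 →
      ChordArc (Γ.γ e₀.1) (u e₀.1) (pieceLo (fun _ => δ) (fun _ => 1 - δ) (Sum.inl e₀))
        (pieceHi (fun _ => δ) (fun _ => 1 - δ) (Sum.inl e₀)) ∧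
      ∃ y, Tendsto (fun x : ℝ => arcPV (Γ.γ e₀.1) (u e₀.1)
          (pieceLo (fun _ => δ) (fun _ => 1 - δ) (Sum.inl e₀))
          (pieceHi (fun _ => δ) (fun _ => 1 - δ) (Sum.inl e₀)) (endPar e₀ x) -
        (Real.log x : ℂ) • endCoeff u e₀) (𝓝[>] 0) (𝓝 y) := by
  have hs := hΓ.smooth
  obtain ⟨i, b⟩ := e₀
  cases b
  · obtain ⟨r, hr, h⟩ := exists_chordArc (hs i) (hu i) (hK i) (hΓ.regular i 0 (by simp))
    refine ⟨r, hr, fun δ hδ hδr hδ1 => ?_⟩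
    have hc := h 0 δ hδ le_rfl hδ1.le (by linarith) (by linarith)
    obtain ⟨y, hy⟩ := hc.tendsto_arcPV_left
    refine ⟨hc, y, hy.congr fun x => ?_⟩
    simp [endCoeff, pieceLo, pieceHi, endPar]
  · obtain ⟨r, hr, h⟩ := exists_chordArc (hs i) (hu i) (hK i) (hΓ.regular i 1 (by simp))
    refine ⟨r, hr, fun δ hδ hδr hδ1 => ?_⟩
    have hc := h (1 - δ) 1 (by linarith) (by linarith) le_rfl (by linarith) (by linarith)
    obtain ⟨y, hy⟩ := hc.tendsto_arcPV_right
    refine ⟨hc, y, hy.congr fun x => ?_⟩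
    simp [endCoeff, pieceLo, pieceHi, endPar]

open Classical in
/-- The boundary values from the right converge at the ends of an arc, because the logarithmic
singularities cancel. -/
theorem exists_boundary_end (hΓ : Γ.IsPiecewiseSmooth) (hu : ∀ i, Continuous (u i)) {K : ℝ}
    (hK : ∀ i, ∀ s ∈ Icc (0 : ℝ) 1, ∀ t ∈ Icc (0 : ℝ) 1, ‖u i s - u i t‖ ≤ K * √|s - t|)
    (hzero : ∀ a : ℂ, ∑ e : Γ.End with Γ.pt e = a, endCoeff u e = 0) (e₀ : Γ.End) :
    ∃ (B : ℝ → E) (y : E), Tendsto B (𝓝[>] 0) (𝓝 y) ∧ ∀ᶠ x in 𝓝[>] 0,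
      Tendsto (fun ε => cauchyInt Γ u (rightNormal Γ e₀.1 (endPar e₀ x) ε)) (𝓝[>] 0) (𝓝 (B x)) := by
  have hs := hΓ.smooth
  obtain ⟨r₀, hr₀, hown⟩ := exists_tendsto_piece_own hΓ hu hK e₀
  have hex : ∀ e : Γ.End, ∃ r > 0, e ≠ e₀ → Γ.pt e = Γ.pt e₀ → ∀ δ, 0 < δ → δ ≤ r → ∃ y, Tendsto
      (fun x : ℝ => pieceCauchy u (fun _ => δ) (fun _ => 1 - δ) (Sum.inl e) (outArc Γ e₀ x) -
        (Real.log x : ℂ) • endCoeff u e) (𝓝[>] 0) (𝓝 y) := by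
    intro e
    by_cases h : e ≠ e₀ ∧ Γ.pt e = Γ.pt e₀
    · obtain ⟨r, hr, h'⟩ := exists_tendsto_piece_corner hΓ hu hK h.1 h.2
      exact ⟨r, hr, fun _ _ => h'⟩
    · exact ⟨1, one_pos, fun h1 h2 => absurd ⟨h1, h2⟩ h⟩
  choose r hr hcorner using hex
  -- One length of end pieces for all ends, below all local radii; δ < 1/2 keeps the two end pieces
  -- of an arc apart.
  obtain ⟨δ, ⟨hδ0, hδh⟩, hδr₀, hδr⟩ : ∃ δ : ℝ, δ ∈ Ioo (0 : ℝ) (1 / 2) ∧ δ ≤ r₀ ∧ ∀ e, δ ≤ r e := by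
    have h1 : ∀ᶠ δ : ℝ in 𝓝[>] 0, δ ∈ Ioo (0 : ℝ) (1 / 2) := Ioo_mem_nhdsGT (by norm_num)
    have h2 : ∀ᶠ δ : ℝ in 𝓝[>] 0, δ ≤ r₀ :=
      nhdsWithin_le_nhds ((eventually_lt_nhds hr₀).mono fun _ h => h.le)
    have h3 : ∀ᶠ δ : ℝ in 𝓝[>] 0, ∀ e, δ ≤ r e := eventually_all.2 fun e =>
      nhdsWithin_le_nhds ((eventually_lt_nhds (hr e)).mono fun _ h => h.le)
    exact (h1.and (h2.and h3)).exists
  obtain ⟨hchord, y₀, hy₀⟩ := hown δ hδ0 hδr₀ (by linarith)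
  set p : Γ.ι → ℝ := fun _ => δ
  set q : Γ.ι → ℝ := fun _ => 1 - δ
  have hp : ∀ j, 0 ≤ p j := fun j => hδ0.le
  have hpq : ∀ j, p j ≤ q j := fun j => by simp only [p, q]; linarith
  have hq : ∀ j, q j ≤ 1 := fun j => by simp only [q]; linarith
  have hmem : ∀ x ∈ Ioo 0 δ, endPar e₀ x ∈ Ioo (pieceLo p q (Sum.inl e₀)) (pieceHi p q (Sum.inl e₀)) := by
    intro x hx
    obtain ⟨i, b⟩ := e₀
    cases b <;> simp [endPar, pieceLo, pieceHi, p, q, hx.1, hx.2]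
  have hmem1 : ∀ x ∈ Ioo 0 δ, endPar e₀ x ∈ Ioo (0 : ℝ) 1 := by
    intro x hx
    have h1 := hmem x hx
    obtain ⟨-, e0, e1⟩ := piece_subset hp hpq hq (Sum.inl e₀)
    exact ⟨e0.trans_lt h1.1, h1.2.trans_le e1⟩
  have hoff : ∀ x ∈ Ioo 0 δ, ∀ y ≠ Sum.inl e₀, Γ.γ e₀.1 (endPar e₀ x) ∉
      Γ.γ (pieceArc y) '' Icc (pieceLo p q y) (pieceHi p q y) := by
    rintro x hx y hy ⟨s, hsm, he⟩
    obtain ⟨-, e0, e1⟩ := piece_subset hp hpq hq y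
    have ht1 := hmem1 x hx
    rcases hΓ.meet _ _ s ⟨e0.trans hsm.1, hsm.2.trans e1⟩ _ (Ioo_subset_Icc_self ht1) he with
      ⟨h1, h2⟩ | ⟨-, h2 | h2⟩
    · have hm := hmem x hx
      rw [← h2] at hm
      obtain ⟨i, b₀⟩ := e₀
      rcases y with ⟨j, b⟩ | j
      · have h1' : j = i := h1
        subst h1'
        cases b <;> cases b₀
        · exact hy rfl
        · simp [pieceLo, pieceHi, p, q] at hsm hm
          linarith [hsm.1, hsm.2, hm.1, hm.2]
        · simp [pieceLo, pieceHi, p, q] at hsm hm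
          linarith [hsm.1, hsm.2, hm.1, hm.2]
        · exact hy rfl
      · cases b₀
        · simp [pieceLo, pieceHi, p, q] at hsm hm
          linarith [hsm.1, hsm.2, hm.1, hm.2]
        · simp [pieceLo, pieceHi, p, q] at hsm hm
          linarith [hsm.1, hsm.2, hm.1, hm.2]
    · exact ht1.1.ne' h2
    · exact ht1.2.ne h2
  have hev : ∀ᶠ x : ℝ in 𝓝[>] 0, x ∈ Ioo 0 δ := Ioo_mem_nhdsGT hδ0
  have hout : Tendsto (outArc Γ e₀) (𝓝[>] 0) (𝓝 (Γ.pt e₀)) := by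
    rw [Contour.pt_eq_outArc]
    exact ((contDiff_outArc hs e₀).continuous.tendsto 0).mono_left nhdsWithin_le_nhds
  -- the singularities of all pieces
  let W : Γ.End ⊕ Γ.ι → E := Sum.elim (fun e => if Γ.pt e = Γ.pt e₀ then endCoeff u e else 0) fun _ => 0
  have hW : ∑ y, W y = 0 := by
    rw [Fintype.sum_sum_type]
    simp only [W, Sum.elim_inl, Sum.elim_inr, Finset.sum_const_zero, add_zero]
    rw [← Finset.sum_filter]
    exact hzero _
  have hpiece : ∀ y ∈ Finset.univ.erase (Sum.inl e₀), ∃ Y, Tendsto (fun x : ℝ =>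
      pieceCauchy u p q y (outArc Γ e₀ x) - (Real.log x : ℂ) • W y) (𝓝[>] 0) (𝓝 Y) := by
    intro y hy
    have hy := Finset.ne_of_mem_erase hy
    have hregular : Γ.pt e₀ ∉ Γ.γ (pieceArc y) '' Icc (pieceLo p q y) (pieceHi p q y) → W y = 0 →
        ∃ Y, Tendsto (fun x : ℝ =>
          pieceCauchy u p q y (outArc Γ e₀ x) - (Real.log x : ℂ) • W y) (𝓝[>] 0) (𝓝 Y) := by
      intro h1 h2
      refine ⟨pieceCauchy u p q y (Γ.pt e₀), ?_⟩
      simp only [h2, smul_zero, sub_zero]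
      exact (continuousAt_arcCauchy (hs _) (hu _) (piece_subset hp hpq hq y).1 h1).tendsto.comp hout
    have hends : ∀ s, s ∈ Icc (0 : ℝ) 1 → Γ.γ (pieceArc y) s = Γ.pt e₀ → s = 0 ∨ s = 1 := by
      intro s hsm he
      have hpar : Γ.par e₀ ∈ Icc (0 : ℝ) 1 ∧ (Γ.par e₀ = 0 ∨ Γ.par e₀ = 1) := by
        simp only [Contour.par]
        split_ifs <;> simp
      rcases hΓ.meet _ _ s hsm _ hpar.1 he with ⟨-, h2⟩ | ⟨h2, -⟩
      · rw [h2]; exact hpar.2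
      · exact h2
    rcases y with e | j
    · by_cases hpt : Γ.pt e = Γ.pt e₀
      · obtain ⟨Y, hY⟩ := hcorner e (fun h => hy (congrArg Sum.inl h)) hpt δ hδ0 (hδr e)
        refine ⟨Y, ?_⟩
        simp only [W, Sum.elim_inl, if_pos hpt]
        exact hY
      · refine hregular ?_ (if_neg hpt)
        rintro ⟨s, hsm, he⟩
        obtain ⟨-, e0, e1⟩ := piece_subset hp hpq hq (Sum.inl e)
        have h01 := hends s ⟨e0.trans hsm.1, hsm.2.trans e1⟩ he
        refine hpt ?_
        rw [← he]
        obtain ⟨j, b⟩ := e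
        cases b
        · simp [pieceLo, pieceHi, p, q] at hsm
          have : s = 0 := h01.resolve_right (by linarith [hsm.1, hsm.2])
          simp [Contour.pt, Contour.par, pieceArc, this]
        · simp [pieceLo, pieceHi, p, q] at hsm
          have : s = 1 := h01.resolve_left (by linarith [hsm.1, hsm.2])
          simp [Contour.pt, Contour.par, pieceArc, this]
    · refine hregular ?_ rfl
      rintro ⟨s, hsm, he⟩
      have hsm' : s ∈ Icc δ (1 - δ) := hsm
      rcases hends s ⟨by linarith [hsm'.1], by linarith [hsm'.2]⟩ he with h | h <;>
        linarith [hsm'.1, hsm'.2]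
  choose! Y hY using hpiece
  refine ⟨fun x => _, (1 / (2 * Real.pi * Complex.I) : ℂ) •
    (y₀ + ∑ y ∈ Finset.univ.erase (Sum.inl e₀), Y y), Tendsto.const_smul ?_ _, hev.mono fun x hx =>
    tendsto_cauchyInt_right hs hu hp hpq hq (Sum.inl e₀) hchord (hmem x hx) (hoff x hx)⟩
  refine (hy₀.add (tendsto_finsetSum _ hY)).congr fun x => ?_
  have hW₀ : endCoeff u e₀ = W (Sum.inl e₀) := by simp [W]
  -- All pieces diverge with the same factor log x, and the sum of their coefficients is zero by
  -- `hW`, so subtracting the singular parts changes nothing.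
  rw [Finset.sum_sub_distrib, ← Finset.smul_sum, hW₀, sub_add_sub_comm, ← smul_add,
    Finset.add_sum_erase _ _ (Finset.mem_univ _), hW, smul_zero, sub_zero]
  rfl

open Classical in
/-- The boundary values from the right of a Hölder continuous density that satisfies the zero-sum
condition are continuous up to the ends of every arc. -/
theorem exists_boundary_values (hΓ : Γ.IsPiecewiseSmooth) (hu : ∀ i, Continuous (u i)) {K : ℝ}
    (hK : ∀ i, ∀ s ∈ Icc (0 : ℝ) 1, ∀ t ∈ Icc (0 : ℝ) 1, ‖u i s - u i t‖ ≤ K * √|s - t|)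
    (hzero : ∀ a : ℂ, ∑ e : Γ.End with Γ.pt e = a, endCoeff u e = 0) :
    ∃ g : Γ.ι → ℝ → E, (∀ i, ContinuousOn (g i) (Icc 0 1)) ∧ ∀ i, ∀ t ∈ Ioo (0 : ℝ) 1,
      Tendsto (fun ε => cauchyInt Γ u (rightNormal Γ i t ε)) (𝓝[>] 0) (𝓝 (g i t)) := by
  set B : Γ.ι → ℝ → E := fun i t =>
    limUnder (𝓝[>] (0 : ℝ)) fun ε => cauchyInt Γ u (rightNormal Γ i t ε)
  have hint : ∀ i, ∀ t ∈ Ioo (0 : ℝ) 1, Tendsto (B i) (𝓝 t) (𝓝 (B i t)) ∧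
      Tendsto (fun ε => cauchyInt Γ u (rightNormal Γ i t ε)) (𝓝[>] 0) (𝓝 (B i t)) := by
    intro i t ht
    obtain ⟨B', y, h1, h2⟩ := exists_boundary_interior hΓ hu hK i ht
    have heq : B' =ᶠ[𝓝 t] B i := h2.mono fun s hs => hs.limUnder_eq.symm
    have h3 : Tendsto (B i) (𝓝 t) (𝓝 y) := h1.congr' heq
    refine ⟨by rwa [← eq_of_tendsto_nhds h3] at h3, ?_⟩
    rw [← heq.self_of_nhds]
    exact h2.self_of_nhds
  have hcl : Icc (0 : ℝ) 1 ⊆ closure (Ioo 0 1) := (closure_Ioo zero_ne_one).symm.subset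
  -- The normal limit is used only at interior parameters; the values at the ends are defined by
  -- continuous extension along the arc.
  refine ⟨fun i => extendFrom (Ioo 0 1) (B i), fun i => continuousOn_extendFrom hcl ?_, ?_⟩
  · intro t ht
    rcases ht.1.eq_or_lt with rfl | h0
    · obtain ⟨B', y, h1, h2⟩ := exists_boundary_end hΓ hu hK hzero (i, false)
      refine ⟨y, ?_⟩
      rw [nhdsWithin_Ioo_eq_nhdsGT one_pos]
      exact h1.congr' (h2.mono fun s hs => hs.limUnder_eq.symm)
    rcases ht.2.eq_or_lt with rfl | h1
    · obtain ⟨B', y, h1, h2⟩ := exists_boundary_end hΓ hu hK hzero (i, true)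
      refine ⟨y, ?_⟩
      rw [nhdsWithin_Ioo_eq_nhdsLT one_pos]
      have h3 : Tendsto (fun x => B i (1 - x)) (𝓝[>] 0) (𝓝 y) :=
        h1.congr' (h2.mono fun s hs => hs.limUnder_eq.symm)
      have h4 : Tendsto (fun x : ℝ => 1 - x) (𝓝[<] 1) (𝓝[>] 0) := by
        refine tendsto_nhdsWithin_iff.2 ⟨?_, ?_⟩
        · have : Continuous fun x : ℝ => 1 - x := by fun_prop
          simpa using (this.tendsto 1).mono_left (nhdsWithin_le_nhds (s := Iio 1))
        · filter_upwards [self_mem_nhdsWithin] with x hx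
          exact sub_pos.2 (mem_Iio.1 hx)
      exact (h3.comp h4).congr fun x => by simp
    · exact ⟨_, (hint i t ⟨h0, h1⟩).1.mono_left nhdsWithin_le_nhds⟩
  · intro i t ht
    have := extendFrom_eq (hcl (Ioo_subset_Icc_self ht))
      ((hint i t ht).1.mono_left (nhdsWithin_le_nhds (s := Ioo 0 1)))
    simp only [this]
    exact (hint i t ht).2

theorem cauchyInt_add (hs : ∀ i, ContDiff ℝ ∞ (Γ.γ i)) {v : Γ.ι → ℝ → E}
    (hu : ∀ i, Continuous (u i)) (hv : ∀ i, Continuous (v i)) {z : ℂ} (hz : z ∉ Γ.trace) :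
    cauchyInt Γ (u + v) z = cauchyInt Γ u z + cauchyInt Γ v z := by
  have hz' : ∀ i, z ∉ Γ.γ i '' Icc 0 1 := fun i h => hz (mem_iUnion.2 ⟨i, h⟩)
  rw [cauchyInt, cauchyInt, cauchyInt, ← smul_add, ← Finset.sum_add_distrib]
  congr 1
  refine Finset.sum_congr rfl fun i _ => ?_
  rw [← intervalIntegral.integral_add
    (intervalIntegrable_cauchyKernel (hs i) (hu i) zero_le_one (hz' i))
    (intervalIntegrable_cauchyKernel (hs i) (hv i) zero_le_one (hz' i))]
  simp only [Pi.add_apply, smul_add]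

theorem cauchyInt_smul (c : ℂ) (u : Γ.ι → ℝ → E) (z : ℂ) :
    cauchyInt Γ (c • u) z = c • cauchyInt Γ u z := by
  have h : ∀ i, ∫ t in (0 : ℝ)..1, (deriv (Γ.γ i) t / (Γ.γ i t - z)) • (c • u) i t =
      c • ∫ t in (0 : ℝ)..1, (deriv (Γ.γ i) t / (Γ.γ i t - z)) • u i t := by
    intro i
    rw [← intervalIntegral.integral_smul]
    simp only [Pi.smul_apply, smul_comm c]
  simp only [cauchyInt, h, ← Finset.smul_sum, smul_comm c]

end BoundaryValues

/-! ### The boundary value from the right as a linear operator from H¹_z(Γ) to C(Γ). -/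

section BoundaryOperator

variable {Γ : Contour}

theorem cauchy_add (hs : ∀ i, ContDiff ℝ ∞ (Γ.γ i)) (u v : PC Γ) {z : ℂ} (hz : z ∉ Γ.trace) :
    cauchy Γ (toFn (u + v)) z = cauchy Γ (toFn u) z + cauchy Γ (toFn v) z :=
  cauchyInt_add (E := M2) hs (continuous_toFn u) (continuous_toFn v) hz

theorem cauchy_smul (c : ℂ) (u : PC Γ) (z : ℂ) :
    cauchy Γ (toFn (c • u)) z = c • cauchy Γ (toFn u) z :=
  cauchyInt_smul (E := M2) c (toFn u) z

/-- `g` consists of the boundary values of `C_Γ u` from the right. -/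
def IsBoundaryValue (u g : PC Γ) : Prop := ∀ i, ∀ t ∈ Ioo (0 : ℝ) 1,
  Tendsto (fun ε => cauchy Γ (toFn u) (rightNormal Γ i t ε)) (𝓝[>] 0) (𝓝 (toFn g i t))

theorem exists_isBoundaryValue (hΓ : Γ.IsPiecewiseSmooth) {u : PC Γ} (hu : u ∈ H1z Γ) :
    ∃ g : PC Γ, IsBoundaryValue u g := by
  obtain ⟨K, hK⟩ := hΓ.toRegular.holder_of_mem_H1z hu
  obtain ⟨g, hg, hlim⟩ := exists_boundary_values (E := M2) hΓ (continuous_toFn u) hK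
    (zeroSum_iff.1 hu.2)
  refine ⟨ofContinuousOn g hg, fun i t ht => ?_⟩
  rw [toFn_ofContinuousOn g hg i (Ioo_subset_Icc_self ht)]
  exact hlim i t ht

theorem PC.ext_Ioo {f g : PC Γ} (h : ∀ i, ∀ t ∈ Ioo (0 : ℝ) 1, toFn f i t = toFn g i t) : f = g := by
  refine PC.ext_Icc fun i t ht => ?_
  have hcl : Icc (0 : ℝ) 1 ⊆ closure (Ioo 0 1) := (closure_Ioo zero_ne_one).symm.subset
  exact EqOn.closure (fun t ht => h i t ht) (continuous_toFn f i) (continuous_toFn g i) (hcl ht)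

/-- Interior parameters determine a member of C(Γ). This uniqueness makes the chosen values in
`rightBoundary` linear in the density. -/
theorem IsBoundaryValue.unique {u g g' : PC Γ} (h : IsBoundaryValue u g)
    (h' : IsBoundaryValue u g') : g = g' :=
  PC.ext_Ioo fun i t ht => tendsto_nhds_unique (h i t ht) (h' i t ht)

theorem IsBoundaryValue.add (hΓ : Γ.IsPiecewiseSmooth) {u v f g : PC Γ}
    (h : IsBoundaryValue u f) (h' : IsBoundaryValue v g) : IsBoundaryValue (u + v) (f + g) := by
  intro i t ht
  refine Tendsto.congr' ?_ ((h i t ht).add (h' i t ht))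
  -- Additivity of the integral needs integrable kernels, hence points off the contour.
  filter_upwards [eventually_rightNormal_notMem_trace hΓ i ht] with ε hε
  exact (cauchy_add hΓ.smooth u v hε).symm

theorem IsBoundaryValue.smul {u f : PC Γ} (c : ℂ) (h : IsBoundaryValue u f) :
    IsBoundaryValue (c • u) (c • f) := by
  intro i t ht
  exact ((h i t ht).const_smul c).congr fun ε => (cauchy_smul c u _).symm

/-- The boundary values from the right, as an operator from `H¹_z(Γ)` to `C(Γ)`. -/
def rightBoundary (hΓ : Γ.IsPiecewiseSmooth) : H1zSub hΓ.toRegular →ₗ[ℂ] PC Γ where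
  toFun u := (exists_isBoundaryValue hΓ u.2).choose
  map_add' u v := (exists_isBoundaryValue hΓ (u + v).2).choose_spec.unique
    ((exists_isBoundaryValue hΓ u.2).choose_spec.add hΓ (exists_isBoundaryValue hΓ v.2).choose_spec)
  map_smul' c u := (exists_isBoundaryValue hΓ (c • u).2).choose_spec.unique
    ((exists_isBoundaryValue hΓ u.2).choose_spec.smul c)

theorem cauchyMinus_eq_rightBoundary (hΓ : Γ.IsPiecewiseSmooth) (u : H1zSub hΓ.toRegular) (i : Γ.ι)
    {t : ℝ} (ht : t ∈ Ioo (0 : ℝ) 1) :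
    cauchyMinus Γ (toFn (u : PC Γ)) i t = toFn (rightBoundary hΓ u) i t :=
  ((exists_isBoundaryValue hΓ u.2).choose_spec i t ht).limUnder_eq

end BoundaryOperator

/-! ### Perturbation of the discrete problem -/

section Perturbation

variable {V X ι : Type*} [NormedAddCommGroup V] [NormedSpace ℂ V] [NormedAddCommGroup X]
  [NormedSpace ℂ X] [FiniteDimensional ℂ X] {l : Filter ι} {A : ι → X →ₗ[ℂ] V} {A₀ : X →ₗ[ℂ] V}

/-- An injective `A₀` on a finite-dimensional space satisfies ‖u‖ ≤ K‖A₀ u‖. Convergence on a basis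
makes the operator norm of A i - A₀ small; once it is below 1/(2K), half of the lower bound 1/K
remains. -/
theorem eventually_lower_bound (hinj : Function.Injective A₀)
    (hA : ∀ u, Tendsto (fun i => A i u) l (𝓝 (A₀ u))) :
    ∃ c > 0, ∀ᶠ i in l, ∀ u, c * ‖u‖ ≤ ‖A i u‖ := by
  obtain ⟨K, hK, hanti⟩ := A₀.exists_antilipschitzWith (LinearMap.ker_eq_bot.2 hinj)
  have hK' : (0 : ℝ) < K := hK
  let b := Module.finBasis ℂ X
  let coord : Fin (Module.finrank ℂ X) → (X →L[ℂ] ℂ) := fun k => (b.coord k).toContinuousLinearMap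
  have hsum : Tendsto (fun i => ∑ k, ‖coord k‖ * ‖A i (b k) - A₀ (b k)‖) l (𝓝 0) := by
    rw [← Finset.sum_const_zero (ι := Fin (Module.finrank ℂ X)) (s := Finset.univ)]
    refine tendsto_finsetSum _ fun k _ => ?_
    have := ((hA (b k)).sub_const (A₀ (b k))).norm.const_mul ‖coord k‖
    simpa using this
  refine ⟨1 / (2 * K), by positivity, ?_⟩
  filter_upwards [hsum.eventually_lt_const (show (0 : ℝ) < 1 / (2 * K) by positivity)] with i hi u
  have h1 : ‖A i u - A₀ u‖ ≤ (∑ k, ‖coord k‖ * ‖A i (b k) - A₀ (b k)‖) * ‖u‖ := by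
    have hu : A i u - A₀ u = ∑ k, b.repr u k • (A i (b k) - A₀ (b k)) := by
      conv_lhs => rw [← b.sum_repr u]
      simp only [map_sum, map_smul, smul_sub, Finset.sum_sub_distrib]
    rw [hu, Finset.sum_mul]
    refine (norm_sum_le _ _).trans (Finset.sum_le_sum fun k _ => ?_)
    rw [norm_smul, mul_right_comm]
    gcongr
    exact (coord k).le_opNorm u
  have h2 : ‖u‖ ≤ K * ‖A₀ u‖ := by
    simpa using hanti.le_mul_norm (by simp) u
  have h3 : ‖A₀ u‖ ≤ ‖A i u‖ + ‖A i u - A₀ u‖ := by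
    have := norm_sub_norm_le (A₀ u) (A i u)
    rw [norm_sub_rev] at this
    linarith
  have h4 : ‖A i u - A₀ u‖ ≤ 1 / (2 * K) * ‖u‖ := h1.trans (by gcongr)
  have h5 : 1 / K * ‖u‖ ≤ ‖A₀ u‖ := by
    rw [one_div, inv_mul_le_iff₀ hK']
    exact h2
  have h6 : 1 / (K : ℝ) = 1 / (2 * K) + 1 / (2 * K) := by field_simp; ring
  rw [h6, add_mul] at h5
  linarith

/-- Stability of solutions: the uniform lower bound is applied to x i - x₀, whose image tends to 0.
-/
theorem tendsto_of_tendsto_map (hinj : Function.Injective A₀)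
    (hA : ∀ u, Tendsto (fun i => A i u) l (𝓝 (A₀ u))) {x : ι → X} {x₀ : X}
    (hx : Tendsto (fun i => A i (x i)) l (𝓝 (A₀ x₀))) : Tendsto x l (𝓝 x₀) := by
  obtain ⟨c, hc, hlow⟩ := eventually_lower_bound hinj hA
  rw [tendsto_iff_norm_sub_tendsto_zero]
  have h1 : Tendsto (fun i => c⁻¹ * ‖A i (x i) - A i x₀‖) l (𝓝 0) := by
    have := ((hx.sub (hA x₀)).norm).const_mul c⁻¹
    simpa using this
  refine squeeze_zero' (Eventually.of_forall fun i => norm_nonneg _) ?_ h1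
  filter_upwards [hlow] with i hi
  have := hi (x i - x₀)
  rw [map_sub] at this
  rw [inv_mul_eq_div, le_div_iff₀ hc, mul_comm]
  exact this

/-- The map factors through the quotient by its kernel, which is Hausdorff because the kernel is
closed and finite-dimensional because the range is. -/
theorem continuous_of_isClosed_ker_of_finiteDimensional_range {W : Type*} [NormedAddCommGroup W]
    [NormedSpace ℂ W] (f : V →ₗ[ℂ] W) [FiniteDimensional ℂ (LinearMap.range f)]
    (hf : IsClosed (LinearMap.ker f : Set V)) : Continuous f := by
  have : IsClosed (LinearMap.ker f : Set V) := hf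
  have : FiniteDimensional ℂ (V ⧸ LinearMap.ker f) :=
    LinearEquiv.finiteDimensional f.quotKerEquivRange.symm
  have h1 : Continuous ((LinearMap.ker f).liftQ f le_rfl) :=
    LinearMap.continuous_of_finiteDimensional _
  exact h1.comp continuous_quot_mk

end Perturbation

/-! ### The maximum norm on C(Γ) and its comparison with L² and L^∞. -/

section SupNorm

variable {Γ : Contour}

/-- The entries of a function in `C(Γ)`. -/
def pcEntries (Γ : Contour) : PC Γ →ₗ[ℂ] (Γ.ι → C(unitInterval, Fin 2 → Fin 2 → ℂ)) where
  toFun f i := ⟨fun t => f i t, (f i).continuous⟩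
  map_add' _ _ := rfl
  map_smul' _ _ := rfl

theorem pcEntries_injective : Function.Injective (pcEntries Γ) := by
  intro f g h
  funext i
  ext1 t
  exact congrArg (fun F : Γ.ι → C(unitInterval, Fin 2 → Fin 2 → ℂ) => F i t) h

/-- The maximum norm on `C(Γ)`. -/
instance instNormedAddCommGroupPC : NormedAddCommGroup (PC Γ) :=
  NormedAddCommGroup.induced (PC Γ) (Γ.ι → C(unitInterval, Fin 2 → Fin 2 → ℂ)) (pcEntries Γ)
    pcEntries_injective

instance instNormedSpacePC : NormedSpace ℂ (PC Γ) :=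
  NormedSpace.induced ℂ (PC Γ) (Γ.ι → C(unitInterval, Fin 2 → Fin 2 → ℂ)) (pcEntries Γ)

/-- The topology of the maximum norm. -/
instance (priority := 10000) instTopologicalSpacePC : TopologicalSpace (PC Γ) :=
  PseudoMetricSpace.toUniformSpace.toTopologicalSpace

theorem PC.norm_le_iff {f : PC Γ} {C : ℝ} (hC : 0 ≤ C) :
    ‖f‖ ≤ C ↔ ∀ i, ∀ t ∈ Icc (0 : ℝ) 1, ‖toFn f i t‖ ≤ C := by
  have h1 : ‖f‖ = ‖pcEntries Γ f‖ := rfl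
  rw [h1, pi_norm_le_iff_of_nonneg hC]
  refine forall_congr' fun i => ?_
  rw [ContinuousMap.norm_le _ hC]
  constructor
  · intro h t ht
    rw [toFn_apply f i ht]
    exact h ⟨t, ht⟩
  · intro h t
    have := h t t.2
    rw [toFn_apply f i t.2] at this
    exact this

theorem PC.norm_toFn_le (f : PC Γ) (i : Γ.ι) {t : ℝ} (ht : t ∈ Icc (0 : ℝ) 1) :
    ‖toFn f i t‖ ≤ ‖f‖ := (PC.norm_le_iff (norm_nonneg f)).1 le_rfl i t ht

/-- The entrywise maximum norm is not submultiplicative; an entry of the product has two summands.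
-/
theorem norm_matrix_mul_le (A B : M2) : ‖A * B‖ ≤ 2 * ‖A‖ * ‖B‖ := by
  rw [Matrix.norm_le_iff (by positivity)]
  intro i j
  rw [Matrix.mul_apply, Fin.sum_univ_two]
  have h : ∀ k, ‖A i k * B k j‖ ≤ ‖A‖ * ‖B‖ := fun k => by
    rw [norm_mul]
    gcongr
    · exact A.norm_entry_le_entrywise_sup_norm
    · exact B.norm_entry_le_entrywise_sup_norm
  refine (norm_add_le _ _).trans ?_
  linarith [h 0, h 1]

theorem toFn_mul (f g : PC Γ) (i : Γ.ι) (t : ℝ) : toFn (f * g) i t = toFn f i t * toFn g i t := rfl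

theorem PC.norm_mul_le (f g : PC Γ) : ‖f * g‖ ≤ 2 * ‖f‖ * ‖g‖ := by
  rw [PC.norm_le_iff (by positivity)]
  intro i t ht
  rw [toFn_mul]
  refine (norm_matrix_mul_le _ _).trans ?_
  gcongr
  · exact f.norm_toFn_le i ht
  · exact g.norm_toFn_le i ht

theorem Contour.Regular.LinfNorm_toFn_le (hΓ : Γ.Regular) (f : PC Γ) :
    LinfNorm Γ (toFn f) ≤ ‖f‖ₑ := by
  refine hΓ.LinfNorm_le fun i t ht => ?_
  rw [← ofReal_norm, ← ofReal_norm]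
  exact ENNReal.ofReal_le_ofReal (f.norm_toFn_le i ht)

theorem Contour.Regular.exists_L2norm_le (hΓ : Γ.Regular) :
    ∃ C : ℝ≥0∞, C ≠ ⊤ ∧ ∀ f : PC Γ, L2norm Γ (toFn f) ≤ C * ‖f‖ₑ := by
  have hfin : ∀ i, Γ.arclength i univ ≠ ⊤ := by
    intro i
    obtain ⟨C, hC, h1, -⟩ := hΓ.exists_arclength_bounds i
    refine ne_top_of_le_ne_top ?_ (h1 univ)
    rw [Measure.smul_apply, smul_eq_mul]
    exact ENNReal.mul_ne_top hC (by simp)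
  have hbd : ∀ i (f : PC Γ), eLpNorm (toFn f i) 2 (Γ.arclength i) ≤
      Γ.arclength i univ ^ (1 / 2 : ℝ) * ‖f‖ₑ := by
    intro i f
    refine (eLpNorm_le_of_ae_bound (C := ‖f‖) ?_).trans ?_
    · rw [hΓ.ae_iff i]
      filter_upwards [ae_restrict_mem measurableSet_Icc] with t ht using f.norm_toFn_le i ht
    · rw [ofReal_norm]
      norm_num
  refine ⟨(∑ i, (Γ.arclength i univ ^ (1 / 2 : ℝ)) ^ 2) ^ (1 / 2 : ℝ), ?_, fun f => ?_⟩
  · refine ENNReal.rpow_ne_top_of_nonneg (by norm_num) (ENNReal.sum_ne_top.2 fun i _ => ?_)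
    exact ENNReal.pow_ne_top (ENNReal.rpow_ne_top_of_nonneg (by norm_num) (hfin i))
  · have h1 : (∑ i, eLpNorm (toFn f i) 2 (Γ.arclength i) ^ 2) ≤
        (∑ i, (Γ.arclength i univ ^ (1 / 2 : ℝ)) ^ 2) * ‖f‖ₑ ^ 2 := by
      rw [Finset.sum_mul]
      refine Finset.sum_le_sum fun i _ => ?_
      rw [← mul_pow]
      gcongr
      exact hbd i f
    refine (ENNReal.rpow_le_rpow h1 (by norm_num)).trans (le_of_eq ?_)
    rw [ENNReal.mul_rpow_of_nonneg _ _ (by norm_num), ← ENNReal.rpow_natCast, ← ENNReal.rpow_mul]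
    norm_num

theorem ae_eq_zero_of_eLpNorm_eq_zero {E : Type*} [NormedAddCommGroup E] {f : ℝ → E}
    (hf : Continuous f) {μ : Measure ℝ} (h : eLpNorm f 2 μ = 0) : f =ᵐ[μ] 0 :=
  (eLpNorm_eq_zero_iff hf.aestronglyMeasurable two_ne_zero).1 h

theorem Contour.Regular.eq_zero_of_L2norm_eq_zero (hΓ : Γ.Regular) {f : PC Γ}
    (h : L2norm Γ (toFn f) = 0) : f = 0 := by
  rw [L2norm, ENNReal.rpow_eq_zero_iff_of_pos (by norm_num), Finset.sum_eq_zero_iff] at h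
  have h0 : AEEq (toFn f) (toFn 0) := by
    intro i
    have h1 := h i (Finset.mem_univ i)
    rw [pow_eq_zero_iff two_ne_zero] at h1
    exact (hΓ.ae_iff i).1 (ae_eq_zero_of_eLpNorm_eq_zero (E := M2) (continuous_toFn f i) h1)
  exact PC.ext_Icc fun i t ht => h0.eqOn (fun i => (continuous_toFn _ i).continuousOn)
    (fun i => (continuous_toFn _ i).continuousOn) i ht

end SupNorm

/-! ### The discrete operator on C(Γ) and its stability. -/

section Discrete

variable {Γ : Contour}

theorem aeeq_of_eqOn_Ioo {f g : Fn Γ} (h : ∀ i, ∀ t ∈ Ioo (0 : ℝ) 1, f i t = g i t) : AEEq f g := by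
  intro i
  filter_upwards [ae_restrict_mem measurableSet_Icc, ae_restrict_of_ae (Measure.ae_ne volume 0),
    ae_restrict_of_ae (Measure.ae_ne volume 1)] with t ht h0 h1
  exact h i t ⟨lt_of_le_of_ne ht.1 (Ne.symm h0), lt_of_le_of_ne ht.2 h1⟩

theorem toFn_contRep {f : Fn Γ} (hf : ∀ i, ContinuousOn (f i) (Icc 0 1)) (i : Γ.ι) {t : ℝ}
    (ht : t ∈ Icc (0 : ℝ) 1) : toFn (contRep f) i t = f i t := by
  rw [contRep_eq (g := ofContinuousOn f hf) (aeeq_of_eqOn fun i t ht =>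
    toFn_ofContinuousOn f hf i ht), toFn_ofContinuousOn f hf i ht]

theorem contRep_sub_one {f : Fn Γ} (hf : ∀ i, ContinuousOn (f i) (Icc 0 1)) :
    contRep (f - one Γ) = contRep f - 1 := by
  refine contRep_eq (aeeq_of_eqOn fun i t ht => ?_)
  rw [toFn_sub]
  exact congrArg (· - (1 : M2)) (toFn_contRep hf i ht)

namespace NumericalMethod

variable (m : NumericalMethod Γ)

/-- The hypothesis controls `I_n f` only in L², but this is enough to show that a uniform limit of
kernel elements lies in the kernel; finite rank does the rest. -/
theorem continuous_I (hΓ : Γ.Regular) {n : ℕ} {K : ℝ≥0}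
    (hK : ∀ f, L2norm Γ (toFn (m.I n f)) ≤ K * LinfNorm Γ (toFn f)) : Continuous (m.I n) := by
  have := m.I_finite n
  refine continuous_of_isClosed_ker_of_finiteDimensional_range (m.I n) ?_
  refine isClosed_of_closure_subset fun f hf => ?_
  obtain ⟨x, hx, hlim⟩ := mem_closure_iff_seq_limit.1 hf
  refine LinearMap.mem_ker.2 (hΓ.eq_zero_of_L2norm_eq_zero (le_antisymm ?_ zero_le))
  have h1 : ∀ k, L2norm Γ (toFn (m.I n f)) ≤ K * ‖x k - f‖ₑ := by
    intro k
    have e : m.I n f = m.I n (f - x k) := by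
      rw [map_sub, LinearMap.mem_ker.1 (hx k), sub_zero]
    rw [e, ← enorm_neg, neg_sub]
    exact (hK _).trans (by gcongr; exact hΓ.LinfNorm_toFn_le _)
  have h2 : Tendsto (fun k => (K : ℝ≥0∞) * ‖x k - f‖ₑ) atTop (𝓝 0) := by
    have h3 : Tendsto (fun k => ‖x k - f‖ₑ) atTop (𝓝 0) := by
      have := (hlim.sub_const f).enorm
      simpa using this
    simpa using ENNReal.Tendsto.const_mul h3 (Or.inr ENNReal.coe_ne_top)
  exact ge_of_tendsto' h2 h1

/-- `X_n` as a subspace. -/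
def XSub (hΓ : Γ.Regular) (n : ℕ) : Submodule ℂ (PC Γ) := (H1zSub hΓ).map (m.P n)

theorem coe_XSub (hΓ : Γ.Regular) (n : ℕ) : (m.XSub hΓ n : Set (PC Γ)) = m.X n := rfl

theorem XSub_le (hΓ : Γ.Regular) (n : ℕ) : m.XSub hΓ n ≤ H1zSub hΓ := by
  rintro _ ⟨f, hf, rfl⟩
  exact m.P_mem n f hf

theorem span_X (hΓ : Γ.Regular) (n : ℕ) : Submodule.span ℂ (m.X n) = m.XSub hΓ n := by
  rw [← m.coe_XSub hΓ n, Submodule.span_eq]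

theorem finiteDimensional_XSub (hΓ : Γ.Regular) (n : ℕ) : FiniteDimensional ℂ (m.XSub hΓ n) := by
  rw [← m.span_X hΓ n]
  exact m.P_finite n

/-- The operator `C_n[G;Γ]` for continuous `G`. -/
def CnLin (hΓ : Γ.IsPiecewiseSmooth) (n : ℕ) (g : PC Γ) : H1zSub hΓ.toRegular →ₗ[ℂ] PC Γ :=
  m.I n ∘ₗ ((H1zSub hΓ.toRegular).subtype - LinearMap.mulRight ℂ (g - 1) ∘ₗ rightBoundary hΓ)

theorem CnLin_apply (hΓ : Γ.IsPiecewiseSmooth) (n : ℕ) (g : PC Γ) (u : H1zSub hΓ.toRegular) :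
    m.CnLin hΓ n g u = m.I n (u - rightBoundary hΓ u * (g - 1)) := rfl

/-- The pointwise `cauchyMinus` is not controlled at the ends of the arcs, but `contRep` sees a
function only almost everywhere. -/
theorem Cn_eq (hΓ : Γ.IsPiecewiseSmooth) (n : ℕ) {G : Fn Γ}
    (hG : ∀ i, ContinuousOn (G i) (Icc 0 1)) (u : H1zSub hΓ.toRegular) :
    m.Cn n G u = m.CnLin hΓ n (contRep G) u := by
  rw [CnLin_apply, Cn]
  congr 1
  refine contRep_eq (aeeq_of_eqOn_Ioo fun i t ht => ?_)
  have h1 := toFn_contRep hG i (Ioo_subset_Icc_self ht)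
  have h2 := cauchyMinus_eq_rightBoundary hΓ u i ht
  change toFn (u : PC Γ) i t - toFn (rightBoundary hΓ u) i t * (toFn (contRep G) i t - 1) =
    toFn (u : PC Γ) i t - cauchyMinus Γ (toFn (u : PC Γ)) i t * (G i t - 1)
  rw [h1, h2]

theorem rhs_mem_Y (hΓ : Γ.IsPiecewiseSmooth) (n : ℕ) {G : Fn Γ}
    (hG : ∀ i, ContinuousOn (G i) (Icc 0 1)) : m.rhs n G ∈ m.Y n G := by
  refine ⟨0, (H1zSub hΓ.toRegular).zero_mem, 1, ?_⟩
  have : m.Cn n G (0 : H1zSub hΓ.toRegular) = 0 := by rw [m.Cn_eq hΓ n hG, map_zero]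
  rw [one_smul]
  exact (zero_add (m.rhs n G)).symm.trans (congrArg (· + m.rhs n G) this.symm)

theorem approx_spec (hΓ : Γ.IsPiecewiseSmooth) {n : ℕ} {G : Fn Γ}
    (hG : ∀ i, ContinuousOn (G i) (Icc 0 1)) (h : m.Invertible n G) :
    m.approx n G ∈ m.X n ∧ m.Cn n G (m.approx n G) = m.rhs n G := by
  have hmem : m.rhs n G ∈ m.Cn n G '' m.X n := h.surjOn (m.rhs_mem_Y hΓ n hG)
  exact ⟨Function.invFunOn_mem hmem, Function.invFunOn_eq hmem⟩

/-- The image of `X_n` lies in the span of `Y_n` and has dimension dim X_n by injectivity, hence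
equals this span by the dimension hypothesis. In particular no continuity of `Y_n[G]` in G is ever
needed. -/
theorem invertible_of_injOn (hΓ : Γ.IsPiecewiseSmooth) {n : ℕ} {G : Fn Γ}
    (hG : ∀ i, ContinuousOn (G i) (Icc 0 1))
    (hdim : Module.finrank ℂ (Submodule.span ℂ (m.Y n G)) ≤
      Module.finrank ℂ (Submodule.span ℂ (m.X n)))
    (hinj : Function.Injective
      (m.CnLin hΓ n (contRep G) ∘ₗ Submodule.inclusion (m.XSub_le hΓ.toRegular n))) :
    m.Invertible n G := by
  set A := m.CnLin hΓ n (contRep G) ∘ₗ Submodule.inclusion (m.XSub_le hΓ.toRegular n) with hA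
  have hAC : ∀ u : m.XSub hΓ.toRegular n, A u = m.Cn n G u := fun u =>
    (m.Cn_eq hΓ n hG (Submodule.inclusion (m.XSub_le hΓ.toRegular n) u)).symm
  have hmaps : MapsTo (m.Cn n G) (m.X n) (m.Y n G) := fun u hu =>
    ⟨u, m.XSub_le hΓ.toRegular n hu, 0, by rw [zero_smul, add_zero]⟩
  have hle : LinearMap.range A ≤ Submodule.span ℂ (m.Y n G) := by
    rintro _ ⟨u, rfl⟩
    rw [hAC]
    exact Submodule.subset_span (hmaps u.2)
  have hfin : FiniteDimensional ℂ (Submodule.span ℂ (m.Y n G)) := by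
    have := m.I_finite n
    refine Submodule.finiteDimensional_of_le (S₂ := LinearMap.range (m.I n))
      (Submodule.span_le.2 ?_)
    rintro _ ⟨v, -, c, rfl⟩
    exact (LinearMap.range (m.I n)).add_mem ⟨_, rfl⟩
      ((LinearMap.range (m.I n)).smul_mem c ⟨_, rfl⟩)
  have heq : LinearMap.range A = Submodule.span ℂ (m.Y n G) := by
    refine Submodule.eq_of_le_of_finrank_le hle ?_
    rw [LinearMap.finrank_range_of_inj hinj, ← m.span_X hΓ.toRegular n]
    exact hdim
  refine ⟨hmaps, ?_, ?_⟩
  · intro u hu v hv huv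
    have : A ⟨u, hu⟩ = A ⟨v, hv⟩ := by rw [hAC, hAC]; exact huv
    exact congrArg Subtype.val (hinj this)
  · intro y hy
    have : y ∈ LinearMap.range A := heq ▸ Submodule.subset_span hy
    obtain ⟨u, rfl⟩ := this
    exact ⟨u, u.2, (hAC u).symm⟩

/-- Invertibility of the discrete operator is stable under small perturbations of the jump matrix,
and the discrete solution depends continuously on it. -/
theorem discrete_perturbation (hΓ : Γ.IsPiecewiseSmooth) {n : ℕ} {K : ℝ≥0}
    (hK : ∀ f, L2norm Γ (toFn (m.I n f)) ≤ K * LinfNorm Γ (toFn f))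
    {ι : Type*} {l : Filter ι} {G : ι → Fn Γ} {G₀ : Fn Γ}
    (hdim : ∀ᶠ i in l, Module.finrank ℂ (Submodule.span ℂ (m.Y n (G i))) ≤
      Module.finrank ℂ (Submodule.span ℂ (m.X n)))
    (hG : ∀ᶠ i in l, ∀ j, ContinuousOn (G i j) (Icc 0 1)) (hG₀ : ∀ j, ContinuousOn (G₀ j) (Icc 0 1))
    (hlim : Tendsto (fun i => contRep (G i)) l (𝓝 (contRep G₀))) (hinv : m.Invertible n G₀) :
    (∀ᶠ i in l, m.Invertible n (G i)) ∧
      Tendsto (fun i => m.approx n (G i)) l (𝓝 (m.approx n G₀)) := by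
  have hI := m.continuous_I hΓ.toRegular hK
  have hfin := m.finiteDimensional_XSub hΓ.toRegular n
  -- All operators act between the fixed spaces `X_n` and C(Γ), so that they can be compared
  -- although their natural targets `Y_n` vary.
  set A : PC Γ → m.XSub hΓ.toRegular n →ₗ[ℂ] PC Γ := fun g =>
    m.CnLin hΓ n g ∘ₗ Submodule.inclusion (m.XSub_le hΓ.toRegular n) with hA
  have hAC : ∀ G : Fn Γ, (∀ j, ContinuousOn (G j) (Icc 0 1)) → ∀ u : m.XSub hΓ.toRegular n,
      A (contRep G) u = m.Cn n G u := fun G hG u =>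
    (m.Cn_eq hΓ n hG (Submodule.inclusion (m.XSub_le hΓ.toRegular n) u)).symm
  have hmul : ∀ f : PC Γ, Tendsto (fun i => f * (contRep (G i) - 1)) l
      (𝓝 (f * (contRep G₀ - 1))) := by
    intro f
    rw [tendsto_iff_norm_sub_tendsto_zero]
    have h1 : Tendsto (fun i => 2 * ‖f‖ * ‖contRep (G i) - contRep G₀‖) l (𝓝 0) := by
      have := (tendsto_iff_norm_sub_tendsto_zero.1 hlim).const_mul (2 * ‖f‖)
      simpa using this
    refine squeeze_zero (fun i => norm_nonneg _) (fun i => ?_) h1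
    rw [← mul_sub, sub_sub_sub_cancel_right]
    exact PC.norm_mul_le _ _
  have hpt : ∀ u, Tendsto (fun i => A (contRep (G i)) u) l (𝓝 (A (contRep G₀) u)) := fun u =>
    (hI.tendsto _).comp ((hmul _).const_sub _)
  have hinj : Function.Injective (A (contRep G₀)) := by
    intro u v huv
    rw [hAC G₀ hG₀, hAC G₀ hG₀] at huv
    exact Subtype.ext (hinv.injOn u.2 v.2 huv)
  have hev : ∀ᶠ i in l, m.Invertible n (G i) := by
    obtain ⟨c, hc, hlow⟩ := eventually_lower_bound hinj hpt
    filter_upwards [hlow, hdim, hG] with i hi hd hc'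
    refine m.invertible_of_injOn hΓ hc' hd ((injective_iff_map_eq_zero _).2 fun u hu => ?_)
    have := hi u
    rw [show A (contRep (G i)) u = 0 from hu, norm_zero] at this
    exact norm_le_zero_iff.1 (nonpos_of_mul_nonpos_right this hc)
  refine ⟨hev, ?_⟩
  have hspec₀ := m.approx_spec hΓ hG₀ hinv
  set x₀ : m.XSub hΓ.toRegular n := ⟨m.approx n G₀, hspec₀.1⟩
  classical
  set x : ι → m.XSub hΓ.toRegular n := fun i =>
    if h : m.approx n (G i) ∈ m.X n then ⟨m.approx n (G i), h⟩ else 0 with hx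
  have hxe : ∀ᶠ i in l, (x i : PC Γ) = m.approx n (G i) ∧
      A (contRep (G i)) (x i) = m.I n (contRep (G i) - 1) := by
    filter_upwards [hev, hG] with i hi hc
    have hs := m.approx_spec hΓ hc hi
    have e : (x i : PC Γ) = m.approx n (G i) := by simp only [hx, dif_pos hs.1]
    refine ⟨e, ?_⟩
    rw [hAC _ hc, e, hs.2, rhs, contRep_sub_one hc]
  have hx₀ : A (contRep G₀) x₀ = m.I n (contRep G₀ - 1) := by
    rw [hAC _ hG₀, ← contRep_sub_one hG₀]
    exact hspec₀.2
  have hlimx : Tendsto (fun i => A (contRep (G i)) (x i)) l (𝓝 (A (contRep G₀) x₀)) := by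
    rw [hx₀]
    exact ((hI.tendsto _).comp (hlim.sub_const 1)).congr' (hxe.mono fun i hi => hi.2.symm)
  have := tendsto_of_tendsto_map hinj hpt hlimx
  exact ((continuous_subtype_val.tendsto x₀).comp this).congr' (hxe.mono fun i hi => hi.1)

end NumericalMethod

end Discrete

/-! ### Lipschitz functions on the unit interval -/

section Lipschitz

variable {E : Type*} [NormedAddCommGroup E] [NormedSpace ℝ E]

/-- `f` is Lipschitz continuous on the unit interval. -/
def LipUnit (f : ℝ → E) : Prop :=
  ∃ K : ℝ≥0, ∀ s ∈ Icc (0 : ℝ) 1, ∀ t ∈ Icc (0 : ℝ) 1, ‖f s - f t‖ ≤ K * |s - t|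

theorem LipUnit.lipschitzOnWith {f : ℝ → E} (hf : LipUnit f) :
    ∃ K : ℝ≥0, LipschitzOnWith K f (Icc 0 1) := by
  obtain ⟨K, hK⟩ := hf
  refine ⟨K, LipschitzOnWith.of_dist_le_mul fun s hs t ht => ?_⟩
  rw [dist_eq_norm, Real.dist_eq]
  exact hK s hs t ht

theorem LipUnit.continuousOn {f : ℝ → E} (hf : LipUnit f) : ContinuousOn f (Icc 0 1) := by
  obtain ⟨K, hK⟩ := hf.lipschitzOnWith
  exact hK.continuousOn

theorem LipUnit.exists_bound {f : ℝ → E} (hf : LipUnit f) :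
    ∃ M : ℝ≥0, ∀ t ∈ Icc (0 : ℝ) 1, ‖f t‖ ≤ M := by
  obtain ⟨M, hM⟩ := (isCompact_Icc (a := (0 : ℝ)) (b := 1)).exists_bound_of_continuousOn
    hf.continuousOn
  exact ⟨M.toNNReal, fun t ht => (hM t ht).trans (Real.le_coe_toNNReal M)⟩

theorem LipUnit.const (c : E) : LipUnit fun _ => c := ⟨0, fun s _ t _ => by simp⟩

theorem LipUnit.add {f g : ℝ → E} (hf : LipUnit f) (hg : LipUnit g) : LipUnit (f + g) := by
  obtain ⟨K, hK⟩ := hf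
  obtain ⟨L, hL⟩ := hg
  refine ⟨K + L, fun s hs t ht => ?_⟩
  rw [Pi.add_apply, Pi.add_apply, add_sub_add_comm, NNReal.coe_add, add_mul]
  exact (norm_add_le _ _).trans (add_le_add (hK s hs t ht) (hL s hs t ht))

theorem LipUnit.congr {f g : ℝ → E} (hf : LipUnit f) (h : ∀ t ∈ Icc (0 : ℝ) 1, g t = f t) :
    LipUnit g := by
  obtain ⟨K, hK⟩ := hf
  exact ⟨K, fun s hs t ht => by rw [h s hs, h t ht]; exact hK s hs t ht⟩

theorem HasPrimitive.lipUnit {f : ℝ → E} (hf : HasPrimitive ⊤ f) : LipUnit f := by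
  obtain ⟨h, hh, hprim⟩ := hf
  have hb : ∀ᵐ t ∂unitVol, ‖h t‖ ≤ (eLpNorm h ⊤ unitVol).toReal := by
    filter_upwards [ae_le_eLpNormEssSup (f := h) (μ := unitVol)] with t ht
    rw [← toReal_enorm]
    refine ENNReal.toReal_mono hh.2.ne ?_
    rw [eLpNorm_exponent_top]
    exact ht
  refine ⟨(eLpNorm h ⊤ unitVol).toNNReal, fun s hs t ht => ?_⟩
  rw [hprim.sub_eq le_top hh ht hs, abs_sub_comm, abs_sub_comm]
  refine intervalIntegral.norm_integral_le_of_norm_le_const_ae ?_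
  have hb' := (ae_restrict_iff' measurableSet_Icc).1 hb
  filter_upwards [hb'] with x hx hxm
  exact hx ((uIoc_subset_uIcc.trans ((convex_Icc (0 : ℝ) 1).ordConnected.uIcc_subset ht hs)) hxm)

/-- A Lipschitz extension g to the line is differentiable almost everywhere with bounded derivative.
The difference of g and the integral of its derivative is absolutely continuous with derivative 0
almost everywhere, hence constant. -/
theorem LipUnit.hasPrimitive [FiniteDimensional ℝ E] {f : ℝ → E} (hf : LipUnit f) :
    HasPrimitive ⊤ f := by
  have : CompleteSpace E := FiniteDimensional.complete ℝ E
  obtain ⟨K, hK⟩ := hf.lipschitzOnWith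
  obtain ⟨g, hg, hfg⟩ := hK.extend_finite_dimension
  set C := lipschitzExtensionConstant E * K
  have hsm : StronglyMeasurable (deriv g) := stronglyMeasurable_deriv g
  have hbd : ∀ t, ‖deriv g t‖ ≤ C := fun t => norm_deriv_le_of_lipschitz hg
  have hmem : MemLp (deriv g) ⊤ unitVol :=
    memLp_top_of_bound hsm.aestronglyMeasurable C (Eventually.of_forall hbd)
  have hint : ∀ s t : ℝ, IntervalIntegrable (deriv g) volume s t := fun s t =>
    (intervalIntegrable_const (c := (C : ℝ))).mono_fun' hsm.aestronglyMeasurable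
      (Eventually.of_forall hbd)
  have hF : LipschitzWith C fun t => ∫ s in (0 : ℝ)..t, deriv g s := by
    refine LipschitzWith.of_dist_le_mul fun s t => ?_
    rw [dist_eq_norm, Real.dist_eq, intervalIntegral.integral_interval_sub_left (hint _ _)
      (hint _ _)]
    exact intervalIntegral.norm_integral_le_of_norm_le_const fun x _ => hbd x
  have hac : AbsolutelyContinuousOnInterval (g - fun t => ∫ s in (0 : ℝ)..t, deriv g s) 0 1 :=
    (hg.lipschitzOnWith.absolutelyContinuousOnInterval).sub
      hF.lipschitzOnWith.absolutelyContinuousOnInterval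
  have hzero : ∀ᵐ x, x ∈ uIcc (0 : ℝ) 1 →
      HasDerivAt (g - fun t => ∫ s in (0 : ℝ)..t, deriv g s) 0 x := by
    filter_upwards [hg.ae_differentiableAt_real, (hint 0 1).ae_hasDerivAt_integral] with x h1 h2 hx
    have := h1.hasDerivAt.sub (h2 hx 0 left_mem_uIcc)
    rwa [sub_self] at this
  obtain ⟨c, hc⟩ := hac.const_of_ae_hasDerivAt_zero hzero
  refine ⟨deriv g, hmem, fun t ht => ?_⟩
  have z : (0 : ℝ) ∈ Icc (0 : ℝ) 1 := by simp
  have h1 := hc t (by rwa [uIcc_of_le zero_le_one])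
  have h0 := hc 0 left_mem_uIcc
  simp only [Pi.sub_apply, intervalIntegral.integral_same, sub_zero] at h1 h0
  rw [hfg ht, hfg z, h0, ← h1]
  abel

end Lipschitz

/-! ### Lipschitz matrix functions: products and inverses. -/

theorem LipUnit.mul {f g : ℝ → M2} (hf : LipUnit f) (hg : LipUnit g) :
    LipUnit fun t => f t * g t := by
  obtain ⟨M, hM⟩ := LipUnit.exists_bound (E := M2) hf
  obtain ⟨N, hN⟩ := LipUnit.exists_bound (E := M2) hg
  obtain ⟨K, hK⟩ := hf
  obtain ⟨L, hL⟩ := hg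
  refine ⟨2 * K * N + 2 * M * L, fun s hs t ht => ?_⟩
  have e : f s * g s - f t * g t = (f s - f t) * g s + f t * (g s - g t) := by noncomm_ring
  rw [e]
  push_cast
  have h1 := norm_matrix_mul_le (f s - f t) (g s)
  have h2 := norm_matrix_mul_le (f t) (g s - g t)
  calc _ ≤ _ := norm_add_le _ _
    _ ≤ 2 * (K * |s - t|) * N + 2 * M * (L * |s - t|) := by
      refine add_le_add (h1.trans ?_) (h2.trans ?_)
      · gcongr
        · exact hK s hs t ht
        · exact hN s hs
      · gcongr
        · exact hM t ht
        · exact hL s hs t ht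
    _ = _ := by ring

theorem norm_matrix_inv_le (A : M2) : ‖A⁻¹‖ ≤ ‖A.det‖⁻¹ * ‖A‖ := by
  rw [Matrix.inv_def, norm_smul, Ring.inverse_eq_inv, norm_inv]
  gcongr
  rw [Matrix.norm_le_iff (norm_nonneg _), Matrix.adjugate_fin_two]
  intro i j
  fin_cases i <;> fin_cases j <;> simp <;> exact A.norm_entry_le_entrywise_sup_norm

theorem matrix_inv_sub_inv {A B : M2} (hA : IsUnit A.det) (hB : IsUnit B.det) :
    A⁻¹ - B⁻¹ = A⁻¹ * (B - A) * B⁻¹ := by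
  rw [mul_sub, sub_mul, mul_assoc, Matrix.mul_nonsing_inv B hB, Matrix.nonsing_inv_mul A hA, mul_one,
    one_mul]

theorem LipUnit.entry {f : ℝ → M2} (hf : LipUnit f) (i j : Fin 2) : LipUnit fun t => f t i j := by
  obtain ⟨K, hK⟩ := hf
  exact ⟨K, fun s hs t ht =>
    ((f s - f t).norm_entry_le_entrywise_sup_norm (i := i) (j := j)).trans (hK s hs t ht)⟩

theorem LipUnit.exists_det_bound {f : ℝ → M2} (hf : LipUnit f)
    (hdet : ∀ t ∈ Icc (0 : ℝ) 1, IsUnit (f t).det) :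
    ∃ c : ℝ≥0, ∀ t ∈ Icc (0 : ℝ) 1, ‖(f t).det‖⁻¹ ≤ c := by
  have hc : ContinuousOn (fun t => (f t).det) (Icc 0 1) := by
    simp only [Matrix.det_fin_two]
    exact (((hf.entry 0 0).continuousOn.mul (hf.entry 1 1).continuousOn).sub
      ((hf.entry 0 1).continuousOn.mul (hf.entry 1 0).continuousOn))
  have hc' : ContinuousOn (fun t => ((f t).det)⁻¹) (Icc 0 1) := hc.inv₀ fun t ht => (hdet t ht).ne_zero
  obtain ⟨M, hM⟩ := (isCompact_Icc (a := (0 : ℝ)) (b := 1)).exists_bound_of_continuousOn hc'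
  refine ⟨M.toNNReal, fun t ht => ?_⟩
  rw [← norm_inv]
  exact (hM t ht).trans (Real.le_coe_toNNReal M)

theorem LipUnit.inv {f : ℝ → M2} (hf : LipUnit f) (hdet : ∀ t ∈ Icc (0 : ℝ) 1, IsUnit (f t).det) :
    LipUnit fun t => (f t)⁻¹ := by
  obtain ⟨c, hc⟩ := hf.exists_det_bound hdet
  obtain ⟨M, hM⟩ := LipUnit.exists_bound (E := M2) hf
  obtain ⟨K, hK⟩ := hf
  have hinv : ∀ t ∈ Icc (0 : ℝ) 1, ‖(f t)⁻¹‖ ≤ c * M := fun t ht =>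
    (norm_matrix_inv_le _).trans (by gcongr; exacts [hc t ht, hM t ht])
  refine ⟨2 * (2 * (c * M) * K) * (c * M), fun s hs t ht => ?_⟩
  rw [matrix_inv_sub_inv (hdet s hs) (hdet t ht)]
  push_cast
  calc _ ≤ _ := norm_matrix_mul_le _ _
    _ ≤ 2 * (2 * (c * M) * (K * |s - t|)) * (c * M) := by
      gcongr
      · refine (norm_matrix_mul_le _ _).trans ?_
        gcongr
        · exact hinv s hs
        · rw [← norm_neg, neg_sub]
          exact hK s hs t ht
      · exact hinv t ht
    _ = _ := by ring

theorem LipUnit.list_prod {α : Type*} {φ : α → ℝ → M2} (L : List α) (h : ∀ a ∈ L, LipUnit (φ a)) :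
    LipUnit fun t => (L.map fun a => φ a t).prod := by
  induction L with
  | nil => exact LipUnit.const (1 : M2)
  | cons a L ih =>
    simp only [List.map_cons, List.prod_cons]
    exact (h a (by simp)).mul (ih fun b hb => h b (by simp [hb]))

theorem isUnit_det_list_prod (L : List M2) (h : ∀ A ∈ L, IsUnit A.det) : IsUnit L.prod.det := by
  induction L with
  | nil => simp
  | cons A L ih =>
    rw [List.prod_cons, Matrix.det_mul]
    exact (h A (by simp)).mul (ih fun B hB => h B (by simp [hB]))

/-! ### 1-regularity in terms of Lipschitz continuity. -/

section OneRegular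

variable {Γ : Contour} {G : Fn Γ}

theorem Contour.Regular.memSobolev_top_iff (hΓ : Γ.Regular) :
    MemSobolev Γ 1 ⊤ (G - one Γ) ↔ ∀ i, LipUnit (G i) := by
  rw [hΓ.memSobolev_one_iff le_top]
  refine forall_congr' fun i => ⟨fun h => ?_, fun h => ?_⟩
  · exact ((HasPrimitive.lipUnit (E := M2) h).add (LipUnit.const (1 : M2))).congr fun t _ =>
      (sub_add_cancel (G i t) (1 : M2)).symm
  · refine LipUnit.hasPrimitive (E := M2) ((LipUnit.add h (LipUnit.const (-1 : M2))).congr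
      fun t _ => sub_eq_add_neg (G i t) (1 : M2))

/-- W^{1,∞} means Lipschitz on every arc. It passes to inverses since the determinant is bounded
away from 0 on a compact arc, and it implies H¹ since arcs have finite length; so the four Sobolev
conditions reduce to one. -/
theorem Contour.Regular.isOneRegular_iff (hΓ : Γ.Regular) :
    IsOneRegular Γ G ↔ (∀ i, ∀ t ∈ Icc (0 : ℝ) 1, IsUnit (G i t).det) ∧ ProductCondition Γ G ∧
      ∀ i, LipUnit (G i) := by
  have hmono : ∀ {f : Fn Γ}, MemSobolev Γ 1 ⊤ f → MemSobolev Γ 1 2 f := fun h =>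
    (hΓ.memSobolev_one_iff one_le_two).2 fun i =>
      HasPrimitive.mono (E := M2) le_top ((hΓ.memSobolev_one_iff le_top).1 h i)
  refine ⟨fun h => ⟨h.invertible, h.product, hΓ.memSobolev_top_iff.1 h.winf⟩, ?_⟩
  rintro ⟨h1, h2, h3⟩
  have h4 := hΓ.memSobolev_top_iff.2 h3
  have h5 := hΓ.memSobolev_top_iff.2 fun i => (h3 i).inv (h1 i)
  exact ⟨h1, h2, h4, h5, hmono h4, hmono h5⟩

end OneRegular

/-! ### Cauchy integrals off the contour -/

section CauchyBound

variable {E : Type*} [NormedAddCommGroup E] [NormedSpace ℂ E] {Γ : Contour}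

theorem norm_cauchy_const_le (v : E) : ‖(1 / (2 * Real.pi * Complex.I) : ℂ) • v‖ ≤ ‖v‖ := by
  rw [norm_smul]
  refine mul_le_of_le_one_left (norm_nonneg _) ?_
  simp only [norm_div, norm_mul, norm_one, Complex.norm_I, Complex.norm_real, mul_one,
    Complex.norm_ofNat, Real.norm_eq_abs, abs_of_pos Real.pi_pos]
  rw [div_le_one (by positivity)]
  linarith [Real.pi_gt_three]

theorem norm_sum_integral_le {w : Γ.ι → ℝ → E} {B : ℝ}
    (h : ∀ i, ∀ t ∈ Icc (0 : ℝ) 1, ‖w i t‖ ≤ B) :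
    ‖∑ i, ∫ t in (0 : ℝ)..1, w i t‖ ≤ Fintype.card Γ.ι * B := by
  refine (norm_sum_le _ _).trans ?_
  rw [← nsmul_eq_mul, ← Finset.card_univ]
  refine Finset.sum_le_card_nsmul _ _ _ fun i _ => ?_
  have := intervalIntegral.norm_integral_le_of_norm_le_const (a := 0) (b := 1) (C := B) (f := w i)
    fun x hx => h i x (by
      rw [uIoc_of_le zero_le_one] at hx
      exact Ioc_subset_Icc_self hx)
  simpa using this

theorem exists_speed_bound (hs : ∀ i, ContDiff ℝ ∞ (Γ.γ i)) :
    ∃ D : ℝ, 0 ≤ D ∧ ∀ i, ∀ t ∈ Icc (0 : ℝ) 1, ‖deriv (Γ.γ i) t‖ ≤ D := by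
  have h : ∀ i, ∃ D, ∀ t ∈ Icc (0 : ℝ) 1, ‖deriv (Γ.γ i) t‖ ≤ D := fun i =>
    isCompact_Icc.exists_bound_of_continuousOn ((hs i).continuous_deriv (by simp)).continuousOn
  choose D hD using h
  refine ⟨∑ i, |D i|, by positivity, fun i t ht => (hD i t ht).trans ((le_abs_self _).trans ?_)⟩
  exact Finset.single_le_sum (f := fun i => |D i|) (fun _ _ => abs_nonneg _) (Finset.mem_univ i)

variable {D M r : ℝ} {u : Γ.ι → ℝ → E}

theorem norm_cauchyInt_le (hD : ∀ i, ∀ t ∈ Icc (0 : ℝ) 1, ‖deriv (Γ.γ i) t‖ ≤ D) (hr : 0 < r)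
    (hD0 : 0 ≤ D) (hM : ∀ i, ∀ t ∈ Icc (0 : ℝ) 1, ‖u i t‖ ≤ M) {z : ℂ}
    (hz : ∀ i, ∀ t ∈ Icc (0 : ℝ) 1, r ≤ ‖Γ.γ i t - z‖) :
    ‖cauchyInt Γ u z‖ ≤ Fintype.card Γ.ι * (D / r * M) := by
  refine (norm_cauchy_const_le _).trans (norm_sum_integral_le fun i t ht => ?_)
  rw [norm_smul, norm_div]
  gcongr
  exacts [hD i t ht, hz i t ht, hM i t ht]

theorem norm_cauchyInt_sub_le (hs : ∀ i, ContDiff ℝ ∞ (Γ.γ i)) (hu : ∀ i, Continuous (u i))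
    (hD : ∀ i, ∀ t ∈ Icc (0 : ℝ) 1, ‖deriv (Γ.γ i) t‖ ≤ D) (hr : 0 < r)
    (hD0 : 0 ≤ D) (hM : ∀ i, ∀ t ∈ Icc (0 : ℝ) 1, ‖u i t‖ ≤ M) {z w : ℂ}
    (hz : ∀ i, ∀ t ∈ Icc (0 : ℝ) 1, r ≤ ‖Γ.γ i t - z‖)
    (hw : ∀ i, ∀ t ∈ Icc (0 : ℝ) 1, r ≤ ‖Γ.γ i t - w‖) :
    ‖cauchyInt Γ u z - cauchyInt Γ u w‖ ≤ Fintype.card Γ.ι * (D * ‖z - w‖ / (r * r) * M) := by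
  have hoff : ∀ {y : ℂ}, (∀ i, ∀ t ∈ Icc (0 : ℝ) 1, r ≤ ‖Γ.γ i t - y‖) →
      ∀ i, y ∉ Γ.γ i '' Icc 0 1 := by
    rintro y hy i ⟨t, ht, rfl⟩
    have := hy i t ht
    rw [sub_self, norm_zero] at this
    linarith
  have hne : ∀ {y : ℂ}, (∀ i, ∀ t ∈ Icc (0 : ℝ) 1, r ≤ ‖Γ.γ i t - y‖) →
      ∀ i, ∀ t ∈ Icc (0 : ℝ) 1, Γ.γ i t - y ≠ 0 := fun hy i t ht h0 => by
    have := hy i t ht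
    rw [h0, norm_zero] at this
    linarith
  rw [cauchyInt, cauchyInt, ← smul_sub, ← Finset.sum_sub_distrib]
  refine (norm_cauchy_const_le _).trans ?_
  simp_rw [← intervalIntegral.integral_sub (intervalIntegrable_cauchyKernel (hs _) (hu _)
    zero_le_one (hoff hz _)) (intervalIntegrable_cauchyKernel (hs _) (hu _) zero_le_one
    (hoff hw _)), ← sub_smul]
  refine norm_sum_integral_le fun i t ht => ?_
  have h1 := hne hz i t ht
  have h2 := hne hw i t ht
  have e : deriv (Γ.γ i) t / (Γ.γ i t - z) - deriv (Γ.γ i) t / (Γ.γ i t - w) =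
      deriv (Γ.γ i) t * (z - w) / ((Γ.γ i t - z) * (Γ.γ i t - w)) := by
    field_simp
    ring
  rw [e, norm_smul, norm_div, norm_mul, norm_mul]
  gcongr
  exacts [hD i t ht, hz i t ht, hw i t ht, hM i t ht]

theorem Contour.isCompact_trace (hs : ∀ i, ContDiff ℝ ∞ (Γ.γ i)) : IsCompact Γ.trace :=
  isCompact_iUnion fun i => isCompact_Icc.image (hs i).continuous

theorem Contour.mem_trace (i : Γ.ι) {t : ℝ} (ht : t ∈ Icc (0 : ℝ) 1) : Γ.γ i t ∈ Γ.trace :=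
  mem_iUnion.2 ⟨i, t, ht, rfl⟩

theorem exists_pos_le_norm_sub_of_isCompact (hs : ∀ i, ContDiff ℝ ∞ (Γ.γ i)) {S : Set ℂ}
    (hS : IsCompact S) (hd : Disjoint S Γ.trace) :
    ∃ r > 0, ∀ z ∈ S, ∀ i, ∀ t ∈ Icc (0 : ℝ) 1, r ≤ ‖Γ.γ i t - z‖ := by
  obtain ⟨r, hr, h⟩ := Metric.exists_pos_forall_lt_edist hS (Contour.isCompact_trace hs).isClosed hd
  refine ⟨r, hr, fun z hz i t ht => ?_⟩
  have := h z hz _ (Contour.mem_trace i ht)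
  rw [edist_comm, edist_dist, dist_eq_norm, ← ENNReal.ofReal_coe_nnreal] at this
  exact (ENNReal.ofReal_lt_ofReal_iff_of_nonneg r.2).1 this |>.le

theorem exists_pos_eventually_le_norm_sub (hs : ∀ i, ContDiff ℝ ∞ (Γ.γ i)) {z₀ : ℂ}
    (hz : z₀ ∉ Γ.trace) :
    ∃ r > 0, ∀ᶠ z in 𝓝 z₀, ∀ i, ∀ t ∈ Icc (0 : ℝ) 1, r ≤ ‖Γ.γ i t - z‖ := by
  obtain ⟨r, hr, h⟩ := exists_pos_le_norm_sub_of_isCompact hs (isCompact_singleton (x := z₀))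
    (disjoint_singleton_left.2 hz)
  refine ⟨r / 2, by positivity, ?_⟩
  filter_upwards [Metric.ball_mem_nhds z₀ (half_pos hr)] with z hz i t ht
  have h1 := h z₀ rfl i t ht
  have h2 := norm_sub_le_norm_sub_add_norm_sub (Γ.γ i t) z z₀
  rw [Metric.mem_ball, dist_eq_norm] at hz
  linarith

theorem LipUnit.cauchyInt_comp (hs : ∀ i, ContDiff ℝ ∞ (Γ.γ i)) (hu : ∀ i, Continuous (u i))
    (hM : ∀ i, ∀ t ∈ Icc (0 : ℝ) 1, ‖u i t‖ ≤ M) {z : ℝ → ℂ} (hz : LipUnit z)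
    (hoff : ∀ t ∈ Icc (0 : ℝ) 1, z t ∉ Γ.trace) : LipUnit fun t => cauchyInt Γ u (z t) := by
  have : NormedSpace ℝ E := NormedSpace.restrictScalars ℝ ℂ E
  obtain ⟨D, hD0, hD⟩ := exists_speed_bound hs
  obtain ⟨r, hr, h⟩ := exists_pos_le_norm_sub_of_isCompact hs
    (isCompact_Icc.image_of_continuousOn hz.continuousOn) (S := z '' Icc 0 1)
    (disjoint_left.2 (by rintro _ ⟨t, ht, rfl⟩; exact hoff t ht))
  obtain ⟨K, hK⟩ := hz
  have hM' : ∀ i, ∀ t ∈ Icc (0 : ℝ) 1, ‖u i t‖ ≤ |M| := fun i t ht =>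
    (hM i t ht).trans (le_abs_self M)
  refine ⟨(Fintype.card Γ.ι * (D * K / (r * r) * |M|)).toNNReal, fun s hs' t ht => ?_⟩
  rw [Real.coe_toNNReal _ (by positivity)]
  refine (norm_cauchyInt_sub_le hs hu hD hr hD0 hM' (h _ ⟨s, hs', rfl⟩) (h _ ⟨t, ht, rfl⟩)).trans ?_
  have := hK s hs' t ht
  calc _ ≤ (Fintype.card Γ.ι : ℝ) * (D * (K * |s - t|) / (r * r) * |M|) := by gcongr
    _ = _ := by ring

/-- Density and evaluation point vary together. The error is the Cauchy integral of v a - u at the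
moving point plus a displacement of the point for fixed u; both are controlled by a positive
distance from the contour near z₀. -/
theorem tendsto_cauchyInt [CompleteSpace E] (hs : ∀ i, ContDiff ℝ ∞ (Γ.γ i)) {α : Type*} {l : Filter α}
    {v : α → Γ.ι → ℝ → E} (hu : ∀ i, Continuous (u i)) (hv : ∀ a i, Continuous (v a i))
    {B : α → ℝ} (hB : ∀ a i, ∀ t ∈ Icc (0 : ℝ) 1, ‖(v a - u) i t‖ ≤ B a)
    (hlim : Tendsto B l (𝓝 0)) {z : α → ℂ} {z₀ : ℂ} (hz : Tendsto z l (𝓝 z₀))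
    (hz₀ : z₀ ∉ Γ.trace) :
    Tendsto (fun a => cauchyInt Γ (v a) (z a)) l (𝓝 (cauchyInt Γ u z₀)) := by
  obtain ⟨D, hD0, hD⟩ := exists_speed_bound hs
  obtain ⟨r, hr, h⟩ := exists_pos_eventually_le_norm_sub hs hz₀
  have hMi : ∀ i, ∃ M, ∀ t ∈ Icc (0 : ℝ) 1, ‖u i t‖ ≤ M := fun i =>
    isCompact_Icc.exists_bound_of_continuousOn (hu i).continuousOn
  choose M hM using hMi
  have hM' : ∀ i, ∀ t ∈ Icc (0 : ℝ) 1, ‖u i t‖ ≤ ∑ i, |M i| := fun i t ht =>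
    (hM i t ht).trans ((le_abs_self _).trans
      (Finset.single_le_sum (f := fun i => |M i|) (fun _ _ => abs_nonneg _) (Finset.mem_univ i)))
  have h0 := h.self_of_nhds
  rw [tendsto_iff_norm_sub_tendsto_zero]
  have hz' : Tendsto (fun a => ‖z a - z₀‖) l (𝓝 0) := tendsto_iff_norm_sub_tendsto_zero.1 hz
  have hup : Tendsto (fun a => Fintype.card Γ.ι * (D / r * B a) +
      Fintype.card Γ.ι * (D * ‖z a - z₀‖ / (r * r) * ∑ i, |M i|)) l (𝓝 0) := by
    have h1 := ((hlim.const_mul (D / r)).const_mul (Fintype.card Γ.ι : ℝ))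
    have h2 := ((((hz'.const_mul D).div_const (r * r)).mul_const (∑ i, |M i|)).const_mul
      (Fintype.card Γ.ι : ℝ))
    simpa using h1.add h2
  refine squeeze_zero' (Eventually.of_forall fun _ => norm_nonneg _) ?_ hup
  filter_upwards [hz.eventually h] with a ha
  have hoff : z a ∉ Γ.trace := fun hmem => by
    obtain ⟨i, t, ht, hti⟩ := mem_iUnion.1 hmem
    have := ha i t ht
    rw [hti, sub_self, norm_zero] at this
    linarith
  have e : cauchyInt Γ (v a) (z a) - cauchyInt Γ u z₀ =
      cauchyInt Γ (v a - u) (z a) + (cauchyInt Γ u (z a) - cauchyInt Γ u z₀) := by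
    have := cauchyInt_add hs (fun i => (hv a i).sub (hu i)) hu hoff
    rw [show (fun i => v a i - u i) + u = v a from sub_add_cancel (v a) u] at this
    rw [show v a - u = fun i => v a i - u i from rfl, add_sub_assoc', ← this]
  rw [e]
  exact (norm_add_le _ _).trans (add_le_add (norm_cauchyInt_le hD hr hD0 (hB a) ha)
    (norm_cauchyInt_sub_le hs hu hD hr hD0 hM' ha h0))

end CauchyBound

/-! ### Regularity of the jump matrices of the stages -/

section Stage

variable {ℓ : ℕ} {Ω : Fin ℓ → Contour} {a b : Fin ℓ → ℂ}

/-- The contours `a i • Ω i + b i` are disjoint and not degenerate. -/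
structure IsSeparated (Ω : Fin ℓ → Contour) (a b : Fin ℓ → ℂ) : Prop where
  ne_zero : ∀ i, a i ≠ 0
  disjoint : ∀ i j, i ≠ j → Disjoint ((fun k => a i * k + b i) '' (Ω i).trace)
    ((fun k => a j * k + b j) '' (Ω j).trace)

theorem IsSeparated.notMem_trace (h : IsSeparated Ω a b) {i j : Fin ℓ} (hij : i ≠ j) {k : ℂ}
    (hk : k ∈ (Ω i).trace) : (a i * k + b i - b j) / a j ∉ (Ω j).trace := by
  intro hmem
  refine disjoint_left.1 (h.disjoint i j hij) ⟨k, hk, rfl⟩ ⟨_, hmem, ?_⟩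
  have := h.ne_zero j
  field_simp
  ring

/-- The product `Φ_{i-1,i} ⋯ Φ_{1,i}`. -/
def stageMul (Ω : Fin ℓ → Contour) (a b : Fin ℓ → ℂ) (i : Fin ℓ) (U : ∀ j, PC (Ω j)) : Fn (Ω i) :=
  fun x t => (((List.finRange ℓ).filter (· < i)).reverse.map fun j =>
    stagePhi Ω a b j i (U j) x t).prod

/-- The inverses occur in reverse order, so that all stages together amount to a single conjugation.
-/
theorem stageJump_eq (H : ∀ i, Fn (Ω i)) (i : Fin ℓ) (U : ∀ j, PC (Ω j)) (x : (Ω i).ι) (t : ℝ) :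
    stageJump Ω a b H i U x t =
      stageMul Ω a b i U x t * H i x t * (stageMul Ω a b i U x t)⁻¹ := by
  rw [stageMul, Matrix.list_prod_inv_reverse, ← List.map_reverse, List.reverse_reverse,
    List.map_map]
  rfl

theorem stageMul_congr {i : Fin ℓ} {U V : ∀ j, PC (Ω j)} (h : ∀ j < i, U j = V j) :
    stageMul Ω a b i U = stageMul Ω a b i V := by
  funext x t
  rw [stageMul, stageMul]
  congr 1
  refine List.map_congr_left fun j hj => ?_
  rw [List.mem_reverse, List.mem_filter] at hj
  rw [h j (by simpa using hj.2)]

theorem stageJump_congr {H : ∀ i, Fn (Ω i)} {i : Fin ℓ} {U V : ∀ j, PC (Ω j)}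
    (h : ∀ j < i, U j = V j) : stageJump Ω a b H i U = stageJump Ω a b H i V := by
  funext x t
  rw [stageJump_eq, stageJump_eq, stageMul_congr h]

/-- The factors Φ depend on the arc only through the point of the plane. Hence all ends at a
junction are conjugated by one matrix, which preserves the product condition. -/
theorem stageMul_eq_of_eq {i : Fin ℓ} (U : ∀ j, PC (Ω j)) {x y : (Ω i).ι} {s t : ℝ}
    (h : (Ω i).γ x s = (Ω i).γ y t) : stageMul Ω a b i U x s = stageMul Ω a b i U y t := by
  simp only [stageMul, stagePhi, h]

theorem isUnit_det_stageMul {i : Fin ℓ} {U : ∀ j, PC (Ω j)} {x : (Ω i).ι} {t : ℝ}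
    (h : ∀ j < i, IsUnit (stagePhi Ω a b j i (U j) x t).det) :
    IsUnit (stageMul Ω a b i U x t).det := by
  refine isUnit_det_list_prod _ fun A hA => ?_
  obtain ⟨j, hj, rfl⟩ := List.mem_map.1 hA
  rw [List.mem_reverse, List.mem_filter] at hj
  exact h j (by simpa using hj.2)

theorem lipUnit_of_contDiff {γ : ℝ → ℂ} (hγ : ContDiff ℝ ∞ γ) : LipUnit γ := by
  obtain ⟨D, hD⟩ := (isCompact_Icc (a := (0 : ℝ)) (b := 1)).exists_bound_of_continuousOn
    (hγ.continuous_deriv (by simp)).continuousOn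
  refine ⟨D.toNNReal, fun s hs t ht => ?_⟩
  exact (convex_Icc (0 : ℝ) 1).norm_image_sub_le_of_norm_deriv_le
    (fun x _ => (hγ.differentiable (by simp)).differentiableAt)
    (fun x hx => (hD x hx).trans (Real.le_coe_toNNReal D)) ht hs

theorem IsSeparated.lipUnit_stagePhi (h : IsSeparated Ω a b) (hΩ : ∀ i, (Ω i).IsPiecewiseSmooth)
    {i j : Fin ℓ} (hij : i ≠ j) (u : PC (Ω j)) (x : (Ω i).ι) :
    LipUnit (stagePhi Ω a b j i u x) := by
  have hz : LipUnit fun t => (a i * (Ω i).γ x t + b i - b j) / a j := by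
    obtain ⟨K, hK⟩ := lipUnit_of_contDiff ((hΩ i).smooth x)
    refine ⟨‖a i / a j‖₊ * K, fun s hs t ht => ?_⟩
    have e : (a i * (Ω i).γ x s + b i - b j) / a j - (a i * (Ω i).γ x t + b i - b j) / a j =
        a i / a j * ((Ω i).γ x s - (Ω i).γ x t) := by ring
    rw [e, norm_mul, NNReal.coe_mul, coe_nnnorm, mul_assoc]
    gcongr
    exact hK s hs t ht
  exact (LipUnit.const (1 : M2)).add (LipUnit.cauchyInt_comp (E := M2) (hΩ j).smooth
    (continuous_toFn u) (fun i t ht => u.norm_toFn_le i ht) hz fun t ht =>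
    h.notMem_trace hij (Contour.mem_trace x ht))

theorem IsSeparated.lipUnit_stageMul (h : IsSeparated Ω a b) (hΩ : ∀ i, (Ω i).IsPiecewiseSmooth)
    (i : Fin ℓ) (U : ∀ j, PC (Ω j)) (x : (Ω i).ι) : LipUnit (stageMul Ω a b i U x) := by
  refine LipUnit.list_prod _ fun j hj => ?_
  rw [List.mem_reverse, List.mem_filter] at hj
  exact h.lipUnit_stagePhi hΩ (ne_of_gt (by simpa using hj.2)) (U j) x

theorem regular_scaledUnion (h : IsSeparated Ω a b) (hΩ : ∀ i, (Ω i).IsPiecewiseSmooth) :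
    (Contour.scaledUnion Ω a b).Regular where
  smooth x := (contDiff_const.mul ((hΩ x.1).smooth x.2)).add contDiff_const
  regular x t ht := by
    have : deriv ((Contour.scaledUnion Ω a b).γ x) t = a x.1 * deriv ((Ω x.1).γ x.2) t := by
      change deriv (fun t => a x.1 * (Ω x.1).γ x.2 t + b x.1) t = _
      rw [deriv_add_const, deriv_const_mul_field]
    rw [this]
    exact mul_ne_zero (h.ne_zero _) ((hΩ x.1).regular x.2 t ht)

/-- An end of `Ω i` as an end of the union. -/
def unionEnd (Ω : Fin ℓ → Contour) (a b : Fin ℓ → ℂ) (i : Fin ℓ) (e : (Ω i).End) :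
    (Contour.scaledUnion Ω a b).End := (⟨i, e.1⟩, e.2)

theorem pt_unionEnd (i : Fin ℓ) (e : (Ω i).End) :
    (Contour.scaledUnion Ω a b).pt (unionEnd Ω a b i e) = a i * (Ω i).pt e + b i := rfl

theorem dir_unionEnd (i : Fin ℓ) (e : (Ω i).End) :
    (Contour.scaledUnion Ω a b).dir (unionEnd Ω a b i e) = a i * (Ω i).dir e := by
  have : ∀ t, deriv ((Contour.scaledUnion Ω a b).γ ⟨i, e.1⟩) t = a i * deriv ((Ω i).γ e.1) t := by
    intro t
    change deriv (fun t => a i * (Ω i).γ e.1 t + b i) t = _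
    rw [deriv_add_const, deriv_const_mul_field]
  simp only [Contour.dir, unionEnd, this]
  split_ifs
  · rw [mul_neg]
  · rfl

theorem IsSeparated.angle_unionEnd (h : IsSeparated Ω a b) (i : Fin ℓ) (e e' : (Ω i).End) :
    (Contour.scaledUnion Ω a b).angle (unionEnd Ω a b i e) (unionEnd Ω a b i e') =
      (Ω i).angle e e' := by
  rw [Contour.angle, Contour.angle, dir_unionEnd, dir_unionEnd,
    mul_div_mul_left _ _ (h.ne_zero i)]

theorem Contour.pt_mem_trace {Γ : Contour} (e : Γ.End) : Γ.pt e ∈ Γ.trace := by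
  refine Contour.mem_trace e.1 ?_
  rw [Contour.par]
  split_ifs <;> simp

/-- By disjointness no other contour has an end at this point, so a junction of the union is a
junction of a single `Ω i`. -/
theorem IsSeparated.exists_unionEnd (h : IsSeparated Ω a b) {i : Fin ℓ} {e₀ : (Ω i).End}
    {e' : (Contour.scaledUnion Ω a b).End}
    (he : (Contour.scaledUnion Ω a b).pt e' = a i * (Ω i).pt e₀ + b i) :
    ∃ e : (Ω i).End, unionEnd Ω a b i e = e' ∧ (Ω i).pt e = (Ω i).pt e₀ := by
  obtain ⟨⟨j, x⟩, s⟩ := e'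
  have h1 : a j * (Ω j).pt (x, s) + b j = a i * (Ω i).pt e₀ + b i := he
  have hji : j = i := by
    by_contra hne
    exact disjoint_left.1 (h.disjoint j i hne) ⟨_, Contour.pt_mem_trace (x, s), rfl⟩
      ⟨_, Contour.pt_mem_trace e₀, h1.symm⟩
  subst hji
  exact ⟨(x, s), rfl, mul_left_cancel₀ (h.ne_zero j) (add_right_cancel h1)⟩

theorem list_prod_conj {A : M2} (hA : IsUnit A.det) (L : List M2) :
    (L.map fun B => A * B * A⁻¹).prod = A * L.prod * A⁻¹ := by
  induction L with
  | nil => simp [Matrix.mul_nonsing_inv A hA]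
  | cons B L ih =>
    rw [List.map_cons, List.prod_cons, ih, List.prod_cons]
    calc _ = A * B * (A⁻¹ * A) * L.prod * A⁻¹ := by noncomm_ring
      _ = _ := by rw [Matrix.nonsing_inv_mul A hA]; noncomm_ring

theorem matrix_conj_inv {A : M2} (hA : IsUnit A.det) (B : M2) :
    (A * B * A⁻¹)⁻¹ = A * B⁻¹ * A⁻¹ := by
  rw [Matrix.mul_inv_rev, Matrix.mul_inv_rev, Matrix.nonsing_inv_nonsing_inv A hA, mul_assoc]

/-- The jump matrix of a stage inherits the regularity of the given jump matrix. -/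
theorem IsSeparated.isOneRegular_stageJump (h : IsSeparated Ω a b)
    (hΩ : ∀ i, (Ω i).IsPiecewiseSmooth) {G : Fn (Contour.scaledUnion Ω a b)}
    (hG : IsOneRegular (Contour.scaledUnion Ω a b) G) {H : ∀ i, Fn (Ω i)}
    (hH : ∀ i, H i = scaledRestriction Ω a b G i) (i : Fin ℓ) (U : ∀ j, PC (Ω j))
    (hU : ∀ j < i, ∀ x, ∀ t ∈ Icc (0 : ℝ) 1, IsUnit (stagePhi Ω a b j i (U j) x t).det) :
    IsOneRegular (Ω i) (stageJump Ω a b H i U) := by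
  obtain ⟨hinv, hprod, hlip⟩ := (regular_scaledUnion h hΩ).isOneRegular_iff.1 hG
  have hdet : ∀ x, ∀ t ∈ Icc (0 : ℝ) 1, IsUnit (stageMul Ω a b i U x t).det := fun x t ht =>
    isUnit_det_stageMul fun j hj => hU j hj x t ht
  have hHG : ∀ x t, H i x t = G ⟨i, x⟩ t := fun x t => by rw [hH i]; rfl
  refine (hΩ i).toRegular.isOneRegular_iff.2 ⟨fun x t ht => ?_, ?_, fun x => ?_⟩
  · rw [stageJump_eq, hHG, Matrix.det_mul, Matrix.det_mul]
    exact ((hdet x t ht).mul (hinv ⟨i, x⟩ t ht)).mul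
      ((Matrix.isUnit_nonsing_inv_det_iff).2 (hdet x t ht))
  · intro p e₀ L hL hsorted
    set A : M2 := stageMul Ω a b i U e₀.1 ((Ω i).par e₀) with hA
    have hp : (Ω i).pt e₀ = p := (hL e₀).1 (by simp)
    have hpar : ∀ e : (Ω i).End, (Ω i).par e ∈ Icc (0 : ℝ) 1 := fun e => by
      rw [Contour.par]; split_ifs <;> simp
    have hAdet : IsUnit A.det := hdet _ _ (hpar e₀)
    have hend : ∀ e ∈ e₀ :: L, endJump (stageJump Ω a b H i U) e =
        A * endJump G (unionEnd Ω a b i e) * A⁻¹ := by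
      intro e he
      have hAe : stageMul Ω a b i U e.1 ((Ω i).par e) = A :=
        stageMul_eq_of_eq U (((hL e).1 he).trans hp.symm)
      obtain ⟨x, s⟩ := e
      cases s
      · simp only [Contour.par, Bool.false_eq_true, if_false] at hAe
        simp only [endJump, unionEnd, Bool.false_eq_true, if_false]
        rw [stageJump_eq, hAe, hHG]
      · simp only [Contour.par, if_true] at hAe
        simp only [endJump, unionEnd, if_true]
        rw [stageJump_eq, hAe, hHG, matrix_conj_inv hAdet]
    -- Multiplication by `a i` rotates all directions at p alike, so the list is still in
    -- counter-clockwise order and exhausts the ends at the image point.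
    have h1 := hprod (a i * p + b i) (unionEnd Ω a b i e₀) (L.map (unionEnd Ω a b i)) (by
      intro e'
      rw [← List.map_cons, List.mem_map]
      constructor
      · rintro ⟨e, he, rfl⟩
        rw [pt_unionEnd, (hL e).1 he]
      · intro he
        rw [← hp] at he
        obtain ⟨e, rfl, hpe⟩ := h.exists_unionEnd he
        exact ⟨e, (hL e).2 (hpe.trans hp), rfl⟩) (by
      rw [← List.map_cons, List.pairwise_map]
      refine hsorted.imp fun {e e'} hee => ?_
      rwa [h.angle_unionEnd, h.angle_unionEnd])
    rw [← List.map_cons, List.map_map] at h1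
    have h2 := list_prod_conj hAdet ((e₀ :: L).map (endJump G ∘ unionEnd Ω a b i))
    rw [List.map_map, h1, mul_one, Matrix.mul_nonsing_inv A hAdet] at h2
    rw [List.map_congr_left hend]
    exact h2
  · have h1 := h.lipUnit_stageMul hΩ i U x
    exact ((h1.mul (hlip ⟨i, x⟩)).mul (h1.inv (hdet x))).congr fun t _ => by
      rw [stageJump_eq, hHG]

end Stage

/-! ### Continuous convergence on the unit interval -/

section ContConv

/-- `F i` converges continuously to `F₀` on the unit interval. -/
def ContConv {ι E : Type*} [TopologicalSpace E] (l : Filter ι) (F : ι → ℝ → E) (F₀ : ℝ → E) : Prop :=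
  ∀ t₀ ∈ Icc (0 : ℝ) 1, Tendsto (fun p : ι × ℝ => F p.1 p.2) (l ×ˢ 𝓝[Icc 0 1] t₀) (𝓝 (F₀ t₀))

/-- Tube lemma over the compact parameter interval; it turns joint limits at every t₀ into
statements uniform in t. -/
theorem eventually_forall_Icc {P : Type*} [TopologicalSpace P] {η : P} {Q : P → ℝ → Prop}
    (h : ∀ t₀ ∈ Icc (0 : ℝ) 1, ∀ᶠ p : P × ℝ in 𝓝 η ×ˢ 𝓝[Icc 0 1] t₀, Q p.1 p.2) :
    ∀ᶠ ξ in 𝓝 η, ∀ t ∈ Icc (0 : ℝ) 1, Q ξ t := by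
  have := (isCompact_Icc (a := (0 : ℝ)) (b := 1)).eventually_forall_of_forall_eventually
    (x₀ := η) (P := fun ξ t => t ∈ Icc (0 : ℝ) 1 → Q ξ t) fun t ht => by
      have h1 := h t ht
      rw [← nhdsWithin_univ η, ← nhdsWithin_prod_eq, eventually_nhdsWithin_iff] at h1
      exact h1.mono fun p hp hpt => hp ⟨mem_univ _, hpt⟩
  exact this.mono fun ξ hξ t ht => hξ t ht ht

section Normed

variable {P E : Type*} [NormedAddCommGroup E]

theorem ContConv.of_enorm_le {l : Filter P} {F : P → ℝ → E} {F₀ : ℝ → E} {B : P → ℝ≥0∞}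
    (hB : Tendsto B l (𝓝 0)) (h : ∀ i, ∀ t ∈ Icc (0 : ℝ) 1, ‖F i t - F₀ t‖ₑ ≤ B i)
    (hF₀ : ContinuousOn F₀ (Icc 0 1)) : ContConv l F F₀ := by
  intro t₀ ht₀
  rw [tendsto_iff_edist_tendsto_0]
  have h1 : Tendsto (fun p : P × ℝ => B p.1 + edist (F₀ p.2) (F₀ t₀)) (l ×ˢ 𝓝[Icc 0 1] t₀)
      (𝓝 0) := by
    have h2 := tendsto_iff_edist_tendsto_0.1 (hF₀ t₀ ht₀)
    simpa using (hB.comp tendsto_fst).add (h2.comp tendsto_snd)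
  refine tendsto_of_tendsto_of_tendsto_of_le_of_le' tendsto_const_nhds h1
    (Eventually.of_forall fun _ => zero_le) ?_
  have h3 : ∀ᶠ p : P × ℝ in l ×ˢ 𝓝[Icc 0 1] t₀, p.2 ∈ Icc (0 : ℝ) 1 :=
    tendsto_snd.eventually self_mem_nhdsWithin
  filter_upwards [h3] with p hp
  refine (edist_triangle _ (F₀ p.2) _).trans ?_
  gcongr
  rw [edist_eq_enorm_sub]
  exact h _ _ hp

theorem ContConv.eventually_norm_sub_lt [TopologicalSpace P] {η : P} {F : P → ℝ → E} {F₀ : ℝ → E}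
    (h : ContConv (𝓝 η) F F₀) (hF₀ : ContinuousOn F₀ (Icc 0 1)) {ε : ℝ} (hε : 0 < ε) :
    ∀ᶠ ξ in 𝓝 η, ∀ t ∈ Icc (0 : ℝ) 1, ‖F ξ t - F₀ t‖ < ε := by
  refine eventually_forall_Icc fun t₀ ht₀ => ?_
  have h1 := ((h t₀ ht₀).sub ((hF₀ t₀ ht₀).tendsto.comp tendsto_snd)).norm
  rw [sub_self, norm_zero] at h1
  exact h1.eventually_lt_const hε

end Normed

variable {P : Type*} {l : Filter P} {F F' : P → ℝ → M2} {F₀ F₀' : ℝ → M2}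

/-- Continuous convergence passes through products, determinants and inverses by their continuity at
the limit matrix, without uniform bounds. -/
theorem ContConv.mul (h : ContConv l F F₀) (h' : ContConv l F' F₀') :
    ContConv l (fun i t => F i t * F' i t) fun t => F₀ t * F₀' t :=
  fun t ht => (h t ht).mul (h' t ht)

theorem ContConv.det (h : ContConv l F F₀) :
    ContConv l (fun i t => (F i t).det) fun t => (F₀ t).det :=
  fun t ht => ((continuous_id.matrix_det).tendsto (F₀ t)).comp (h t ht)

theorem ContConv.inv (h : ContConv l F F₀) (hdet : ∀ t ∈ Icc (0 : ℝ) 1, IsUnit (F₀ t).det) :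
    ContConv l (fun i t => (F i t)⁻¹) fun t => (F₀ t)⁻¹ := by
  intro t ht
  refine Tendsto.comp (continuousAt_matrix_inv (F₀ t) ?_) (h t ht)
  rw [Ring.inverse_eq_inv']
  exact continuousAt_inv₀ (hdet t ht).ne_zero

theorem ContConv.list_prod {α : Type*} {φ : α → P → ℝ → M2} {φ₀ : α → ℝ → M2} (L : List α)
    (h : ∀ a ∈ L, ContConv l (φ a) (φ₀ a)) :
    ContConv l (fun i t => (L.map fun a => φ a i t).prod) fun t => (L.map fun a => φ₀ a t).prod := by
  induction L with
  | nil => exact fun t _ => tendsto_const_nhds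
  | cons a L ih =>
    simp only [List.map_cons, List.prod_cons]
    exact (h a (by simp)).mul (ih fun b hb => h b (by simp [hb]))

theorem ContConv.eventually_isUnit_det [TopologicalSpace P] {η : P} (h : ContConv (𝓝 η) F F₀)
    (hdet : ∀ t ∈ Icc (0 : ℝ) 1, IsUnit (F₀ t).det) :
    ∀ᶠ ξ in 𝓝 η, ∀ t ∈ Icc (0 : ℝ) 1, IsUnit (F ξ t).det := by
  refine eventually_forall_Icc (Q := fun ξ t => IsUnit (F ξ t).det) fun t₀ ht₀ => ?_
  exact ((h.det t₀ ht₀).eventually_ne (hdet t₀ ht₀).ne_zero).mono fun p hp => hp.isUnit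

theorem tendsto_contRep {Γ : Contour} [TopologicalSpace P] {η : P} {G : P → Fn Γ} {G₀ : Fn Γ}
    (hG : ∀ᶠ ξ in 𝓝 η, ∀ i, ContinuousOn (G ξ i) (Icc 0 1))
    (hG₀ : ∀ i, ContinuousOn (G₀ i) (Icc 0 1))
    (h : ∀ i, ContConv (𝓝 η) (fun ξ => G ξ i) (G₀ i)) :
    Tendsto (fun ξ => contRep (G ξ)) (𝓝 η) (𝓝 (contRep G₀)) := by
  rw [tendsto_iff_norm_sub_tendsto_zero, Metric.tendsto_nhds]
  intro ε hε
  have h1 := eventually_all.2 fun i =>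
    ContConv.eventually_norm_sub_lt (E := M2) (h i) (hG₀ i) (half_pos hε)
  filter_upwards [h1, hG] with ξ hξ hc
  rw [Real.dist_eq, sub_zero, abs_of_nonneg (norm_nonneg _)]
  refine lt_of_le_of_lt ((PC.norm_le_iff (half_pos hε).le).2 fun i t ht => ?_) (half_lt_self hε)
  have e : toFn (contRep (G ξ) - contRep G₀) i t = G ξ i t - G₀ i t := by
    rw [← toFn_contRep hc i ht, ← toFn_contRep hG₀ i ht]
    rfl
  rw [e]
  exact (hξ i t ht).le

end ContConv

/-! ### Dependence of the discrete solver on the parameter -/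

section Family

variable {ℓ : ℕ} {Ω : Fin ℓ → Contour} {m : ∀ i, NumericalMethod (Ω i)}

section Fixed

variable {a b : Fin ℓ → ℂ} {H : ∀ i, Fn (Ω i)}

/-- The recursion inserts 0 for the stages j ≥ i, which the jump matrix of stage i does not involve.
-/
theorem discreteU_eq_approx (n : Fin ℓ → ℕ) (i : Fin ℓ) :
    discreteU Ω a b m H n i = (m i).approx (n i) (discreteJump Ω a b m H n i) := by
  rw [discreteU]
  exact congrArg ((m i).approx (n i)) (stageJump_congr fun j hj => dif_pos hj)

theorem discreteU_congr {n n' : Fin ℓ → ℕ} (i : Fin ℓ) (h : ∀ j ≤ i, n j = n' j) :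
    discreteU Ω a b m H n i = discreteU Ω a b m H n' i := by
  induction i using WellFoundedLT.induction with
  | _ i ih =>
    have h1 : discreteJump Ω a b m H n i = discreteJump Ω a b m H n' i :=
      stageJump_congr fun j hj => ih j hj fun k hk => h k (hk.trans hj.le)
    rw [discreteU_eq_approx, discreteU_eq_approx, h1, h i le_rfl]

theorem stageSolvable_update {n : Fin ℓ → ℕ} {i : Fin ℓ} {k : ℕ}
    (hJ : JumpDefined Ω a b m H n i) (hk : (m i).Invertible k (discreteJump Ω a b m H n i)) :
    StageSolvable Ω a b m H (Function.update n i k) i := by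
  have hU : ∀ j < i, discreteU Ω a b m H (Function.update n i k) j = discreteU Ω a b m H n j :=
    fun j hj => discreteU_congr j fun k' hk' => Function.update_of_ne (hk'.trans_lt hj).ne _ _
  refine ⟨fun j hj x t ht => ?_, ?_⟩
  · rw [hU j hj]
    exact hJ j hj x t ht
  · rw [Function.update_self, discreteJump, stageJump_congr hU]
    exact hk

end Fixed

variable {α β : ℝ≥0 → Fin ℓ → ℂ}

/-- The evaluation point varies continuously with ξ and t and its limit is off `Ω j`, so
`tendsto_cauchyInt` applies. -/
theorem contConv_stagePhi (hΩ : ∀ i, (Ω i).IsPiecewiseSmooth) (hα : Continuous α)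
    (hβ : Continuous β) {η : ℝ≥0} (hsep : IsSeparated Ω (α η) (β η)) {i j : Fin ℓ} (hij : i ≠ j)
    {u : ℝ≥0 → PC (Ω j)} (hu : Tendsto u (𝓝 η) (𝓝 (u η))) (x : (Ω i).ι) :
    ContConv (𝓝 η) (fun ξ => stagePhi Ω (α ξ) (β ξ) j i (u ξ) x)
      (stagePhi Ω (α η) (β η) j i (u η) x) := by
  intro t₀ ht₀
  have hc : ∀ {c : ℝ≥0 → Fin ℓ → ℂ}, Continuous c → ∀ k, Tendsto (fun p : ℝ≥0 × ℝ => c p.1 k)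
      (𝓝 η ×ˢ 𝓝[Icc 0 1] t₀) (𝓝 (c η k)) := fun hc k =>
    (((continuous_apply k).comp hc).tendsto η).comp tendsto_fst
  have hγ : Tendsto (fun p : ℝ≥0 × ℝ => (Ω i).γ x p.2) (𝓝 η ×ˢ 𝓝[Icc 0 1] t₀)
      (𝓝 ((Ω i).γ x t₀)) :=
    ((((hΩ i).smooth x).continuous.tendsto t₀).mono_left nhdsWithin_le_nhds).comp tendsto_snd
  have hz := ((((hc hα i).mul hγ).add (hc hβ i)).sub (hc hβ j)).div (hc hα j) (hsep.ne_zero j)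
  have hB := (tendsto_iff_norm_sub_tendsto_zero.1 hu).comp
    (tendsto_fst (f := 𝓝 η) (g := 𝓝[Icc (0 : ℝ) 1] t₀))
  have h1 := tendsto_cauchyInt (E := M2) (hΩ j).smooth (v := fun p : ℝ≥0 × ℝ => toFn (u p.1))
    (continuous_toFn (u η)) (fun p => continuous_toFn (u p.1))
    (fun p k t ht => PC.norm_toFn_le (u p.1 - u η) k ht) hB hz
    (hsep.notMem_trace hij (Contour.mem_trace x ht₀))
  exact Tendsto.const_add (1 : M2) h1

theorem contConv_stageJump (hΩ : ∀ i, (Ω i).IsPiecewiseSmooth) (hα : Continuous α)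
    (hβ : Continuous β) {η : ℝ≥0} (hsep : IsSeparated Ω (α η) (β η))
    {H : ℝ≥0 → ∀ i, Fn (Ω i)} {i : Fin ℓ} {U : ℝ≥0 → ∀ j, PC (Ω j)}
    (hU : ∀ j < i, Tendsto (fun ξ => U ξ j) (𝓝 η) (𝓝 (U η j)))
    (hdet : ∀ j < i, ∀ x, ∀ t ∈ Icc (0 : ℝ) 1,
      IsUnit (stagePhi Ω (α η) (β η) j i (U η j) x t).det)
    (x : (Ω i).ι) (hH : ContConv (𝓝 η) (fun ξ => H ξ i x) (H η i x)) :
    ContConv (𝓝 η) (fun ξ => stageJump Ω (α ξ) (β ξ) (H ξ) i (U ξ) x)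
      (stageJump Ω (α η) (β η) (H η) i (U η) x) := by
  have hM : ContConv (𝓝 η) (fun ξ => stageMul Ω (α ξ) (β ξ) i (U ξ) x)
      (stageMul Ω (α η) (β η) i (U η) x) := by
    refine ContConv.list_prod _ fun j hj => ?_
    rw [List.mem_reverse, List.mem_filter] at hj
    have hji : j < i := by simpa using hj.2
    exact contConv_stagePhi hΩ hα hβ hsep hji.ne' (u := fun ξ => U ξ j) (hU j hji) x
  have h1 := (hM.mul hH).mul (hM.inv fun t ht => isUnit_det_stageMul fun j hj => hdet j hj x t ht)
  intro t ht
  simp only [stageJump_eq]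
  exact h1 t ht

/-- A continuous family of regular problems on disjoint contours, scaled and shifted to the
contours `Ω i`. -/
structure IsRegularFamily (Ω : Fin ℓ → Contour) (α β : ℝ≥0 → Fin ℓ → ℂ)
    (H : ℝ≥0 → ∀ i, Fn (Ω i)) : Prop where
  continuous_scale : Continuous α
  continuous_shift : Continuous β
  separated : ∀ ξ, IsSeparated Ω (α ξ) (β ξ)
  regular : ∀ ξ, ∃ G, IsOneRegular (Contour.scaledUnion Ω (α ξ) (β ξ)) G ∧
    ∀ i, H ξ i = scaledRestriction Ω (α ξ) (β ξ) G i
  continuous_jump : ∀ i η, Tendsto (fun ξ => LinfNorm (Ω i) (H ξ i - H η i)) (𝓝 η) (𝓝 0)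

namespace IsRegularFamily

variable {H : ℝ≥0 → ∀ i, Fn (Ω i)} (h : IsRegularFamily Ω α β H)

include h

theorem isOneRegular_stageJump (hΩ : ∀ i, (Ω i).IsPiecewiseSmooth) (ξ : ℝ≥0) (i : Fin ℓ)
    (U : ∀ j, PC (Ω j)) (hU : ∀ j < i, ∀ x, ∀ t ∈ Icc (0 : ℝ) 1,
      IsUnit (stagePhi Ω (α ξ) (β ξ) j i (U j) x t).det) :
    IsOneRegular (Ω i) (stageJump Ω (α ξ) (β ξ) (H ξ) i U) := by
  obtain ⟨G, hG, hHG⟩ := h.regular ξ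
  exact (h.separated ξ).isOneRegular_stageJump hΩ hG hHG i U hU

theorem contConv_jump (hΩ : ∀ i, (Ω i).IsPiecewiseSmooth) (η : ℝ≥0) (i : Fin ℓ) (x : (Ω i).ι) :
    ContConv (𝓝 η) (fun ξ => H ξ i x) (H η i x) := by
  have hcont : ∀ ξ, ContinuousOn (H ξ i x) (Icc 0 1) := fun ξ => by
    obtain ⟨G, hG, hHG⟩ := h.regular ξ
    rw [hHG i]
    exact LipUnit.continuousOn (E := M2)
      (((regular_scaledUnion (h.separated ξ) hΩ).isOneRegular_iff.1 hG).2.2 ⟨i, x⟩)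
  refine ContConv.of_enorm_le (E := M2) (h.continuous_jump i η) (fun ξ t ht => ?_) (hcont η)
  exact (hΩ i).toRegular.enorm_le_LinfNorm (f := H ξ i - H η i) x
    (ContinuousOn.sub (G := M2) (hcont ξ) (hcont η)) ht

/-- Strong induction on the stage. Convergence is kept in the maximum norm, in which
`discrete_perturbation` delivers it and in which the Cauchy integrals of the next stage use it. -/
theorem tendsto_discreteU (hΩ : ∀ i, (Ω i).IsPiecewiseSmooth) (hm : ∀ i, (m i).Admissible)
    {n : Fin ℓ → ℕ} (η : ℝ≥0) (i : Fin ℓ)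
    (hn : ∀ j ≤ i, ∀ G : Fn (Ω j), IsOneRegular (Ω j) G →
      Module.finrank ℂ (Submodule.span ℂ ((m j).Y (n j) G)) ≤
        Module.finrank ℂ (Submodule.span ℂ ((m j).X (n j))))
    (hη : ∀ j ≤ i, StageSolvable Ω (α η) (β η) m (H η) n j) :
    (∀ᶠ ξ in 𝓝 η, StageSolvable Ω (α ξ) (β ξ) m (H ξ) n i) ∧
      Tendsto (fun ξ => discreteU Ω (α ξ) (β ξ) m (H ξ) n i) (𝓝 η)
        (𝓝 (discreteU Ω (α η) (β η) m (H η) n i)) := by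
  induction i using WellFoundedLT.induction with
  | _ i ih =>
    have hU : ∀ j < i, Tendsto (fun ξ => discreteU Ω (α ξ) (β ξ) m (H ξ) n j) (𝓝 η)
        (𝓝 (discreteU Ω (α η) (β η) m (H η) n j)) := fun j hj =>
      (ih j hj (fun k hk => hn k (hk.trans hj.le)) fun k hk => hη k (hk.trans hj.le)).2
    obtain ⟨hJ, hinv⟩ := hη i le_rfl
    have hJev : ∀ᶠ ξ in 𝓝 η, JumpDefined Ω (α ξ) (β ξ) m (H ξ) n i := by
      refine eventually_all.2 fun j => ?_
      by_cases hj : j < i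
      · have := eventually_all.2 fun x => (contConv_stagePhi hΩ h.continuous_scale
          h.continuous_shift (h.separated η) hj.ne'
          (u := fun ξ => discreteU Ω (α ξ) (β ξ) m (H ξ) n j) (hU j hj) x).eventually_isUnit_det
          (hJ j hj x)
        exact this.mono fun ξ hξ _ => hξ
      · exact Eventually.of_forall fun ξ hj' => absurd hj' hj
    have hreg : ∀ ξ, JumpDefined Ω (α ξ) (β ξ) m (H ξ) n i →
        IsOneRegular (Ω i) (discreteJump Ω (α ξ) (β ξ) m (H ξ) n i) := fun ξ hξ =>
      h.isOneRegular_stageJump hΩ ξ i _ hξ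
    have hcont : ∀ ξ, JumpDefined Ω (α ξ) (β ξ) m (H ξ) n i → ∀ x,
        ContinuousOn (discreteJump Ω (α ξ) (β ξ) m (H ξ) n i x) (Icc 0 1) := fun ξ hξ x =>
      LipUnit.continuousOn (E := M2)
        (((hΩ i).toRegular.isOneRegular_iff.1 (hreg ξ hξ)).2.2 x)
    obtain ⟨K, hK⟩ := (hm i).bounded
    -- The dimension inequality is available only for 1-regular jump matrices, thus where the jump
    -- matrix is defined; by `hJev` this covers all ξ near η.
    have key := (m i).discrete_perturbation (hΩ i) (hK (n i)) (l := 𝓝 η)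
      (hJev.mono fun ξ hξ => hn i le_rfl _ (hreg ξ hξ)) (hJev.mono hcont) (hcont η hJ)
      (tendsto_contRep (hJev.mono hcont) (hcont η hJ) fun x =>
        contConv_stageJump hΩ h.continuous_scale h.continuous_shift (h.separated η) hU hJ x
          (h.contConv_jump hΩ η i x)) hinv
    refine ⟨hJev.and key.1, ?_⟩
    simp only [discreteU_eq_approx]
    exact key.2

end IsRegularFamily

end Family

end RH

end

/-! ### Solvability and continuity for the whole family. -/

theorem mainTheorem11 {ℓ : ℕ} (Ω : Fin ℓ → RH.Contour) (hΩ : ∀ i, (Ω i).IsPiecewiseSmooth)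
    (m : ∀ i, RH.NumericalMethod (Ω i)) (hm : ∀ i, (m i).Admissible) :
    ∃ N₀ : Fin ℓ → ℕ,
      ∀ (α β : ℝ≥0 → Fin ℓ → ℂ) (G : ∀ ξ, RH.Fn (RH.Contour.scaledUnion Ω (α ξ) (β ξ)))
        (H : ∀ (_ : ℝ≥0) (i : Fin ℓ), RH.Fn (Ω i)),
        (∀ ξ i, α ξ i ≠ 0) → Continuous α → Continuous β →
        (∀ ξ i j, i ≠ j → Disjoint ((fun k => α ξ i * k + β ξ i) '' (Ω i).trace)
          ((fun k => α ξ j * k + β ξ j) '' (Ω j).trace)) →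
        (∀ ξ, RH.IsOneRegular (RH.Contour.scaledUnion Ω (α ξ) (β ξ)) (G ξ)) →
        (∀ ξ i, H ξ i = RH.scaledRestriction Ω (α ξ) (β ξ) (G ξ) i) →
        (∀ i η, Tendsto (fun ξ => RH.LinfNorm (Ω i) (H ξ i - H η i)) (𝓝 η) (𝓝 0)) →
        -- at each parameter value, sufficiently large orders make the successive stages solvable
        (∀ ξ n i, (∀ j < i, RH.StageSolvable Ω (α ξ) (β ξ) m (H ξ) n j) →
          RH.JumpDefined Ω (α ξ) (β ξ) m (H ξ) n i →
          RH.WellPosed (Ω i) (RH.discreteJump Ω (α ξ) (β ξ) m (H ξ) n i) →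
          ∃ N : ℕ, ∀ k > N,
            RH.StageSolvable Ω (α ξ) (β ξ) m (H ξ) (Function.update n i k) i) ∧
        -- solvability persists near a parameter value, and the solution is continuous there
        (∀ (n : Fin ℓ → ℕ) i η, (∀ j ≤ i, N₀ j < n j) →
          (∀ j ≤ i, RH.StageSolvable Ω (α η) (β η) m (H η) n j) →
          (∀ᶠ ξ in 𝓝 η, ∀ j ≤ i, RH.StageSolvable Ω (α ξ) (β ξ) m (H ξ) n j) ∧
          Tendsto (fun ξ => RH.L2norm (Ω i)
            (RH.toFn (RH.discreteU Ω (α ξ) (β ξ) m (H ξ) n i) -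
              RH.toFn (RH.discreteU Ω (α η) (β η) m (H η) n i))) (𝓝 η) (𝓝 0)) := by
  classical
  -- The thresholds come from `square` alone, which is uniform in G; they are fixed before any
  -- family is given.
  choose N₀ hN₀ using fun i => (hm i).square
  refine ⟨N₀, fun α β G H hα0 hα hβ hdisj hG hH hcont => ?_⟩
  have h : RH.IsRegularFamily Ω α β H :=
    ⟨hα, hβ, fun ξ => ⟨hα0 ξ, hdisj ξ⟩, fun ξ => ⟨G ξ, hG ξ, hH ξ⟩, hcont⟩
  refine ⟨fun ξ n i _ hJ hwp => ?_, fun n i η hn hη => ?_⟩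
  · obtain ⟨_, _, _, _, _, _, htype⟩ := (hm i).type
    -- This N may depend on the jump matrix, hence on ξ and on the orders of the earlier stages.
    obtain ⟨N, hN⟩ := htype _ (h.isOneRegular_stageJump hΩ ξ i _ hJ) hwp
    exact ⟨N, fun k hk => RH.stageSolvable_update hJ (hN k hk).1⟩
  · have key := fun j (hj : j ≤ i) => h.tendsto_discreteU hΩ hm (n := n) η j
      (fun k hk => hN₀ k (n k) (hn k (hk.trans hj))) fun k hk => hη k (hk.trans hj)
    refine ⟨eventually_all.2 fun j => ?_, ?_⟩
    · by_cases hj : j ≤ i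
      · exact (key j hj).1.mono fun ξ hξ _ => hξ
      · exact Eventually.of_forall fun ξ hj' => absurd hj' hj
    · obtain ⟨C, hC, hbd⟩ := (hΩ i).toRegular.exists_L2norm_le
      have h1 := ((key i le_rfl).2.sub_const (RH.discreteU Ω (α η) (β η) m (H η) n i)).enorm
      rw [sub_self, enorm_zero] at h1
      have h2 := ENNReal.Tendsto.const_mul h1 (Or.inr hC)
      rw [mul_zero] at h2
      exact tendsto_of_tendsto_of_tendsto_of_le_of_le tendsto_const_nhds h2 (fun _ => zero_le)
        fun ξ => by
          rw [← RH.toFn_sub]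
          exact hbd _
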